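/- For $q\in\mathbb C$ with $0<|q|<1$ write $(x;q)_n=\prod_{j=0}^{n-1}(1-xq^j)$, $(x;q)_\infty=\prod_{j\ge 0}(1-xq^j)$, $(x_1,\dots,x_m;q)_\nu=\prod_i(x_i;q)_\nu$, $\Omega_q=\{q^{-k}:k=0,1,2,\dots\}$, and $$ {}_{10}W_9(b;c_1,\dots,c_7;q,z)=\sum_{k=0}^\infty\frac{(q\sqrt b,-q\sqrt b,b,c_1,\dots,c_7;q)_k}{(q,\sqrt b,-\sqrt b,qb/c_1,\dots,qb/c_7;q)_k}\,z^k . $$ For a function $f(x_1,\dots,x_n)$ let $\mathbb I_{x_1;x_2,\dots,x_n}f(x_1,\dots,x_n)$ be the sum of $f(x_1,\dots,x_n)$ and of the $n-1$ expressions obtained from it by interchanging $x_1$ with $x_k$, $k=2,\dots,n$. Write $a_{ij}=a_ia_j$ and $a_{123456}=a_1a_2a_3a_4a_5a_6$. Let $q\in\mathbb C$ with $0<|q|<1$ and let $a_1,\dots,a_6,\lambda,\mu$ be nonzero complex numbers with $\lambda\mu=a_{123456}$. Suppose that no denominator below vanishes, that is, none of the numbers $a_ia_j$ and $a_j/a_i$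 ($i\neq j$), $\pm a_i$, $\lambda a_i$, $\mu a_i$, $\lambda^2$, $\mu^2$, $\lambda/\mu$, $\mu/\lambda$ lies in $\Omega_q$, and $\lambda^2\ne q$, $\mu^2\neq q$. Then all the series below converge absolutely, and $$ \mathop{\mathbb I}_{a_1;a_2,\dots,a_6} \frac{\left(a_1^{-2},a_1\lambda,a_1\mu,\frac{\lambda}{a_1},\frac{\mu}{a_1};q\right)_\infty} {\left(a_{12},\dots,a_{16},\frac{a_2}{a_1},\dots,\frac{a_6}{a_1};q\right)_\infty}\; {}_{10}W_9\!\left(a_1^2;a_{12},\dots,a_{16},\frac{qa_1}{\lambda},\frac{qa_1}{\mu};q,q\right) $$ $$ =2\mathop{\mathbb I}_{\lambda;\mu} \frac{\left(\lambda a_1,\dots,\lambda a_6,\frac{\mu}{a_1},\dots,\frac{\mu}{a_6};q\right)_\infty} {\left(\lambda^2,\frac{\mu}{\lambda};q\right)_\infty\prod_{1\le i<j\le 6}(a_{ij};q)_\infty}\; {}_{10}W_9\!\left(\frac{\lambda^2}{q};\frac{\lambda}{a_1},\dots,\frac{\lambda}{a_6},\frac{a_{123456}}{q};q,q\right). $$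 -/

import Mathlib

noncomputable section

namespace BasicHyp

/-- The set `Ω_q = {q^{-k} : k = 0, 1, 2, …}`. -/
def Omega (q : ℂ) : Set ℂ := {x | ∃ k : ℕ, x = (q ^ k)⁻¹}

/-- The `q`-shifted factorial `(x; q)_n = (1 - x)(1 - x q) ⋯ (1 - x q^{n-1})`. -/
def qPoch (x q : ℂ) (n : ℕ) : ℂ := ∏ j ∈ Finset.range n, (1 - x * q ^ j)

/-- The infinite `q`-shifted factorial `(x; q)_∞ = ∏_{n ≥ 0} (1 - x q^n)`. -/
def qPochInf (x q : ℂ) : ℂ := ∏' n : ℕ, (1 - x * q ^ n)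

/-- For `|q| < 1` the infinite product defining `(x; q)_∞` converges. -/
theorem multipliable_qPochInf (x q : ℂ) (hq : ‖q‖ < 1) :
    Multipliable fun n : ℕ => 1 - x * q ^ n := by
  have h : Summable fun n : ℕ => ‖-(x * q ^ n)‖ := by
    simp only [norm_neg, norm_mul, norm_pow]
    exact (summable_geometric_of_lt_one (norm_nonneg q) hq).mul_left _
  simpa [sub_eq_add_neg] using multipliable_one_add_of_summable h

/-- `(x₁, …, x_m; q)_n = (x₁; q)_n ⋯ (x_m; q)_n`. -/
def qPochs (xs : List ℂ) (q : ℂ) (n : ℕ) : ℂ := (xs.map fun x => qPoch x q n).prod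

/-- `(x₁, …, x_m; q)_∞ = (x₁; q)_∞ ⋯ (x_m; q)_∞`. -/
def qPochInfs (xs : List ℂ) (q : ℂ) : ℂ := (xs.map fun x => qPochInf x q).prod

/-- The `k`-th term of the basic hypergeometric series with numerator parameters `as` and
denominator parameters `bs`; with `r + 1` numerator and `s` denominator parameters the exponent
`s - r` is `s + 1 - (r + 1)`. -/
def phiTerm (as bs : List ℂ) (q z : ℂ) (k : ℕ) : ℂ :=
  qPochs as q k / qPochs (q :: bs) q k *
    ((-1) ^ k * q ^ (k.choose 2)) ^ ((bs.length : ℤ) + 1 - (as.length : ℤ)) * z ^ k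

/-- The `k`-th term of the very-well-poised series `W(b; as; q, z)`: the numerator parameters are
`±q√b, b, as` and the denominator parameters `±√b, qb/a` for `a` in `as`. It does not depend on the
choice of the square root. -/
def vwpTerm (b : ℂ) (as : List ℂ) (q z : ℂ) (k : ℕ) : ℂ :=
  phiTerm ([q * Complex.sqrt b, -(q * Complex.sqrt b), b] ++ as)
    ([Complex.sqrt b, -Complex.sqrt b] ++ as.map fun x => q * b / x) q z k

/-- The very-well-poised basic hypergeometric series `W(b; as; q, z)`; it is a `₁₀W₉` if `as` has
seven entries. -/
def vwpW (b : ℂ) (as : List ℂ) (q z : ℂ) : ℂ := ∑' k : ℕ, vwpTerm b as q z k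

/-- The symmetric sum `f(x₁, …, x_n) + idem(x₁; x₂, …, x_n)`: the sum of the values of `f` at the
`n` tuples obtained by interchanging the first entry with the `k`-th one. -/
def idemSum {n : ℕ} (f : (Fin (n + 1) → ℂ) → ℂ) (x : Fin (n + 1) → ℂ) : ℂ :=
  ∑ k : Fin (n + 1), f (x ∘ Equiv.swap 0 k)

/-- `a₁a₂, …, a₁a₆, q a₁/λ, q a₁/μ`. -/
def sixParams (q lam mu : ℂ) (a : Fin 6 → ℂ) : List ℂ :=
  (List.ofFn fun j : Fin 5 => a 0 * a j.succ) ++ [q * a 0 / lam, q * a 0 / mu]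

/-- The function of `(a₁, …, a₆)` that is symmetrized on the left-hand side. -/
def sixTerm (q lam mu : ℂ) (a : Fin 6 → ℂ) : ℂ :=
  qPochInfs [(a 0 ^ 2)⁻¹, a 0 * lam, a 0 * mu, lam / a 0, mu / a 0] q /
      qPochInfs ((List.ofFn fun j : Fin 5 => a 0 * a j.succ) ++
        List.ofFn fun j : Fin 5 => a j.succ / a 0) q *
    vwpW (a 0 ^ 2) (sixParams q lam mu a) q q

/-- `l/a₁, …, l/a₆, a₁a₂a₃a₄a₅a₆/q`. -/
def twoParams (q : ℂ) (a : Fin 6 → ℂ) (l : ℂ) : List ℂ :=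
  (List.ofFn fun i : Fin 6 => l / a i) ++ [(∏ i, a i) / q]

/-- The function of `(l 0, l 1) = (λ, μ)` that is symmetrized on the right-hand side. -/
def twoTerm (q : ℂ) (a : Fin 6 → ℂ) (l : Fin 2 → ℂ) : ℂ :=
  qPochInfs ((List.ofFn fun i : Fin 6 => l 0 * a i) ++ List.ofFn fun i : Fin 6 => l 1 / a i) q /
      ((∏ i : Fin 6, ∏ j ∈ Finset.Ioi i, qPochInf (a i * a j) q) *
        qPochInfs [l 0 ^ 2, l 1 / l 0] q) *
    vwpW (l 0 ^ 2 / q) (twoParams q a (l 0)) q q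

end BasicHyp

end

/-! Write φ(x) for (x;q)_∞ and let I be the average over |z| = 1 of
φ(z²)φ(z⁻²)φ(λz)φ(λ/z)φ(μz)φ(μ/z) / ∏ φ(a_i z)φ(a_i/z) (`sixInt`), where λμ = a₁⋯a₆. The two sides
of the theorem are two evaluations of I.

Left side. When the circle is shrunk to radius |q|^N, the integrand decays like |q|^N, because the
balancing condition makes all other powers cancel. Hence φ(q) I is the sum of the residues at the
points a_i q^k. For fixed i these form one very-well-poised series (`qPochInf_mul_sixInt`).

Right side. Two evaluations are needed, both obtained by the same method: a contiguous relation
whose defect is a q-difference, iteration to infinity, and a limit. One is Rahman's five-parameter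
integral (`rahmanInt_eq`). The other is Bailey's nonterminating form of Jackson's sum, a balanced
two-term sum with four parameters (`BailGen.bailSum_eq`). Bailey's sum expands the integrand of I
into Rahman integrands whose first parameter is xq^k or yq^k, for any chosen pair x, y of the six
parameters. Integrating termwise makes I a two-term sum attached to that pair
(`sixInt_mul_eq_crossSum`).

This sum is not yet the one wanted. With e² = a₁a₂a₃a₄, however, the sum for the pair a₂, a₁
coincides, up to products, with the sum for another integral I', whose parameters are e/a₁, …, e/a₄,
λ/e, μ/e and whose numerator parameters are a₆e, a₅e. Thus I and I' are proportional, and expanding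
I' along the pair λ/e, μ/e produces the right side (`sixInt_mul_eq_bailSum`).

All this is done for |a_i| = ρ and |λ| = |μ| = ρ³ with |q| < ρ⁶ < 1, where every nondegeneracy
condition can be read off from absolute values. Any admissible parameters are joined to that region
by a one-parameter holomorphic family that preserves the balancing condition. The identity theorem
off the zeros of an entire function then gives the general case (`sum_tsum_sixCoef`). -/

noncomputable section

open Filter Topology Complex

namespace BasicHyp

/-! ### Finite and infinite q-shifted factorials -/

section Basics

variable {q : ℂ}

local notation "φ" x:max => qPochInf x q

@[simp] theorem qPochInf_zero_left : φ 0 = 1 := by simp [qPochInf]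

@[simp] theorem qPoch_zero_right (x : ℂ) : qPoch x q 0 = 1 := by simp [qPoch]

theorem qPoch_succ (x : ℂ) (n : ℕ) : qPoch x q (n + 1) = qPoch x q n * (1 - x * q ^ n) := by
  simp [qPoch, Finset.prod_range_succ]

theorem qPoch_succ' (x : ℂ) (n : ℕ) : qPoch x q (n + 1) = (1 - x) * qPoch (x * q) q n := by
  rw [qPoch, Finset.prod_range_succ', qPoch, mul_comm]
  simp [pow_succ', mul_assoc]

theorem tendsto_qPoch (hq : ‖q‖ < 1) (x : ℂ) :
    Tendsto (qPoch x q) atTop (𝓝 (φ x)) :=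
  (multipliable_qPochInf x q hq).hasProd.tendsto_prod_nat

theorem qPochInf_step (hq : ‖q‖ < 1) (x : ℂ) : φ x = (1 - x) * φ (x * q) := by
  have h1 := (tendsto_qPoch hq x).comp (tendsto_add_atTop_nat 1)
  have h2 := (tendsto_qPoch hq (x * q)).const_mul (1 - x)
  refine tendsto_nhds_unique h1 (h2.congr fun n => ?_)
  simp [qPoch_succ']

theorem qPochInf_eq_qPoch_mul (hq : ‖q‖ < 1) (x : ℂ) (n : ℕ) :
    φ x = qPoch x q n * φ (x * q ^ n) := by
  induction n with
  | zero => simp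
  | succ n ih => rw [ih, qPochInf_step hq (x * q ^ n), qPoch_succ, pow_succ]; ring_nf

theorem qPochInf_ne_zero (hq0 : q ≠ 0) (hq : ‖q‖ < 1) {x : ℂ} (hx : x ∉ Omega q) : φ x ≠ 0 := by
  have := tprod_one_add_ne_zero_of_summable (f := fun n : ℕ => -(x * q ^ n)) ?_ ?_
  · simpa [qPochInf, sub_eq_add_neg] using this
  · intro n h
    apply hx
    refine ⟨n, ?_⟩
    have hn : q ^ n ≠ 0 := pow_ne_zero _ hq0
    field_simp
    linear_combination -h
  · simp only [norm_neg, norm_mul, norm_pow]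
    exact (summable_geometric_of_lt_one (norm_nonneg q) hq).mul_left _

theorem qPochInf_ne_zero_iff (hq0 : q ≠ 0) (hq : ‖q‖ < 1) {x : ℂ} : φ x ≠ 0 ↔ x ∉ Omega q := by
  refine ⟨?_, qPochInf_ne_zero hq0 hq⟩
  rintro h ⟨n, hn⟩
  apply h
  rw [qPochInf_eq_qPoch_mul hq x (n + 1), qPoch_succ, hn,
    inv_mul_cancel₀ (pow_ne_zero _ hq0)]
  simp

theorem not_mem_Omega_of_norm_lt_one (hq0 : q ≠ 0) (hq : ‖q‖ < 1) {x : ℂ} (hx : ‖x‖ < 1) :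
    x ∉ Omega q := by
  rintro ⟨n, rfl⟩
  rw [norm_inv, norm_pow] at hx
  have h1 : ‖q‖ ^ n ≤ 1 := pow_le_one₀ (norm_nonneg _) hq.le
  have h2 : 0 < ‖q‖ ^ n := pow_pos (norm_pos_iff.2 hq0) _
  have := (one_le_inv₀ h2).2 h1
  linarith

theorem norm_qPoch_le (hq : ‖q‖ < 1) {x : ℂ} {r : ℝ} (hx : ‖x‖ ≤ r) (n : ℕ) :
    ‖qPoch x q n‖ ≤ Real.exp (r / (1 - ‖q‖)) := by
  have hr : 0 ≤ r := (norm_nonneg x).trans hx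
  have h1 : ‖qPoch x q n‖ ≤ ∏ j ∈ Finset.range n, Real.exp (r * ‖q‖ ^ j) := by
    rw [qPoch, norm_prod]
    refine Finset.prod_le_prod (fun _ _ => norm_nonneg _) fun j _ => ?_
    calc ‖1 - x * q ^ j‖ ≤ ‖(1 : ℂ)‖ + ‖x * q ^ j‖ := norm_sub_le _ _
      _ ≤ r * ‖q‖ ^ j + 1 := by
        rw [norm_one, norm_mul, norm_pow]
        have : ‖x‖ * ‖q‖ ^ j ≤ r * ‖q‖ ^ j := by gcongr
        linarith
      _ ≤ _ := Real.add_one_le_exp _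
  refine h1.trans ?_
  rw [← Real.exp_sum, ← Finset.mul_sum, Real.exp_le_exp, div_eq_mul_inv]
  gcongr
  rw [← tsum_geometric_of_lt_one (norm_nonneg q) hq]
  exact (summable_geometric_of_lt_one (norm_nonneg q) hq).sum_le_tsum _
    fun _ _ => by positivity

theorem norm_qPochInf_le (hq : ‖q‖ < 1) {x : ℂ} {r : ℝ} (hx : ‖x‖ ≤ r) :
    ‖φ x‖ ≤ Real.exp (r / (1 - ‖q‖)) :=
  le_of_tendsto (tendsto_qPoch hq x).norm (Eventually.of_forall fun n => norm_qPoch_le hq hx n)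

theorem differentiable_qPochInf (hq : ‖q‖ < 1) : Differentiable ℂ fun x => φ x := by
  have key : HasProdLocallyUniformlyOn (fun (n : ℕ) (x : ℂ) => 1 + -(x * q ^ n))
      (fun x => ∏' n : ℕ, (1 + -(x * q ^ n))) Set.univ := by
    apply hasProdLocallyUniformlyOn_of_forall_compact isOpen_univ
    intro K _ hK
    obtain ⟨C, hC⟩ := hK.isBounded.exists_norm_le
    refine Summable.hasProdUniformlyOn_nat_one_add (u := fun n => C * ‖q‖ ^ n) hK
      ((summable_geometric_of_lt_one (norm_nonneg q) hq).mul_left _)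
      (.of_forall fun n x hx => ?_) (fun n => by fun_prop)
    rw [norm_neg, norm_mul, norm_pow]
    gcongr
    exact hC x hx
  have h2 := key.differentiableOn (.of_forall fun s => by
    simpa [Finset.prod_fn] using DifferentiableOn.fun_finsetProd (fun _ _ => by fun_prop)) isOpen_univ
  rw [← differentiableOn_univ]
  simpa [qPochInf, sub_eq_add_neg] using h2

theorem continuous_qPochInf (hq : ‖q‖ < 1) : Continuous fun x => φ x :=
  (differentiable_qPochInf hq).continuous

theorem differentiable_qPoch (n : ℕ) : Differentiable ℂ fun x => qPoch x q n := by
  unfold qPoch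
  fun_prop

/-- Positive powers of `q` are bounded away from the zeros uniformly. -/
theorem exists_le_norm_qPochInf_mul_pow (hq0 : q ≠ 0) (hq : ‖q‖ < 1) {x : ℂ} (hx : x ∉ Omega q) :
    ∃ c > 0, ∀ n : ℕ, c ≤ ‖φ (x * q ^ n)‖ := by
  have hpos : 0 < ‖φ x‖ := norm_pos_iff.2 (qPochInf_ne_zero hq0 hq hx)
  refine ⟨‖φ x‖ / Real.exp (‖x‖ / (1 - ‖q‖)), by positivity, fun n => ?_⟩
  rw [div_le_iff₀ (Real.exp_pos _)]
  conv_lhs => rw [qPochInf_eq_qPoch_mul hq x n, norm_mul, mul_comm]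
  gcongr
  exact norm_qPoch_le hq le_rfl n

/-- The finite product is φ(x)/φ(xqⁿ), and the denominator is bounded above uniformly in n. -/
theorem exists_le_norm_qPoch (hq0 : q ≠ 0) (hq : ‖q‖ < 1) {x : ℂ} (hx : x ∉ Omega q) :
    ∃ c > 0, ∀ n : ℕ, c ≤ ‖qPoch x q n‖ := by
  have hpos : 0 < ‖φ x‖ := norm_pos_iff.2 (qPochInf_ne_zero hq0 hq hx)
  refine ⟨‖φ x‖ / Real.exp (‖x‖ / (1 - ‖q‖)), by positivity, fun n => ?_⟩
  rw [div_le_iff₀ (Real.exp_pos _)]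
  conv_lhs => rw [qPochInf_eq_qPoch_mul hq x n, norm_mul]
  gcongr
  refine norm_qPochInf_le hq ?_
  rw [norm_mul, norm_pow]
  exact mul_le_of_le_one_right (norm_nonneg _) (pow_le_one₀ (norm_nonneg _) hq.le)

/-- The quadratic transformation `(x²; q)_∞ = (x, -x, √q x, -√q x; q)_∞`. -/
theorem qPochInf_sq (hq : ‖q‖ < 1) {p : ℂ} (hp : p ^ 2 = q) (x : ℂ) :
    φ (x ^ 2) = φ x * φ (-x) * φ (p * x) * φ (-(p * x)) := by
  have h1 := (((tendsto_qPoch hq x).mul (tendsto_qPoch hq (-x))).mul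
    (tendsto_qPoch hq (p * x))).mul (tendsto_qPoch hq (-(p * x)))
  -- Along even lengths the identity already holds for finite products: even exponents give (1 -
  -- xqⁱ)(1 + xqⁱ), odd ones give (1 - pxqⁱ)(1 + pxqⁱ).
  have h2 : Tendsto (fun n => qPoch (x ^ 2) q (2 * n)) atTop (𝓝 (φ (x ^ 2))) :=
    (tendsto_qPoch hq (x ^ 2)).comp (tendsto_id.const_mul_atTop' (by norm_num))
  refine tendsto_nhds_unique h2 (h1.congr fun n => ?_)
  induction n with
  | zero => simp
  | succ n ih =>
    rw [show 2 * (n + 1) = 2 * n + 1 + 1 by ring]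
    simp only [qPoch_succ]
    rw [← ih, ← hp]
    ring

end Basics

/-- `(xz, x/z; q)_∞`. -/
def qPochPM (x z q : ℂ) : ℂ := qPochInf (x * z) q * qPochInf (x / z) q

/-- The integrand of the five-parameter Rahman integral. -/
def rahmanFun (q a b c d e z : ℂ) : ℂ :=
  qPochInf (z ^ 2) q * qPochInf (z ^ 2)⁻¹ q * qPochPM (a * b * c * d * e) z q /
    (qPochPM a z q * qPochPM b z q * qPochPM c z q * qPochPM d z q * qPochPM e z q)

/-- The five-parameter Rahman integral over the unit circle. -/
def rahmanInt (q a b c d e : ℂ) : ℂ := Real.circleAverage (rahmanFun q a b c d e) 0 1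

/-- The ratio of the Rahman integral and the product to which it is proportional. -/
def rahmanRatio (q a b c d e : ℂ) : ℂ :=
  rahmanInt q a b c d e *
    (qPochInf (a * b) q * qPochInf (a * c) q * qPochInf (a * d) q * qPochInf (a * e) q *
      qPochInf (b * c) q * qPochInf (b * d) q * qPochInf (b * e) q * qPochInf (c * d) q *
      qPochInf (c * e) q * qPochInf (d * e) q) /
    (qPochInf (b * c * d * e) q * qPochInf (a * c * d * e) q * qPochInf (a * b * d * e) q *
      qPochInf (a * b * c * e) q * qPochInf (a * b * c * d) q)

/-! ### Rahman's integral: the contiguous relation -/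

section Rahman

variable {q : ℂ}

local notation "φ" x:max => qPochInf x q

theorem circleAverage_comp_mul_left (G : ℂ → ℂ) :
    Real.circleAverage (fun z => G (q * z)) 0 1 = Real.circleAverage G 0 ‖q‖ := by
  -- Starting the parametrization at angle arg q absorbs the rotation by q/|q|, so only the radius
  -- changes.
  rw [Real.circleAverage_eq_integral_add (R := ‖q‖) q.arg, Real.circleAverage_def]
  congr 2
  ext θ
  congr 1
  have := norm_mul_exp_arg_mul_I q
  simp only [circleMap, ofReal_add, add_mul, Complex.exp_add, ofReal_one, zero_add, one_mul]
  linear_combination (-exp (θ * I)) * this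

/-- Cauchy's theorem on the annulus |q| ≤ |z| ≤ 1, applied to G(z)/z: the averages over the two
boundary circles agree. -/
theorem circleAverage_comp_mul_left_eq (hq0 : q ≠ 0) (hq : ‖q‖ < 1) {G : ℂ → ℂ}
    (hG : ∀ z, ‖q‖ ≤ ‖z‖ → ‖z‖ ≤ 1 → DifferentiableAt ℂ G z) :
    Real.circleAverage (fun z => G (q * z)) 0 1 = Real.circleAverage G 0 1 := by
  have hpos := norm_pos_iff.2 hq0
  rw [circleAverage_comp_mul_left, Real.circleAverage_eq_circleIntegral one_ne_zero,
    Real.circleAverage_eq_circleIntegral hpos.ne',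
    circleIntegral_sub_center_inv_smul_eq_of_differentiable_on_annulus_off_countable hpos hq.le
      Set.countable_empty]
  · intro z hz
    simp only [Set.mem_sdiff, Metric.mem_closedBall, Metric.mem_ball, dist_zero_right, not_lt] at hz
    exact (hG z hz.2 hz.1).continuousAt.continuousWithinAt
  · intro z hz
    simp only [Set.mem_sdiff, Metric.mem_closedBall, Metric.mem_ball, dist_zero_right, not_le] at hz
    exact hG z hz.1.2.le hz.1.1.le

theorem qPochInf_ne_zero_of_norm_lt_one (hq0 : q ≠ 0) (hq : ‖q‖ < 1) {x : ℂ} (hx : ‖x‖ < 1) :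
    φ x ≠ 0 :=
  qPochInf_ne_zero hq0 hq (not_mem_Omega_of_norm_lt_one hq0 hq hx)

theorem qPochPM_ne_zero (hq0 : q ≠ 0) (hq : ‖q‖ < 1) {x z : ℂ} (hx : ‖x‖ < 1) (hz : ‖z‖ = 1) :
    qPochPM x z q ≠ 0 :=
  mul_ne_zero (qPochInf_ne_zero_of_norm_lt_one hq0 hq (by simpa [hz] using hx))
    (qPochInf_ne_zero_of_norm_lt_one hq0 hq (by simpa [hz] using hx))

theorem qPochPM_step (hq : ‖q‖ < 1) (x z : ℂ) :
    qPochPM x z q = (1 - x * z) * (1 - x / z) * qPochPM (x * q) z q := by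
  rw [qPochPM, qPochPM, qPochInf_step hq (x * z), qPochInf_step hq (x / z)]
  ring_nf

theorem differentiableAt_qPochPM (hq : ‖q‖ < 1) (x : ℂ) {z : ℂ} (hz : z ≠ 0) :
    DifferentiableAt ℂ (fun z => qPochPM x z q) z := by
  have h := differentiable_qPochInf hq
  unfold qPochPM
  exact (h.differentiableAt.comp z (by fun_prop : DifferentiableAt ℂ (fun z => x * z) z)).mul
    (h.differentiableAt.comp z (by fun_prop (disch := assumption) :
      DifferentiableAt ℂ (fun z => x / z) z))

theorem differentiableAt_qPochInf_comp (hq : ‖q‖ < 1) {g : ℂ → ℂ} {z : ℂ}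
    (hg : DifferentiableAt ℂ g z) : DifferentiableAt ℂ (fun z => φ (g z)) z :=
  (differentiable_qPochInf hq).differentiableAt.comp z hg

theorem circleIntegrable_of_differentiableAt {f : ℂ → ℂ}
    (hf : ∀ z, ‖z‖ = 1 → DifferentiableAt ℂ f z) : CircleIntegrable f 0 1 := by
  refine ContinuousOn.circleIntegrable zero_le_one fun z hz => ?_
  exact (hf z (by simpa using hz)).continuousAt.continuousWithinAt

theorem ne_zero_of_norm_eq_one {z : ℂ} (hz : ‖z‖ = 1) : z ≠ 0 := by
  rintro rfl; simp at hz

theorem differentiableAt_rahmanFun (hq0 : q ≠ 0) (hq : ‖q‖ < 1) {a b c d e z : ℂ}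
    (ha : ‖a‖ < 1) (hb : ‖b‖ < 1) (hc : ‖c‖ < 1) (hd : ‖d‖ < 1) (he : ‖e‖ < 1) (hz : ‖z‖ = 1) :
    DifferentiableAt ℂ (rahmanFun q a b c d e) z := by
  have hz0 := ne_zero_of_norm_eq_one hz
  have hz2 : z ^ 2 ≠ 0 := pow_ne_zero _ hz0
  have h1 := differentiableAt_qPochInf_comp hq (by fun_prop : DifferentiableAt ℂ (fun z => z ^ 2) z)
  have h2 := differentiableAt_qPochInf_comp hq
    (by fun_prop (disch := assumption) : DifferentiableAt ℂ (fun z => (z ^ 2)⁻¹) z)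
  have h (x : ℂ) := differentiableAt_qPochPM hq x hz0
  have hn {x : ℂ} (hx : ‖x‖ < 1) := qPochPM_ne_zero hq0 hq hx hz
  unfold rahmanFun
  refine ((h1.mul h2).mul (h _)).div (((((h a).mul (h b)).mul (h c)).mul (h d)).mul (h e)) ?_
  simp [hn ha, hn hb, hn hc, hn hd, hn he]

/-- The function whose `q`-difference is the defect in the contiguous relation for
`rahmanFun`. -/
def rahmanAux (q a b c d e z : ℂ) : ℂ :=
  z * qPochInf (z ^ 2) q * qPochInf (q / z ^ 2) q * qPochInf (a * b * c * d * e * z) q *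
    qPochInf (a * b * c * d * e * q / z) q /
    (qPochInf (a * z) q * qPochInf (a * q / z) q * (qPochInf (b * z) q * qPochInf (b * q / z) q) *
      (qPochInf (c * z) q * qPochInf (c * q / z) q) *
      (qPochInf (d * z) q * qPochInf (d * q / z) q) *
      (qPochInf (e * z) q * qPochInf (e * q / z) q))

theorem differentiableAt_rahmanAux (hq0 : q ≠ 0) (hq : ‖q‖ < 1) {a b c d e z : ℂ}
    (ha : ‖a‖ < 1) (hb : ‖b‖ < 1) (hc : ‖c‖ < 1) (hd : ‖d‖ < 1) (he : ‖e‖ < 1)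
    (hz : ‖q‖ ≤ ‖z‖) (hz' : ‖z‖ ≤ 1) :
    DifferentiableAt ℂ (rahmanAux q a b c d e) z := by
  have hqp := norm_pos_iff.2 hq0
  have hzp : 0 < ‖z‖ := hqp.trans_le hz
  have hz0 : z ≠ 0 := norm_pos_iff.1 hzp
  have hz2 : z ^ 2 ≠ 0 := pow_ne_zero _ hz0
  have h1 := differentiableAt_qPochInf_comp hq (by fun_prop : DifferentiableAt ℂ (fun z => z ^ 2) z)
  have h2 := differentiableAt_qPochInf_comp hq
    (by fun_prop (disch := assumption) : DifferentiableAt ℂ (fun z => q / z ^ 2) z)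
  have h3 (x : ℂ) := differentiableAt_qPochInf_comp hq
    (by fun_prop : DifferentiableAt ℂ (fun z => x * z) z)
  have h4 (x : ℂ) := differentiableAt_qPochInf_comp hq
    (by fun_prop (disch := assumption) : DifferentiableAt ℂ (fun z => x * q / z) z)
  have hn {x : ℂ} (hx : ‖x‖ < 1) : φ (x * z) * φ (x * q / z) ≠ 0 := by
    refine mul_ne_zero (qPochInf_ne_zero_of_norm_lt_one hq0 hq ?_)
      (qPochInf_ne_zero_of_norm_lt_one hq0 hq ?_)
    · rw [norm_mul]
      exact mul_lt_one_of_nonneg_of_lt_one_left (norm_nonneg _) hx hz'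
    · rw [norm_div, norm_mul, div_lt_one hzp]
      refine lt_of_lt_of_le ?_ hz
      exact mul_lt_of_lt_one_left hqp hx
  unfold rahmanAux
  refine ((((differentiableAt_id.mul h1).mul h2).mul (h3 _)).mul (h4 _)).div
    ((((((h3 a).mul (h4 a)).mul ((h3 b).mul (h4 b))).mul ((h3 c).mul (h4 c))).mul
      ((h3 d).mul (h4 d))).mul ((h3 e).mul (h4 e))) ?_
  exact mul_ne_zero (mul_ne_zero (mul_ne_zero (mul_ne_zero (hn ha) (hn hb)) (hn hc)) (hn hd))
    (hn he)

/-- This is what remains of the contiguous relation for the integrand once the common infinite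
products are divided out. -/
theorem rahman_poly_identity {z : ℂ} (hz : z ≠ 0) (a b c d e : ℂ) :
    (1 - z ^ 2) * (1 - (z ^ 2)⁻¹) *
      ((1 - a * z) * (1 - a / z) * ((1 - a * c * d * e) * (1 - a * b * d * e) *
        (1 - a * b * c * e) * (1 - a * b * c * d)) -
        (1 - a * b) * (1 - a * c) * (1 - a * d) * (1 - a * e) *
        ((1 - a * b * c * d * e * z) * (1 - a * b * c * d * e / z))) =
    a * (1 - a * (a * b * c * d * e)) *
      (-z⁻¹ * (1 - (z ^ 2)⁻¹) * (1 - a * b * c * d * e / z) *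
          ((1 - a * z) * (1 - b * z) * (1 - c * z) * (1 - d * z) * (1 - e * z)) -
        z * (1 - z ^ 2) * (1 - a * b * c * d * e * z) *
          ((1 - a / z) * (1 - b / z) * (1 - c / z) * (1 - d / z) * (1 - e / z))) := by
  field_simp
  ring

theorem mul_contiguous {m n r s u v x y : ℂ} (K : ℂ) (h : s * (x * m - n * y) = r * (u - v)) :
    m * (K * (s * x)) - n * (K * (s * y)) = r * (K * u - K * v) := by
  linear_combination K * h

/-- Each of the four functions is a rational function times the same product `K`, so the relation
reduces to `rahman_poly_identity`. It is arranged so that the right side is a q-difference, which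
disappears on integration. -/
theorem rahmanFun_contiguous (hq0 : q ≠ 0) (hq : ‖q‖ < 1) {a b c d e z : ℂ}
    (ha : ‖a‖ < 1) (hb : ‖b‖ < 1) (hc : ‖c‖ < 1) (hd : ‖d‖ < 1) (he : ‖e‖ < 1) (hz : ‖z‖ = 1) :
    (1 - a * c * d * e) * (1 - a * b * d * e) * (1 - a * b * c * e) * (1 - a * b * c * d) *
        rahmanFun q (a * q) b c d e z -
      (1 - a * b) * (1 - a * c) * (1 - a * d) * (1 - a * e) * rahmanFun q a b c d e z =
    a * (1 - a * (a * b * c * d * e)) *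
      (rahmanAux q a b c d e (q * z) - rahmanAux q a b c d e z) := by
  have hz0 := ne_zero_of_norm_eq_one hz
  have hn {x : ℂ} (hx : ‖x‖ < 1) : (φ (x * z) * φ (x * q / z))⁻¹ =
        (qPochPM x z q)⁻¹ * (1 - x / z) ∧
      (φ (x * (q * z)) * φ (x * q / (q * z)))⁻¹ = (qPochPM x z q)⁻¹ * (1 - x * z) ∧
      (qPochPM (x * q) z q)⁻¹ = (qPochPM x z q)⁻¹ * ((1 - x * z) * (1 - x / z)) := by
    have h0 := qPochPM_ne_zero hq0 hq hx hz
    have h1 := qPochInf_step hq (x * z)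
    have h2 := qPochInf_step hq (x / z)
    have h3 := qPochPM_step hq x z
    rw [show x / z * q = x * q / z by ring] at h2
    rw [show x * z * q = x * (q * z) by ring] at h1
    rw [show x * q / (q * z) = x / z by field_simp]
    have h4 : qPochPM x z q = φ (x * z) * ((1 - x / z) * φ (x * q / z)) := by rw [← h2, qPochPM]
    have h5 : qPochPM x z q = (1 - x * z) * φ (x * (q * z)) * φ (x / z) := by rw [← h1, qPochPM]
    refine ⟨?_, ?_, ?_⟩
    · rw [inv_eq_iff_eq_inv, mul_inv, inv_inv, ← div_eq_mul_inv, eq_div_iff, h4]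
      · ring
      · rintro h; rw [h4, h] at h0; simp at h0
    · rw [inv_eq_iff_eq_inv, mul_inv, inv_inv, ← div_eq_mul_inv, eq_div_iff, h5]
      · ring
      · rintro h; rw [h5, h] at h0; simp at h0
    · rw [inv_eq_iff_eq_inv, mul_inv, inv_inv, ← div_eq_mul_inv, eq_div_iff, h3]
      · ring
      · rintro h; rw [h3, h] at h0; simp at h0
  obtain ⟨a1, a2, a3⟩ := hn ha
  obtain ⟨b1, b2, -⟩ := hn hb
  obtain ⟨c1, c2, -⟩ := hn hc
  obtain ⟨d1, d2, -⟩ := hn hd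
  obtain ⟨e1, e2, -⟩ := hn he
  set A := a * b * c * d * e with hA
  set K : ℂ := φ (z ^ 2 * q) * φ ((z ^ 2)⁻¹ * q) * (φ (A * (q * z)) * φ (A * q / z)) *
    ((qPochPM a z q)⁻¹ * (qPochPM b z q)⁻¹ * (qPochPM c z q)⁻¹ * (qPochPM d z q)⁻¹ *
      (qPochPM e z q)⁻¹) with hK
  have hA1 := qPochInf_step hq (A * z)
  have hA2 := qPochInf_step hq (A / z)
  rw [show A / z * q = A * q / z by ring] at hA2
  rw [show A * z * q = A * (q * z) by ring] at hA1
  have hf : rahmanFun q a b c d e z =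
      K * ((1 - z ^ 2) * (1 - (z ^ 2)⁻¹) * ((1 - A * z) * (1 - A / z))) := by
    rw [rahmanFun, ← hA, qPochInf_step hq (z ^ 2), qPochInf_step hq (z ^ 2)⁻¹, qPochPM, hA1, hA2,
      div_eq_mul_inv, mul_inv, mul_inv, mul_inv, mul_inv, hK]
    ring
  have hf' : rahmanFun q (a * q) b c d e z =
      K * ((1 - z ^ 2) * (1 - (z ^ 2)⁻¹) * ((1 - a * z) * (1 - a / z))) := by
    rw [rahmanFun, show a * q * b * c * d * e = A * q by rw [hA]; ring, qPochInf_step hq (z ^ 2),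
      qPochInf_step hq (z ^ 2)⁻¹, qPochPM, show A * q * z = A * (q * z) by ring,
      div_eq_mul_inv, mul_inv, mul_inv, mul_inv, mul_inv, a3, hK]
    ring
  have hG : rahmanAux q a b c d e z = K * (z * (1 - z ^ 2) * (1 - A * z) *
          ((1 - a / z) * (1 - b / z) * (1 - c / z) * (1 - d / z) * (1 - e / z))) := by
    rw [rahmanAux, ← hA, qPochInf_step hq (z ^ 2), show q / z ^ 2 = (z ^ 2)⁻¹ * q by field_simp,
      hA1, div_eq_mul_inv, mul_inv, mul_inv, mul_inv, mul_inv, a1, b1, c1, d1, e1, hK]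
    ring
  have hGq : rahmanAux q a b c d e (q * z) = K * (-z⁻¹ * (1 - (z ^ 2)⁻¹) * (1 - A / z) *
          ((1 - a * z) * (1 - b * z) * (1 - c * z) * (1 - d * z) * (1 - e * z))) := by
    -- Quasi-periodicity of φ(z²)φ(q/z²) under z ↦ qz: the factor 1 - z²q lost by one product is
    -- supplied by the other.
    have e1' : (1 - z ^ 2 * q) * φ ((q * z) ^ 2) = φ (z ^ 2 * q) := by
      rw [qPochInf_step hq (z ^ 2 * q)]; ring_nf
    have e2' : φ (q / (q * z) ^ 2) = (1 - z ^ 2 * q) *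
        (-(z ^ 2 * q)⁻¹ * (1 - (z ^ 2)⁻¹) * φ ((z ^ 2)⁻¹ * q)) := by
      rw [show q / (q * z) ^ 2 = (z ^ 2 * q)⁻¹ by field_simp, qPochInf_step hq (z ^ 2 * q)⁻¹,
        show (z ^ 2 * q)⁻¹ * q = (z ^ 2)⁻¹ by field_simp, qPochInf_step hq (z ^ 2)⁻¹]
      field_simp
      ring
    have e3 : q * z * φ ((q * z) ^ 2) * φ (q / (q * z) ^ 2) =
        -z⁻¹ * (1 - (z ^ 2)⁻¹) * (φ (z ^ 2 * q) * φ ((z ^ 2)⁻¹ * q)) := by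
      rw [← e1', e2']
      field_simp
    rw [rahmanAux, ← hA, e3, show A * q / (q * z) = A / z by field_simp, hA2, div_eq_mul_inv,
      mul_inv, mul_inv, mul_inv, mul_inv, a2, b2, c2, d2, e2, hK]
    ring
  have hpoly := rahman_poly_identity hz0 a b c d e
  rw [← hA] at hpoly
  rw [hf, hf', hG, hGq]
  exact mul_contiguous K hpoly

theorem mul_circleAverage (k : ℂ) (f : ℂ → ℂ) (c : ℂ) (R : ℝ) :
    k * Real.circleAverage f c R = Real.circleAverage (k • f) c R := by
  rw [Real.circleAverage_smul, smul_eq_mul]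

/-- The average of a q-difference of a function holomorphic on the closed annulus is zero, so the
pointwise relation becomes a first-order recurrence in a. -/
theorem rahmanInt_contiguous (hq0 : q ≠ 0) (hq : ‖q‖ < 1) {a b c d e : ℂ}
    (ha : ‖a‖ < 1) (hb : ‖b‖ < 1) (hc : ‖c‖ < 1) (hd : ‖d‖ < 1) (he : ‖e‖ < 1) :
    (1 - a * c * d * e) * (1 - a * b * d * e) * (1 - a * b * c * e) * (1 - a * b * c * d) *
        rahmanInt q (a * q) b c d e =
      (1 - a * b) * (1 - a * c) * (1 - a * d) * (1 - a * e) * rahmanInt q a b c d e := by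
  have haq : ‖a * q‖ < 1 := by
    rw [norm_mul]; exact mul_lt_one_of_nonneg_of_lt_one_left (norm_nonneg _) ha hq.le
  have i1 := circleIntegrable_of_differentiableAt fun z hz =>
    differentiableAt_rahmanFun hq0 hq haq hb hc hd he hz
  have i2 := circleIntegrable_of_differentiableAt fun z hz =>
    differentiableAt_rahmanFun hq0 hq ha hb hc hd he hz
  have d3 := fun z => differentiableAt_rahmanAux hq0 hq (z := z) ha hb hc hd he
  have i3 := circleIntegrable_of_differentiableAt fun z hz =>
    d3 z (by rw [hz]; exact hq.le) hz.le
  have i4 : CircleIntegrable (fun z => rahmanAux q a b c d e (q * z)) 0 1 := by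
    refine circleIntegrable_of_differentiableAt fun z hz => ?_
    have : DifferentiableAt ℂ (rahmanAux q a b c d e) (q * z) :=
      d3 _ (by simp [hz]) (by simpa [hz] using hq.le)
    exact this.comp z (by fun_prop)
  rw [← sub_eq_zero]
  rw [rahmanInt, rahmanInt, mul_circleAverage, mul_circleAverage,
    ← Real.circleAverage_sub (i1.const_smul) (i2.const_smul)]
  rw [Real.circleAverage_congr_sphere
    (f₂ := (a * (1 - a * (a * b * c * d * e))) • ((fun z => rahmanAux q a b c d e (q * z)) -
      rahmanAux q a b c d e))]
  · rw [Real.circleAverage_smul, Real.circleAverage_sub i4 i3,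
      circleAverage_comp_mul_left_eq hq0 hq d3, sub_self, smul_zero]
  · intro z hz
    exact rahmanFun_contiguous hq0 hq ha hb hc hd he (by simpa using hz)

/-- The product in the ratio obeys the same recurrence in a as the integral. -/
theorem rahmanRatio_mul_left (hq0 : q ≠ 0) (hq : ‖q‖ < 1) {a b c d e : ℂ}
    (ha : ‖a‖ < 1) (hb : ‖b‖ < 1) (hc : ‖c‖ < 1) (hd : ‖d‖ < 1) (he : ‖e‖ < 1) :
    rahmanRatio q (a * q) b c d e = rahmanRatio q a b c d e := by
  have key := rahmanInt_contiguous hq0 hq ha hb hc hd he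
  have hlt {x y : ℂ} (hx : ‖x‖ < 1) (hy : ‖y‖ < 1) : ‖x * y‖ < 1 := by
    rw [norm_mul]; exact mul_lt_one_of_nonneg_of_lt_one_left (norm_nonneg _) hx hy.le
  have hne {x : ℂ} (hx : ‖x‖ < 1) : φ x ≠ 0 ∧ 1 - x ≠ 0 ∧ φ (x * q) ≠ 0 := by
    have := qPochInf_ne_zero_of_norm_lt_one hq0 hq hx
    rw [qPochInf_step hq] at this
    exact ⟨qPochInf_ne_zero_of_norm_lt_one hq0 hq hx, left_ne_zero_of_mul this,
      right_ne_zero_of_mul this⟩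
  obtain ⟨n1, -, -⟩ := hne (hlt (hlt (hlt hb hc) hd) he)
  obtain ⟨-, m2, n2⟩ := hne (hlt (hlt (hlt ha hc) hd) he)
  obtain ⟨-, m3, n3⟩ := hne (hlt (hlt (hlt ha hb) hd) he)
  obtain ⟨-, m4, n4⟩ := hne (hlt (hlt (hlt ha hb) hc) he)
  obtain ⟨-, m5, n5⟩ := hne (hlt (hlt (hlt ha hb) hc) hd)
  rw [rahmanRatio, rahmanRatio, qPochInf_step hq (a * b), qPochInf_step hq (a * c),
    qPochInf_step hq (a * d), qPochInf_step hq (a * e), qPochInf_step hq (a * c * d * e),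
    qPochInf_step hq (a * b * d * e), qPochInf_step hq (a * b * c * e),
    qPochInf_step hq (a * b * c * d), show a * q * b = a * b * q by ring,
    show a * q * c = a * c * q by ring, show a * q * d = a * d * q by ring,
    show a * q * e = a * e * q by ring, show a * c * q * d * e = a * c * d * e * q by ring,
    show a * b * q * d * e = a * b * d * e * q by ring,
    show a * b * q * c * e = a * b * c * e * q by ring,
    show a * b * q * c * d = a * b * c * d * q by ring, div_eq_div_iff]
  · generalize rahmanInt q (a * q) b c d e = J' at *
    generalize rahmanInt q a b c d e = J at *
    generalize (1 - a * c * d * e) = y1 at *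
    generalize (1 - a * b * d * e) = y2 at *
    generalize (1 - a * b * c * e) = y3 at *
    generalize (1 - a * b * c * d) = y4 at *
    generalize (1 - a * b) = x1 at *
    generalize (1 - a * c) = x2 at *
    generalize (1 - a * d) = x3 at *
    generalize (1 - a * e) = x4 at *
    linear_combination (φ (a * b * q) * φ (a * c * q) * φ (a * d * q) * φ (a * e * q) *
      φ (b * c) * φ (b * d) * φ (b * e) * φ (c * d) * φ (c * e) * φ (d * e) *
      (φ (b * c * d * e) * φ (a * c * d * e * q) * φ (a * b * d * e * q) * φ (a * b * c * e * q) *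
        φ (a * b * c * d * q))) * key
  · simp [n1, n2, n3, n4, n5]
  · simp [n1, n2, n3, n4, n5, m2, m3, m4, m5]

theorem rahmanRatio_rotate (a b c d e : ℂ) :
    rahmanRatio q a b c d e = rahmanRatio q b c d e a := by
  have h : rahmanInt q a b c d e = rahmanInt q b c d e a := by
    unfold rahmanInt
    congr 1
    ext z
    simp only [rahmanFun]
    rw [show a * b * c * d * e = b * c * d * e * a by ring]
    ring
  simp only [rahmanRatio, h]
  ring_nf

/-- Shift the first parameter n times, rotate, and repeat; the cyclic symmetry brings each parameter
to the front once. -/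
theorem rahmanRatio_mul_pow (hq0 : q ≠ 0) (hq : ‖q‖ < 1) {a b c d e : ℂ}
    (ha : ‖a‖ < 1) (hb : ‖b‖ < 1) (hc : ‖c‖ < 1) (hd : ‖d‖ < 1) (he : ‖e‖ < 1) (n : ℕ) :
    rahmanRatio q (a * q ^ n) (b * q ^ n) (c * q ^ n) (d * q ^ n) (e * q ^ n) =
      rahmanRatio q a b c d e := by
  have hlt {x : ℂ} (hx : ‖x‖ < 1) (n : ℕ) : ‖x * q ^ n‖ < 1 := by
    rw [norm_mul, norm_pow]
    exact mul_lt_one_of_nonneg_of_lt_one_left (norm_nonneg _) hx (pow_le_one₀ (norm_nonneg _) hq.le)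
  have main {a b c d e : ℂ} (ha : ‖a‖ < 1) (hb : ‖b‖ < 1) (hc : ‖c‖ < 1) (hd : ‖d‖ < 1)
      (he : ‖e‖ < 1) (n : ℕ) :
      rahmanRatio q (a * q ^ n) b c d e = rahmanRatio q a b c d e := by
    induction n with
    | zero => simp
    | succ n ih =>
      rw [pow_succ, ← mul_assoc, rahmanRatio_mul_left hq0 hq (hlt ha n) hb hc hd he, ih]
  rw [main ha (hlt hb n) (hlt hc n) (hlt hd n) (hlt he n), rahmanRatio_rotate,
    main hb (hlt hc n) (hlt hd n) (hlt he n) ha, rahmanRatio_rotate,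
    main hc (hlt hd n) (hlt he n) ha hb, rahmanRatio_rotate,
    main hd (hlt he n) ha hb hc, rahmanRatio_rotate,
    main he ha hb hc hd, rahmanRatio_rotate]

end Rahman

/-! ### Rahman's integral: limit and normalization -/

section Rahman

variable {q : ℂ}

local notation "φ" x:max => qPochInf x q

theorem exists_le_norm_qPochInf (hq0 : q ≠ 0) (hq : ‖q‖ < 1) {ρ : ℝ} (hρ : ρ < 1) :
    ∃ c > 0, ∀ x : ℂ, ‖x‖ ≤ ρ → c ≤ ‖φ x‖ := by
  rcases lt_or_ge ρ 0 with h | h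
  · exact ⟨1, one_pos, fun x hx => absurd (norm_nonneg x) (by linarith)⟩
  obtain ⟨y, hy, hmin⟩ := (isCompact_closedBall (0 : ℂ) ρ).exists_isMinOn
    ⟨0, by simpa using h⟩ (continuous_qPochInf hq).norm.continuousOn
  refine ⟨‖φ y‖, norm_pos_iff.2 (qPochInf_ne_zero_of_norm_lt_one hq0 hq ?_), fun x hx => ?_⟩
  · exact lt_of_le_of_lt (by simpa using hy) hρ
  · exact hmin (by simpa using hx)

theorem tendsto_mul_pow_zero (hq : ‖q‖ < 1) (x : ℂ) : Tendsto (fun n : ℕ => x * q ^ n) atTop (𝓝 0) := by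
  simpa using (tendsto_pow_atTop_nhds_zero_of_norm_lt_one hq).const_mul x

theorem norm_mul_pow_le (hq : ‖q‖ < 1) (x : ℂ) (n : ℕ) : ‖x * q ^ n‖ ≤ ‖x‖ := by
  rw [norm_mul, norm_pow]
  exact mul_le_of_le_one_right (norm_nonneg _) (pow_le_one₀ (norm_nonneg _) hq.le)

theorem tendsto_qPochInf_one (hq : ‖q‖ < 1) {u : ℕ → ℂ} (hu : Tendsto u atTop (𝓝 0)) :
    Tendsto (fun n => φ (u n)) atTop (𝓝 1) := by
  have := ((continuous_qPochInf hq).tendsto 0).comp hu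
  rwa [qPochInf_zero_left] at this

theorem tendsto_qPochPM_one (hq : ‖q‖ < 1) {u : ℕ → ℂ} (hu : Tendsto u atTop (𝓝 0)) (z : ℂ) :
    Tendsto (fun n => qPochPM (u n) z q) atTop (𝓝 1) := by
  unfold qPochPM
  simpa using (tendsto_qPochInf_one hq (by simpa using hu.mul_const z)).mul
    (tendsto_qPochInf_one hq (by simpa using hu.div_const z))

/-- Dominated convergence: |xqⁿ| ≤ |x| < 1 keeps the denominators away from zero uniformly in n and
z, while all factors involving the parameters tend to 1. -/
theorem tendsto_rahmanInt (hq0 : q ≠ 0) (hq : ‖q‖ < 1) {a b c d e : ℂ}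
    (ha : ‖a‖ < 1) (hb : ‖b‖ < 1) (hc : ‖c‖ < 1) (hd : ‖d‖ < 1) (he : ‖e‖ < 1) :
    Tendsto (fun n : ℕ => rahmanInt q (a * q ^ n) (b * q ^ n) (c * q ^ n) (d * q ^ n) (e * q ^ n))
      atTop (𝓝 (Real.circleAverage (fun z => φ (z ^ 2) * φ (z ^ 2)⁻¹) 0 1)) := by
  have hlt {x : ℂ} (hx : ‖x‖ < 1) (n : ℕ) : ‖x * q ^ n‖ < 1 := (norm_mul_pow_le hq x n).trans_lt hx
  have hlow {x : ℂ} (hx : ‖x‖ < 1) : ∃ c > 0, ∀ (n : ℕ) (z : ℂ), ‖z‖ = 1 →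
      c ≤ ‖qPochPM (x * q ^ n) z q‖ := by
    obtain ⟨c, hc, h⟩ := exists_le_norm_qPochInf hq0 hq hx
    refine ⟨c * c, by positivity, fun n z hz => ?_⟩
    rw [qPochPM, norm_mul]
    have h1 := norm_mul_pow_le hq x n
    exact mul_le_mul (h _ (by simpa [hz] using h1)) (h _ (by simpa [hz] using h1)) hc.le
      (norm_nonneg _)
  obtain ⟨ca, ca0, hca⟩ := hlow ha
  obtain ⟨cb, cb0, hcb⟩ := hlow hb
  obtain ⟨cc, cc0, hcc⟩ := hlow hc
  obtain ⟨cd, cd0, hcd⟩ := hlow hd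
  obtain ⟨ce, ce0, hce⟩ := hlow he
  set M := Real.exp (1 / (1 - ‖q‖))
  have hM : 0 < M := Real.exp_pos _
  unfold rahmanInt Real.circleAverage
  refine Tendsto.const_smul ?_ _
  refine intervalIntegral.tendsto_integral_filter_of_dominated_convergence
    (fun _ => M * M * (M * M) / (ca * cb * cc * cd * ce)) ?_ ?_ ?_ ?_
  · refine Eventually.of_forall fun n => Continuous.aestronglyMeasurable ?_
    rw [continuous_iff_continuousAt]
    intro θ
    have := (differentiableAt_rahmanFun hq0 hq (hlt ha n) (hlt hb n) (hlt hc n) (hlt hd n)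
      (hlt he n) (z := circleMap 0 1 θ) (by simp)).continuousAt
    exact ContinuousAt.comp this (continuous_circleMap 0 1).continuousAt
  · refine Eventually.of_forall fun n => Eventually.of_forall fun θ _ => ?_
    have hz : ‖circleMap 0 1 θ‖ = 1 := by simp
    set z := circleMap 0 1 θ
    have hup {x : ℂ} (hx : ‖x‖ ≤ 1) : ‖φ x‖ ≤ M := norm_qPochInf_le hq hx
    have hA : ‖a * q ^ n * (b * q ^ n) * (c * q ^ n) * (d * q ^ n) * (e * q ^ n)‖ ≤ 1 := by
      have := fun {x : ℂ} (hx : ‖x‖ < 1) => (hlt hx n).le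
      have hm {x y : ℂ} (hx : ‖x‖ ≤ 1) (hy : ‖y‖ ≤ 1) : ‖x * y‖ ≤ 1 := by
        rw [norm_mul]; exact mul_le_one₀ hx (norm_nonneg _) hy
      exact hm (hm (hm (hm (this ha) (this hb)) (this hc)) (this hd)) (this he)
    rw [rahmanFun, norm_div]
    simp only [norm_mul]
    gcongr
    · exact hup (by simp [hz])
    · exact hup (by simp [hz])
    · rw [qPochPM, norm_mul]
      gcongr
      · exact hup (by simpa [hz] using hA)
      · exact hup (by simpa [hz] using hA)
    · exact hca n z hz
    · exact hcb n z hz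
    · exact hcc n z hz
    · exact hcd n z hz
    · exact hce n z hz
  · exact _root_.intervalIntegrable_const
  · refine Eventually.of_forall fun θ _ => ?_
    set z := circleMap 0 1 θ
    have h (x : ℂ) := tendsto_qPochPM_one hq (tendsto_mul_pow_zero hq x) z
    have hA := tendsto_qPochPM_one hq (((((tendsto_mul_pow_zero hq a).mul
      (tendsto_mul_pow_zero hq b)).mul (tendsto_mul_pow_zero hq c)).mul
      (tendsto_mul_pow_zero hq d)).mul (tendsto_mul_pow_zero hq e) |>.trans (by simp)) z
    have := (hA.const_mul (φ (z ^ 2) * φ (z ^ 2)⁻¹)).div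
      (((((h a).mul (h b)).mul (h c)).mul (h d)).mul (h e)) (by simp)
    simp only [mul_one, div_one] at this
    exact this

/-- The ratio is unchanged when all parameters are multiplied by qⁿ, hence equals its limit as they
tend to 0, where every product tends to 1. -/
theorem rahmanRatio_eq_circleAverage (hq0 : q ≠ 0) (hq : ‖q‖ < 1) {a b c d e : ℂ}
    (ha : ‖a‖ < 1) (hb : ‖b‖ < 1) (hc : ‖c‖ < 1) (hd : ‖d‖ < 1) (he : ‖e‖ < 1) :
    rahmanRatio q a b c d e = Real.circleAverage (fun z => φ (z ^ 2) * φ (z ^ 2)⁻¹) 0 1 := by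
  have t (x : ℂ) := tendsto_mul_pow_zero hq x
  have t2 (x y : ℂ) := tendsto_qPochInf_one hq
    (((t x).mul (t y)).trans (by simp : 𝓝 (0 * 0 : ℂ) ≤ 𝓝 0))
  have t4 (x y z w : ℂ) := tendsto_qPochInf_one hq
    (((((t x).mul (t y)).mul (t z)).mul (t w)).trans (by simp : 𝓝 (0 * 0 * 0 * 0 : ℂ) ≤ 𝓝 0))
  have h1 := ((tendsto_rahmanInt hq0 hq ha hb hc hd he).mul
    ((((((((((t2 a b).mul (t2 a c)).mul (t2 a d)).mul (t2 a e)).mul (t2 b c)).mul (t2 b d)).mul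
      (t2 b e)).mul (t2 c d)).mul (t2 c e)).mul (t2 d e))).div
    (((((t4 b c d e).mul (t4 a c d e)).mul (t4 a b d e)).mul (t4 a b c e)).mul (t4 a b c d))
    (by simp)
  simp only [mul_one, div_one] at h1
  refine tendsto_nhds_unique ?_ h1
  refine tendsto_const_nhds.congr fun n => ?_
  rw [← rahmanRatio_mul_pow hq0 hq ha hb hc hd he n]
  rfl

theorem circleAverage_sq_add_inv :
    Real.circleAverage (fun z : ℂ => 2 - z ^ 2 - (z ^ 2)⁻¹) 0 1 = 2 := by
  have c1 : CircleIntegrable (fun _ : ℂ => (2 : ℂ)) 0 1 := circleIntegrable_const _ _ _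
  have c2 : CircleIntegrable (fun z : ℂ => z ^ 2) 0 1 :=
    circleIntegrable_of_differentiableAt fun z _ => by fun_prop
  have c3 : CircleIntegrable (fun z : ℂ => (z ^ 2)⁻¹) 0 1 :=
    circleIntegrable_of_differentiableAt fun z hz => by
      have : z ^ 2 ≠ 0 := pow_ne_zero _ (ne_zero_of_norm_eq_one hz)
      fun_prop (disch := assumption)
  rw [Real.circleAverage_fun_sub (f₁ := fun z => 2 - z ^ 2) (c1.sub c2) c3, Real.circleAverage_fun_sub c1 c2,
    Real.circleAverage_const]
  have h2 : Real.circleAverage (fun z : ℂ => z ^ 2) 0 1 = 0 := by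
    rw [Real.circleAverage_eq_circleIntegral one_ne_zero]
    have : (∮ z in C(0, 1), (z - 0)⁻¹ • z ^ 2) = ∮ z in C(0, 1), (z - 0) ^ (1 : ℤ) := by
      refine circleIntegral.integral_congr zero_le_one fun z hz => ?_
      have hz0 := ne_zero_of_norm_eq_one (z := z) (by simpa using hz)
      simp only [sub_zero, smul_eq_mul, zpow_one]
      field_simp
    rw [this, circleIntegral.integral_sub_zpow_of_ne (by norm_num), smul_zero]
  have h3 : Real.circleAverage (fun z : ℂ => (z ^ 2)⁻¹) 0 1 = 0 := by
    rw [Real.circleAverage_eq_circleIntegral one_ne_zero]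
    have : (∮ z in C(0, 1), (z - 0)⁻¹ • (z ^ 2)⁻¹) = ∮ z in C(0, 1), (z - 0) ^ (-3 : ℤ) := by
      refine circleIntegral.integral_congr zero_le_one fun z hz => ?_
      have hz0 := ne_zero_of_norm_eq_one (z := z) (by simpa using hz)
      simp only [sub_zero, smul_eq_mul, zpow_neg]
      rw [show (3 : ℤ) = ((3 : ℕ) : ℤ) by rfl, zpow_natCast]
      field_simp
    rw [this, circleIntegral.integral_sub_zpow_of_ne (by norm_num), smul_zero]
  rw [h2, h3]
  simp

/-- For these parameters `qPochInf_sq` cancels the denominator against φ(z²)φ(z⁻²), leaving the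
Laurent polynomial (1 - z²)(1 - z⁻²), whose constant term is 2. -/
theorem rahmanInt_special (hq0 : q ≠ 0) (hq : ‖q‖ < 1) {p : ℂ} (hp : p ^ 2 = q) (hp1 : ‖p‖ < 1) :
    rahmanInt q q (-q) p (-p) 0 = 2 := by
  rw [← circleAverage_sq_add_inv, rahmanInt]
  refine Real.circleAverage_congr_sphere fun z hz => ?_
  have hz1 : ‖z‖ = 1 := by simpa using hz
  have hz0 := ne_zero_of_norm_eq_one hz1
  have n1 := qPochPM_ne_zero hq0 hq hq hz1
  have n2 := qPochPM_ne_zero hq0 hq (x := -q) (by simpa using hq) hz1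
  have n3 := qPochPM_ne_zero hq0 hq hp1 hz1
  have n4 := qPochPM_ne_zero hq0 hq (x := -p) (by simpa using hp1) hz1
  have e1 := qPochInf_sq hq hp z
  have e2 := qPochInf_sq hq hp z⁻¹
  rw [qPochInf_step hq z, qPochInf_step hq (-z)] at e1
  rw [qPochInf_step hq z⁻¹, qPochInf_step hq (-z⁻¹)] at e2
  have e3 : φ (z ^ 2) * φ (z ^ 2)⁻¹ = (2 - z ^ 2 - (z ^ 2)⁻¹) *
      (qPochPM q z q * qPochPM (-q) z q * qPochPM p z q * qPochPM (-p) z q) := by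
    rw [← inv_pow, e1, e2]
    simp only [qPochPM, div_eq_mul_inv, neg_mul, mul_comm q]
    field_simp
    ring
  have h0 : qPochPM 0 z q = 1 := by simp [qPochPM]
  simp only [rahmanFun, e3, mul_zero, h0, mul_one]
  rw [mul_div_assoc, div_self (by simp [n1, n2, n3, n4]), mul_one]

/-- The ratio does not depend on the parameters, so this constant can be read off from q, -q, √q,
-√q, 0, where the integral is elementary. -/
theorem circleAverage_theta (hq0 : q ≠ 0) (hq : ‖q‖ < 1) :
    Real.circleAverage (fun z => φ (z ^ 2) * φ (z ^ 2)⁻¹) 0 1 = 2 / φ q := by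
  obtain ⟨p, hp⟩ := IsAlgClosed.exists_pow_nat_eq q (n := 2) (by norm_num)
  have hp1 : ‖p‖ < 1 := by
    have : ‖p‖ ^ 2 < 1 := by rw [← norm_pow, hp]; exact hq
    exact lt_of_pow_lt_pow_left₀ 2 zero_le_one (by simpa using this)
  rw [← rahmanRatio_eq_circleAverage hq0 hq hq (by simpa using hq : ‖-q‖ < 1) hp1
    (by simpa using hp1 : ‖-p‖ < 1) (by simp : ‖(0 : ℂ)‖ < 1), rahmanRatio,
    rahmanInt_special hq0 hq hp hp1]
  have hqq := qPochInf_ne_zero_of_norm_lt_one hq0 hq hq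
  have e1 := qPochInf_sq hq hp p
  rw [hp, qPochInf_step hq p, qPochInf_step hq (-p), show p * p = q by rw [← hp]; ring] at e1
  -- Euler's identity (q;q²)_∞ (-q;q)_∞ = 1, obtained from the quadratic transformation at x = √q.
  have e2 : (1 - q) * φ (p * q) * φ (-(p * q)) * φ (-q) = 1 := by
    have : φ q * ((1 - q) * φ (p * q) * φ (-(p * q)) * φ (-q)) = φ q * 1 := by
      rw [mul_one]
      conv_rhs => rw [e1]
      rw [show -p * q = -(p * q) by ring, ← hp]
      ring
    exact mul_left_cancel₀ hqq this
  have e3 := qPochInf_step hq (-q)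
  have e4 : φ q = (1 - q) * (1 - q ^ 2) * φ (q ^ 3) := by
    rw [qPochInf_step hq q, qPochInf_step hq (q * q)]; ring_nf
  have e5 : φ (q ^ 3) ≠ 0 := by
    intro h; rw [e4, h] at hqq; simp at hqq
  rw [show -q * q = -q ^ 2 by ring] at e3
  simp only [mul_zero, qPochInf_zero_left, mul_one, one_mul]
  rw [show q * -q = -q ^ 2 by ring, show q * -p = -(p * q) by ring, show -q * p = -(p * q) by ring,
    show -q * -p = p * q by ring, show p * -p = -q by rw [← hp]; ring,
    show -(q ^ 2) * p * -p = q ^ 3 by rw [← hp]; ring, mul_comm q p, div_eq_div_iff e5 hqq]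
  rw [e4]
  have e6 : (1 - q ^ 2) * φ (-q ^ 2) = (1 - q) * φ (-q) := by rw [e3]; ring
  linear_combination (2 * (1 - q) * φ (q ^ 3) * φ (p * q) ^ 2 * φ (-(p * q)) ^ 2 * φ (-q)) * e6 +
    2 * φ (q ^ 3) * ((1 - q) * φ (p * q) * φ (-(p * q)) * φ (-q) + 1) * e2

/-- **Rahman's integral**. -/
theorem rahmanInt_eq (hq0 : q ≠ 0) (hq : ‖q‖ < 1) {a b c d e : ℂ}
    (ha : ‖a‖ < 1) (hb : ‖b‖ < 1) (hc : ‖c‖ < 1) (hd : ‖d‖ < 1) (he : ‖e‖ < 1) :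
    rahmanInt q a b c d e *
      (φ (a * b) * φ (a * c) * φ (a * d) * φ (a * e) * φ (b * c) * φ (b * d) * φ (b * e) *
        φ (c * d) * φ (c * e) * φ (d * e)) =
    2 / φ q * (φ (b * c * d * e) * φ (a * c * d * e) * φ (a * b * d * e) * φ (a * b * c * e) *
        φ (a * b * c * d)) := by
  have h := rahmanRatio_eq_circleAverage hq0 hq ha hb hc hd he
  have hlt {x y : ℂ} (hx : ‖x‖ < 1) (hy : ‖y‖ < 1) : ‖x * y‖ < 1 := by
    rw [norm_mul]; exact mul_lt_one_of_nonneg_of_lt_one_left (norm_nonneg _) hx hy.le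
  have hne {x : ℂ} (hx : ‖x‖ < 1) : φ x ≠ 0 := qPochInf_ne_zero_of_norm_lt_one hq0 hq hx
  rw [circleAverage_theta hq0 hq, rahmanRatio, div_eq_iff] at h
  · exact h
  · exact mul_ne_zero (mul_ne_zero (mul_ne_zero (mul_ne_zero (hne (hlt (hlt (hlt hb hc) hd) he))
      (hne (hlt (hlt (hlt ha hc) hd) he))) (hne (hlt (hlt (hlt ha hb) hd) he)))
      (hne (hlt (hlt (hlt ha hb) hc) he))) (hne (hlt (hlt (hlt ha hb) hc) hd))

end Rahman

/-- `x` is a nonzero number that is not an integral power of `q`. -/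
def QGen (q x : ℂ) : Prop := x ≠ 0 ∧ ∀ n : ℤ, x ≠ q ^ n

/-- The summand of the bilateral form of a two-term very-well-poised sum. -/
def bailH {n : ℕ} (q l m : ℂ) (a : Fin n → ℂ) (t : ℂ) : ℂ :=
  t * (1 - t ^ 2 / q) * (∏ i, qPochInf (t * a i) q / qPochInf (t / a i) q) *
    (qPochInf (q * t / l) q * qPochInf (q * t / m) q /
      (qPochInf (l * t / q) q * qPochInf (m * t / q) q))

/-- The normalizing factor of a two-term very-well-poised sum. -/
def bailD {n : ℕ} (q l m : ℂ) (a : Fin n → ℂ) : ℂ :=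
  (∏ i, qPochInf (l / a i) q * qPochInf (m / a i) q) * qPochInf (l * m / q) q /
    (qPochInf q q * qPochInf (q * l / m) q * qPochInf (q * m / l) q)

/-- A two-term very-well-poised sum. -/
def bailSum {n : ℕ} (q l m : ℂ) (a : Fin n → ℂ) : ℂ :=
  bailD q l m a / (l - m) *
    (∑' k : ℕ, bailH q l m a (l * q ^ k) - ∑' k : ℕ, bailH q l m a (m * q ^ k))

/-! ### Bailey's two-term sum: the contiguous relation for the summand -/

section Bailey

variable {q : ℂ}

local notation "φ" x:max => qPochInf x q

namespace QGen

theorem mul_zpow (hq0 : q ≠ 0) {x : ℂ} (h : QGen q x) (n : ℤ) : QGen q (x * q ^ n) := by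
  refine ⟨mul_ne_zero h.1 (zpow_ne_zero _ hq0), fun k hk => h.2 (k - n) ?_⟩
  rw [zpow_sub₀ hq0, ← hk, mul_div_cancel_right₀ _ (zpow_ne_zero _ hq0)]

theorem mul_pow (hq0 : q ≠ 0) {x : ℂ} (h : QGen q x) (n : ℕ) : QGen q (x * q ^ n) := by
  simpa using h.mul_zpow hq0 n

theorem mul_self (hq0 : q ≠ 0) {x : ℂ} (h : QGen q x) : QGen q (x * q) := by
  simpa using h.mul_zpow hq0 1

theorem div_self (hq0 : q ≠ 0) {x : ℂ} (h : QGen q x) : QGen q (x / q) := by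
  simpa [div_eq_mul_inv] using h.mul_zpow hq0 (-1)

theorem inv {x : ℂ} (h : QGen q x) : QGen q x⁻¹ := by
  refine ⟨inv_ne_zero h.1, fun k hk => h.2 (-k) ?_⟩
  rw [zpow_neg, ← hk, inv_inv]

theorem not_mem_Omega {x : ℂ} (h : QGen q x) : x ∉ Omega q := by
  rintro ⟨k, hk⟩
  exact h.2 (-k) (by simpa using hk)

theorem qPochInf_ne_zero (hq0 : q ≠ 0) (hq : ‖q‖ < 1) {x : ℂ} (h : QGen q x) : φ x ≠ 0 :=
  BasicHyp.qPochInf_ne_zero hq0 hq h.not_mem_Omega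

theorem one_sub_ne_zero {x : ℂ} (h : QGen q x) : 1 - x ≠ 0 := by
  intro h0
  exact h.2 0 (by simpa using (sub_eq_zero.1 h0).symm)

theorem of_norm {x : ℂ} (hq : ‖q‖ < 1) (h1 : ‖q‖ < ‖x‖) (h2 : ‖x‖ < 1) : QGen q x := by
  refine ⟨norm_pos_iff.1 ((norm_nonneg _).trans_lt h1), fun n hn => ?_⟩
  have h0 : q ≠ 0 ∨ q = 0 := (em _).symm
  rcases h0 with h0 | rfl
  · have hp := norm_pos_iff.2 h0
    rw [hn, norm_zpow] at h1 h2
    have h3 : n < 1 := by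
      by_contra! hc
      have := zpow_le_zpow_right_of_le_one₀ hp hq.le hc
      rw [zpow_one] at this
      linarith
    have h4 : 0 < n := by
      by_contra! hc
      have := zpow_le_zpow_right_of_le_one₀ hp hq.le hc
      rw [zpow_zero] at this
      linarith
    omega
  · rcases eq_or_ne n 0 with rfl | h
    · simp [hn] at h2
    · rw [zero_zpow _ h] at hn
      simp [hn] at h1

end QGen

/-- Nondegeneracy of the parameters of a two-term sum. -/
structure BailGen {n : ℕ} (q l m : ℂ) (a : Fin n → ℂ) : Prop where
  div_left : ∀ i, QGen q (l / a i)
  div_right : ∀ i, QGen q (m / a i)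
  mul_left : ∀ i, QGen q (l * a i)
  mul_right : ∀ i, QGen q (m * a i)
  ratio : QGen q (l / m)
  sq_left : QGen q (l ^ 2)
  sq_right : QGen q (m ^ 2)
  prod : QGen q (l * m)

/-- This is `bailH_contiguous` after the common infinite products are removed. The balancing
condition enters by eliminating m. -/
theorem bail_poly_identity {a b c d l m t : ℂ} (hq0 : q ≠ 0) (ha : a ≠ 0) (hb : b ≠ 0) (hc : c ≠ 0)
    (hd : d ≠ 0) (hl : l ≠ 0) (hm : m ≠ 0) (h : l * m = a * b * c * d) :
    t * (1 - t ^ 2 / q) * ((1 - l * m / q) * ((1 - l / b) * (1 - l / c) * (1 - l / d)) *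
        ((1 - t * a) * (1 - t / a / q)) +
      (1 - a * b) * (1 - a * c) * (1 - a * d) * (1 - m / a / q) * (l / m) *
        ((1 - l * t / q) * (1 - t / l))) =
    l * (1 - l * a) * ((1 - l * t / q) * (1 - m * t / q) *
        ((1 - t / b) * (1 - t / c) * (1 - t / d)) * (1 - t / a / q) -
      (1 - t / l) * (1 - t / m) * ((1 - t * b / q) * (1 - t * c / q) * (1 - t * d / q)) *
        (1 - t * a)) := by
  obtain rfl : m = a * b * c * d / l := by rw [eq_div_iff hl, mul_comm, h]
  field_simp
  ring

/-- The function whose `q`-difference is the defect in the contiguous relation for `bailH`. -/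
def bailAux (q l m a b c d t : ℂ) : ℂ :=
  qPochInf (t / l) q * qPochInf (t / m) q *
    (qPochInf (t * a) q * qPochInf (t * b / q) q * qPochInf (t * c / q) q *
      qPochInf (t * d / q) q) /
    (qPochInf (t / a / q) q * qPochInf (t / b) q * qPochInf (t / c) q * qPochInf (t / d) q *
      (qPochInf (l * t / q) q * qPochInf (m * t / q) q))

/-- The analogue for series of `rahmanFun_contiguous`: a combination of two summands, one with l and
a replaced by lq and aq, is a q-difference in t and therefore telescopes along t = xq^k. -/
theorem bailH_contiguous (hq0 : q ≠ 0) (hq : ‖q‖ < 1) {a b c d l m t : ℂ}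
    (ha : a ≠ 0) (hb : b ≠ 0) (hc : c ≠ 0) (hd : d ≠ 0) (hl : l ≠ 0) (hm : m ≠ 0)
    (h : l * m = a * b * c * d) (ta : QGen q (t / a)) (tb : QGen q (t / b)) (tc : QGen q (t / c))
    (td : QGen q (t / d)) (ta' : QGen q (t * a)) (lt : QGen q (l * t)) (mt : QGen q (m * t)) :
    (1 - l * m / q) * ((1 - l / b) * (1 - l / c) * (1 - l / d)) * bailH q l m ![a, b, c, d] t +
      (1 - a * b) * (1 - a * c) * (1 - a * d) * (1 - m / a / q) * (l / m) *
        bailH q (l * q) m ![a * q, b, c, d] t =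
    l * (1 - l * a) * (bailAux q l m a b c d (t * q) - bailAux q l m a b c d t) := by
  have hp := bail_poly_identity (t := t) hq0 ha hb hc hd hl hm h
  have s1 := qPochInf_step hq (t * a)
  have s2 := qPochInf_step hq (t / a / q)
  have s3 := qPochInf_step hq (t / l)
  have s4 := qPochInf_step hq (l * t / q)
  have s5 := qPochInf_step hq (m * t / q)
  have s6 := qPochInf_step hq (t / m)
  have s7 := qPochInf_step hq (t / b)
  have s8 := qPochInf_step hq (t / c)
  have s9 := qPochInf_step hq (t / d)
  have s10 := qPochInf_step hq (t * b / q)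
  have s11 := qPochInf_step hq (t * c / q)
  have s12 := qPochInf_step hq (t * d / q)
  rw [div_mul_cancel₀ _ hq0] at s2 s4 s5 s10 s11 s12
  have n1 := (ta'.mul_self hq0).qPochInf_ne_zero hq0 hq
  have n2 := ta.qPochInf_ne_zero hq0 hq
  have n4 := lt.qPochInf_ne_zero hq0 hq
  have n5 := mt.qPochInf_ne_zero hq0 hq
  have n7 := (tb.mul_self hq0).qPochInf_ne_zero hq0 hq
  have n8 := (tc.mul_self hq0).qPochInf_ne_zero hq0 hq
  have n9 := (td.mul_self hq0).qPochInf_ne_zero hq0 hq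
  have u1 := ta'.one_sub_ne_zero
  have u2 := (ta.div_self hq0).one_sub_ne_zero
  have u4 := (lt.div_self hq0).one_sub_ne_zero
  have u5 := (mt.div_self hq0).one_sub_ne_zero
  have u7 := tb.one_sub_ne_zero
  have u8 := tc.one_sub_ne_zero
  have u9 := td.one_sub_ne_zero
  have e1 : bailH q l m ![a, b, c, d] t = t * (1 - t ^ 2 / q) *
      (φ (t * a) / φ (t / a) * (φ (t * b) / φ (t / b)) * (φ (t * c) / φ (t / c)) *
        (φ (t * d) / φ (t / d))) * (φ (t / l * q) * φ (t / m * q) /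
      (φ (l * t / q) * φ (m * t / q))) := by
    rw [bailH, Fin.prod_univ_four, show q * t / l = t / l * q by ring,
      show q * t / m = t / m * q by ring]
    rfl
  have e2 : bailH q (l * q) m ![a * q, b, c, d] t = t * (1 - t ^ 2 / q) *
      (φ (t * a * q) / φ (t / a / q) * (φ (t * b) / φ (t / b)) * (φ (t * c) / φ (t / c)) *
        (φ (t * d) / φ (t / d))) * (φ (t / l) * φ (t / m * q) /
      (φ (l * t) * φ (m * t / q))) := by
    rw [bailH, Fin.prod_univ_four, show q * t / (l * q) = t / l by field_simp,
      show q * t / m = t / m * q by ring, show l * q * t / q = l * t by field_simp,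
      show t * a * q = t * (a * q) by ring, show t / a / q = t / (a * q) by field_simp]
    rfl
  have e3 : bailAux q l m a b c d t = φ (t / l) * φ (t / m) *
    (φ (t * a) * φ (t * b / q) * φ (t * c / q) * φ (t * d / q)) /
    (φ (t / a / q) * φ (t / b) * φ (t / c) * φ (t / d) * (φ (l * t / q) * φ (m * t / q))) := rfl
  have e4 : bailAux q l m a b c d (t * q) = φ (t / l * q) * φ (t / m * q) *
    (φ (t * a * q) * φ (t * b) * φ (t * c) * φ (t * d)) /
    (φ (t / a) * φ (t / b * q) * φ (t / c * q) * φ (t / d * q) * (φ (l * t) * φ (m * t))) := by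
    rw [bailAux, show t * q / l = t / l * q by ring, show t * q / m = t / m * q by ring,
      show t * q * a = t * a * q by ring, show t * q * b / q = t * b by field_simp,
      show t * q * c / q = t * c by field_simp, show t * q * d / q = t * d by field_simp,
      show t * q / a / q = t / a by field_simp, show t * q / b = t / b * q by ring,
      show t * q / c = t / c * q by ring, show t * q / d = t / d * q by ring,
      show l * (t * q) / q = l * t by field_simp, show m * (t * q) / q = m * t by field_simp]
  rw [e1, e2, e3, e4, s1, s2, s3, s4, s5, s6, s7, s8, s9, s10, s11, s12]
  generalize φ (t * a * q) = A1 at *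
  generalize φ (t / a) = A2 at *
  generalize φ (t / l * q) = L1 at *
  generalize φ (l * t) = L2 at *
  generalize φ (m * t) = M1 at *
  generalize φ (t / m * q) = M2 at *
  generalize φ (t / b * q) = B1 at *
  generalize φ (t / c * q) = C1 at *
  generalize φ (t / d * q) = D1 at *
  generalize φ (t * b) = B2 at *
  generalize φ (t * c) = C2 at *
  generalize φ (t * d) = D2 at *
  clear e1 e2 e3 e4 s1 s2 s3 s4 s5 s6 s7 s8 s9 s10 s11 s12
  generalize 1 - t ^ 2 / q = v1 at *
  generalize 1 - t * a = v2 at *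
  generalize 1 - t / a / q = v3 at *
  generalize 1 - l * t / q = v4 at *
  generalize 1 - m * t / q = v5 at *
  generalize 1 - t / l = v6 at *
  generalize 1 - t / m = v7 at *
  generalize 1 - t / b = v8 at *
  generalize 1 - t / c = v9 at *
  generalize 1 - t / d = v10 at *
  generalize 1 - t * b / q = v11 at *
  generalize 1 - t * c / q = v12 at *
  generalize 1 - t * d / q = v13 at *
  generalize (1 - l * m / q) * ((1 - l / b) * (1 - l / c) * (1 - l / d)) = Q at *
  generalize (1 - a * b) * (1 - a * c) * (1 - a * d) * (1 - m / a / q) * (l / m) = R at *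
  generalize l * (1 - l * a) = S at *
  clear ta tb tc td ta' lt mt h
  field_simp
  linear_combination (L1 * M2 * B2 * C2 * D2) * hp

end Bailey

/-! ### Bailey's two-term sum: summing the relation -/

section BaileySum

variable {q : ℂ}

local notation "φ" x:max => qPochInf x q

theorem continuousAt_qPochInf_comp (hq : ‖q‖ < 1) {g : ℂ → ℂ} {z : ℂ} (hg : ContinuousAt g z) :
    ContinuousAt (fun z => φ (g z)) z :=
  (continuous_qPochInf hq).continuousAt.comp hg

theorem summable_pow_mul_of_tendsto (hq : ‖q‖ < 1) {F : ℕ → ℂ} {L : ℂ}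
    (hF : Tendsto F atTop (𝓝 L)) : Summable fun k => q ^ k * F k := by
  refine summable_of_isBigO_nat (g := fun k => ‖q‖ ^ k)
    (summable_geometric_of_lt_one (norm_nonneg _) hq) ?_
  have h1 : (fun k => q ^ k * F k) =O[atTop] fun k => ‖q‖ ^ k * (1 : ℝ) :=
    (Asymptotics.isBigO_of_le _ fun k => by simp).mul (hF.isBigO_one ℝ)
  simpa using h1

theorem summable_bailH (hq : ‖q‖ < 1) {n : ℕ} (l m x : ℂ) (a : Fin n → ℂ) :
    Summable fun k : ℕ => bailH q l m a (x * q ^ k) := by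
  have hc : ContinuousAt (fun t : ℂ => x * ((1 - t ^ 2 / q) *
      (∏ i, qPochInf (t * a i) q / qPochInf (t / a i) q) *
      (qPochInf (q * t / l) q * qPochInf (q * t / m) q /
      (qPochInf (l * t / q) q * qPochInf (m * t / q) q)))) 0 := by
    have h1 : ContinuousAt (fun t : ℂ => 1 - t ^ 2 / q) 0 := by fun_prop
    have h2 : ContinuousAt (fun t : ℂ => ∏ i, φ (t * a i) / φ (t / a i)) 0 := by
      refine tendsto_finsetProd _ fun i _ => ?_
      have h3 : ContinuousAt (fun t : ℂ => φ (t * a i)) 0 :=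
        continuousAt_qPochInf_comp hq (by fun_prop)
      have h4 : ContinuousAt (fun t : ℂ => φ (t / a i)) 0 :=
        continuousAt_qPochInf_comp hq (by fun_prop)
      exact h3.div h4 (by simp)
    refine continuousAt_const.mul ((h1.mul h2).mul (ContinuousAt.div ?_ ?_ (by simp)))
    · exact ContinuousAt.mul (continuousAt_qPochInf_comp hq (by fun_prop))
        (continuousAt_qPochInf_comp hq (by fun_prop))
    · exact ContinuousAt.mul (continuousAt_qPochInf_comp hq (by fun_prop))
        (continuousAt_qPochInf_comp hq (by fun_prop))
  refine (summable_pow_mul_of_tendsto hq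
    (hc.tendsto.comp (tendsto_mul_pow_zero hq x))).congr fun k => ?_
  simp only [Function.comp, bailH]
  ring

theorem tendsto_bailAux (hq : ‖q‖ < 1) (l m a b c d x : ℂ) :
    Tendsto (fun k : ℕ => bailAux q l m a b c d (x * q ^ k)) atTop (𝓝 1) := by
  have hc : ContinuousAt (bailAux q l m a b c d) 0 := by
    unfold bailAux
    refine ContinuousAt.div ?_ ?_ (by simp)
    all_goals
      repeat' first
        | exact continuousAt_qPochInf_comp hq (by fun_prop)
        | refine ContinuousAt.mul ?_ ?_
  have h0 : bailAux q l m a b c d 0 = 1 := by simp [bailAux]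
  rw [← h0]
  exact hc.tendsto.comp (tendsto_mul_pow_zero hq x)

/-- The sum telescopes. The auxiliary function vanishes at the starting point x by `hx` and tends to
1 as t tends to 0. The outcome is the same for every such x, so the cases x = l and x = m can be
subtracted. -/
theorem tsum_bailH_contiguous (hq0 : q ≠ 0) (hq : ‖q‖ < 1) {a b c d l m x : ℂ}
    (ha : a ≠ 0) (hb : b ≠ 0) (hc : c ≠ 0) (hd : d ≠ 0) (hl : l ≠ 0) (hm : m ≠ 0)
    (h : l * m = a * b * c * d) (xa : QGen q (x / a)) (xb : QGen q (x / b)) (xc : QGen q (x / c))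
    (xd : QGen q (x / d)) (xa' : QGen q (x * a)) (lx : QGen q (l * x)) (mx : QGen q (m * x))
    (hx : φ (x / l) * φ (x / m) = 0) :
    (1 - l * m / q) * ((1 - l / b) * (1 - l / c) * (1 - l / d)) *
        ∑' k : ℕ, bailH q l m ![a, b, c, d] (x * q ^ k) +
      (1 - a * b) * (1 - a * c) * (1 - a * d) * (1 - m / a / q) * (l / m) *
        ∑' k : ℕ, bailH q (l * q) m ![a * q, b, c, d] (x * q ^ k) = l * (1 - l * a) := by
  have s1 := (summable_bailH hq l m x ![a, b, c, d]).mul_left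
    ((1 - l * m / q) * ((1 - l / b) * (1 - l / c) * (1 - l / d)))
  have s2 := (summable_bailH hq (l * q) m x ![a * q, b, c, d]).mul_left
    ((1 - a * b) * (1 - a * c) * (1 - a * d) * (1 - m / a / q) * (l / m))
  rw [← tsum_mul_left, ← tsum_mul_left, ← s1.tsum_add s2]
  refine tendsto_nhds_unique (s1.add s2).hasSum.tendsto_sum_nat ?_
  have e : ∀ k : ℕ, (1 - l * m / q) * ((1 - l / b) * (1 - l / c) * (1 - l / d)) *
        bailH q l m ![a, b, c, d] (x * q ^ k) +
      (1 - a * b) * (1 - a * c) * (1 - a * d) * (1 - m / a / q) * (l / m) *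
        bailH q (l * q) m ![a * q, b, c, d] (x * q ^ k) =
      l * (1 - l * a) * (bailAux q l m a b c d (x * q ^ (k + 1)) -
        bailAux q l m a b c d (x * q ^ k)) := by
    intro k
    rw [bailH_contiguous hq0 hq ha hb hc hd hl hm h, pow_succ, mul_assoc x]
    · rw [mul_div_right_comm]; exact xa.mul_pow hq0 k
    · rw [mul_div_right_comm]; exact xb.mul_pow hq0 k
    · rw [mul_div_right_comm]; exact xc.mul_pow hq0 k
    · rw [mul_div_right_comm]; exact xd.mul_pow hq0 k
    · rw [mul_right_comm]; exact xa'.mul_pow hq0 k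
    · rw [← mul_assoc]; exact lx.mul_pow hq0 k
    · rw [← mul_assoc]; exact mx.mul_pow hq0 k
  have h0 : bailAux q l m a b c d x = 0 := by rw [bailAux, hx]; simp
  simp_rw [e, ← Finset.mul_sum, Finset.sum_range_sub (fun k => bailAux q l m a b c d (x * q ^ k))]
  have := ((tendsto_bailAux hq l m a b c d x).sub_const 0).const_mul (l * (1 - l * a))
  simpa [h0] using this

theorem qPochInf_one (hq : ‖q‖ < 1) : φ 1 = 0 := by
  rw [qPochInf_step hq, sub_self, zero_mul]

theorem BailGen.shift {n : ℕ} (hq0 : q ≠ 0) {l m : ℂ} {a : Fin n → ℂ} (h : BailGen q l m a)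
    (i j : ℕ) (e : Fin n → ℕ) :
    BailGen q (l * q ^ i) (m * q ^ j) (fun t => a t * q ^ e t) := by
  have key : ∀ x y : ℂ, QGen q x → ∀ k : ℤ, y = x * q ^ k → QGen q y := by
    rintro x y hx k rfl
    exact hx.mul_zpow hq0 k
  refine ⟨fun t => key _ _ (h.div_left t) (i - e t) ?_, fun t => key _ _ (h.div_right t) (j - e t) ?_,
    fun t => key _ _ (h.mul_left t) (i + e t) ?_, fun t => key _ _ (h.mul_right t) (j + e t) ?_,
    key _ _ h.ratio (i - j) ?_, key _ _ h.sq_left (i + i) ?_, key _ _ h.sq_right (j + j) ?_,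
    key _ _ h.prod (i + j) ?_⟩
  all_goals
    simp only [zpow_sub₀ hq0, zpow_add₀ hq0, zpow_natCast, div_eq_mul_inv, mul_inv]
    ring

theorem BailGen.swap {n : ℕ} {l m : ℂ} {a : Fin n → ℂ} (h : BailGen q l m a) :
    BailGen q m l a :=
  ⟨h.div_right, h.div_left, h.mul_right, h.mul_left, by simpa using h.ratio.inv, h.sq_right,
    h.sq_left, by simpa [mul_comm] using h.prod⟩

theorem bailSum_swap {n : ℕ} (l m : ℂ) (a : Fin n → ℂ) : bailSum q l m a = bailSum q m l a := by
  have h1 : bailD q m l a = bailD q l m a := by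
    simp only [bailD, mul_comm, mul_left_comm]
  have h2 : bailH q m l a = bailH q l m a := by
    ext t
    simp only [bailH, mul_comm (qPochInf (q * t / m) q), mul_comm (qPochInf (m * t / q) q)]
  rw [bailSum, bailSum, h1, h2, ← neg_sub l m, div_neg]
  ring

theorem bailSum_comp_equiv {n : ℕ} (l m : ℂ) (a : Fin n → ℂ) (σ : Equiv.Perm (Fin n)) :
    bailSum q l m (a ∘ σ) = bailSum q l m a := by
  have h1 : bailD q l m (a ∘ σ) = bailD q l m a := by
    simp only [bailD, Function.comp]
    rw [Equiv.prod_comp σ fun i => qPochInf (l / a i) q * qPochInf (m / a i) q]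
  have h2 : bailH q l m (a ∘ σ) = bailH q l m a := by
    ext t
    simp only [bailH, Function.comp]
    rw [Equiv.prod_comp σ fun i => qPochInf (t * a i) q / qPochInf (t / a i) q]
  rw [bailSum, bailSum, h1, h2]

/-- Subtracting the telescoped sums started at l and at m removes the inhomogeneous term; the
normalizing factors `bailD` account for the remaining quotients. -/
theorem bailSum_contiguous (hq0 : q ≠ 0) (hq : ‖q‖ < 1) {a b c d l m : ℂ}
    (ha : a ≠ 0) (hb : b ≠ 0) (hc : c ≠ 0) (hd : d ≠ 0) (hl : l ≠ 0) (hm : m ≠ 0)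
    (h : l * m = a * b * c * d) (hg : BailGen q l m ![a, b, c, d]) :
    bailSum q l m ![a, b, c, d] = (1 - a * b) * (1 - a * c) * (1 - a * d) *
      bailSum q (l * q) m ![a * q, b, c, d] := by
  have c1 := tsum_bailH_contiguous hq0 hq (x := l) ha hb hc hd hl hm h (hg.div_left 0)
    (hg.div_left 1) (hg.div_left 2) (hg.div_left 3) (hg.mul_left 0)
    (by simpa [sq] using hg.sq_left) (by simpa [mul_comm] using hg.prod)
    (by rw [div_self hl, qPochInf_one hq, zero_mul])
  have c2 := tsum_bailH_contiguous hq0 hq (x := m) ha hb hc hd hl hm h (hg.div_right 0)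
    (hg.div_right 1) (hg.div_right 2) (hg.div_right 3) (hg.mul_right 0)
    hg.prod (by simpa [sq] using hg.sq_right) (by rw [div_self hm, qPochInf_one hq, mul_zero])
  -- After the shift l ↦ lq the sum should start at lq. Its extra term at t = l contains φ(1) = 0,
  -- so both starting points give the same sum.
  have c3 : ∑' k : ℕ, bailH q (l * q) m ![a * q, b, c, d] (l * q ^ k) =
      ∑' k : ℕ, bailH q (l * q) m ![a * q, b, c, d] (l * q * q ^ k) := by
    rw [(summable_bailH hq _ _ _ _).tsum_eq_zero_add]
    have : bailH q (l * q) m ![a * q, b, c, d] (l * q ^ 0) = 0 := by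
      rw [bailH, show q * (l * q ^ 0) / (l * q) = 1 by field_simp, qPochInf_one hq]
      simp
    rw [this, zero_add]
    simp only [pow_succ', mul_assoc]
  rw [c3] at c1
  have s1 := qPochInf_step hq (m / (a * q))
  have s2 := qPochInf_step hq (l / b)
  have s3 := qPochInf_step hq (l / c)
  have s4 := qPochInf_step hq (l / d)
  have s5 := qPochInf_step hq (l * m / q)
  have s6 := qPochInf_step hq (q * l / m)
  have s7 := qPochInf_step hq (m / l)
  have r := hg.ratio
  have r' : QGen q (m / l) := by simpa using r.inv
  have n1 := (hg.div_right 0).div_self hq0 |>.one_sub_ne_zero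
  have n6 : φ (q * l / m * q) ≠ 0 := by
    rw [mul_div_assoc, mul_comm q]
    exact ((r.mul_self hq0).mul_self hq0).qPochInf_ne_zero hq0 hq
  have n6' : 1 - q * l / m ≠ 0 := by
    rw [mul_div_assoc, mul_comm q]
    exact (r.mul_self hq0).one_sub_ne_zero
  have n7 := (r'.mul_self hq0).qPochInf_ne_zero hq0 hq
  have n7' := r'.one_sub_ne_zero
  have nq := qPochInf_ne_zero_of_norm_lt_one hq0 hq hq
  have e1 : bailD q l m ![a, b, c, d] = (φ (l / a) * φ (m / a) * (φ (l / b) * φ (m / b)) *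
    (φ (l / c) * φ (m / c)) * (φ (l / d) * φ (m / d))) * φ (l * m / q) /
    (φ q * φ (q * l / m) * φ (m / l * q)) := by
    rw [bailD, Fin.prod_univ_four, show q * m / l = m / l * q by ring]
    rfl
  have e2 : bailD q (l * q) m ![a * q, b, c, d] = (φ (l / a) * φ (m / (a * q)) *
    (φ (l / b * q) * φ (m / b)) * (φ (l / c * q) * φ (m / c)) *
    (φ (l / d * q) * φ (m / d))) * φ (l * m / q * q) /
    (φ q * φ (q * l / m * q) * φ (m / l)) := by
    rw [bailD, Fin.prod_univ_four, show q * m / (l * q) = m / l by field_simp,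
      show q * (l * q) / m = q * l / m * q by ring, show l * q * m / q = l * m / q * q by ring,
      ← show l * q / (a * q) = l / a by field_simp, ← show l * q / b = l / b * q by ring,
      ← show l * q / c = l / c * q by ring, ← show l * q / d = l / d * q by ring]
    rfl
  rw [show m / (a * q) * q = m / a by field_simp] at s1
  change 1 - m / a / q ≠ 0 at n1
  rw [div_div] at c1 c2 n1
  rw [bailSum, bailSum, e1, e2, s1, s2, s3, s4, s5, s6, s7]
  generalize ∑' k : ℕ, bailH q (l * q) m ![a * q, b, c, d] (l * q * q ^ k) = T1 at *
  generalize ∑' k : ℕ, bailH q (l * q) m ![a * q, b, c, d] (m * q ^ k) = T2 at *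
  generalize ∑' k : ℕ, bailH q l m ![a, b, c, d] (l * q ^ k) = T3 at *
  generalize ∑' k : ℕ, bailH q l m ![a, b, c, d] (m * q ^ k) = T4 at *
  have hml : l - m ≠ 0 := by
    intro h0
    apply n7'
    rw [sub_eq_zero.1 h0, div_self hm, sub_self]
  have hml' : l * q - m ≠ 0 := by
    intro h0
    apply n6'
    rw [mul_comm q, sub_eq_zero.1 h0, div_self hm, sub_self]
  have f6 : 1 - q * l / m = -(l * q - m) / m := by field_simp; ring
  have f7 : 1 - m / l = (l - m) / l := by field_simp
  rw [f6, f7]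
  clear s1 s2 s3 s4 s5 s6 s7 e1 e2 f6 f7 n6' n7' r r' hg h c3
  generalize φ (l / a) = A1 at *
  generalize φ (m / a) = A2 at *
  generalize φ (l / b * q) = B1 at *
  generalize φ (m / b) = B2 at *
  generalize φ (l / c * q) = C1 at *
  generalize φ (m / c) = C2 at *
  generalize φ (l / d * q) = D1 at *
  generalize φ (m / d) = D2 at *
  generalize φ (l * m / q * q) = M1 at *
  generalize φ (q * l / m * q) = M2 at *
  generalize φ (m / l * q) = M3 at *
  generalize φ q = M4 at *
  generalize l * (1 - l * a) = S at *
  -- The common right side of `c1` and `c2` cancels, leaving a homogeneous relation between the two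
  -- differences.
  have c4 : (1 - l * m / q) * ((1 - l / b) * (1 - l / c) * (1 - l / d)) * (T3 - T4) =
      -((1 - a * b) * (1 - a * c) * (1 - a * d) * (1 - m / (a * q)) * (l / m) * (T1 - T2)) := by
    linear_combination c1 - c2
  clear c1 c2
  generalize 1 - l * m / q = v1 at *
  generalize 1 - l / b = v2 at *
  generalize 1 - l / c = v3 at *
  generalize 1 - l / d = v4 at *
  generalize 1 - a * b = v5 at *
  generalize 1 - a * c = v6 at *
  generalize 1 - a * d = v7 at *
  generalize 1 - m / (a * q) = v8 at *
  generalize T3 - T4 = V at *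
  generalize T1 - T2 = W at *
  generalize l - m = x at *
  generalize l * q - m = y at *
  field_simp at c4 ⊢
  linear_combination (-A1 * A2 * B1 * B2 * C1 * C2 * D1 * D2 * M1) * c4

end BaileySum

/-- The `k`-th term of the first of the two series in a two-term very-well-poised sum. -/
def bailTerm {n : ℕ} (q l m : ℂ) (a : Fin n → ℂ) (k : ℕ) : ℂ :=
  q ^ k * (1 - l ^ 2 / q * q ^ (2 * k)) *
    (∏ i, qPochInf (l * a i * q ^ k) q * qPoch (l / a i) q k * qPochInf (m / a i) q) *
    qPoch (l * m / q) q k /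
    (qPoch q q k * qPochInf (l ^ 2 / q * q ^ k) q * qPochInf (m / l) q * qPoch (q * l / m) q k)

/-! ### Bailey's two-term sum: normalized terms and estimates -/

section BaileyLimit

variable {q : ℂ}

local notation "φ" x:max => qPochInf x q

/-- The factors φ(l/a_i), φ(lm/q), φ(q) and φ(ql/m) of the normalization are split after k factors,
and their tails cancel against the summand. The resulting form can be estimated uniformly in k. -/
theorem bailD_mul_bailH (hq0 : q ≠ 0) (hq : ‖q‖ < 1) {n : ℕ} {l m : ℂ} {a : Fin n → ℂ}
    (hl : l ≠ 0) (hlm : QGen q (l / m)) (hp : QGen q (l * m)) (ha : ∀ i, QGen q (l / a i)) (k : ℕ) :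
    bailD q l m a / (l - m) * bailH q l m a (l * q ^ k) = bailTerm q l m a k := by
  have p1 : ∀ i, φ (l / a i) = qPoch (l / a i) q k * φ (l * q ^ k / a i) := fun i => by
    rw [qPochInf_eq_qPoch_mul hq _ k, mul_div_right_comm]
  have n1 : ∀ i, φ (l * q ^ k / a i) ≠ 0 := fun i => by
    rw [mul_div_right_comm]
    exact ((ha i).mul_pow hq0 k).qPochInf_ne_zero hq0 hq
  have n2 : φ (m * (l * q ^ k) / q) ≠ 0 := by
    rw [← mul_assoc, mul_comm m, mul_div_right_comm]
    exact ((hp.div_self hq0).mul_pow hq0 k).qPochInf_ne_zero hq0 hq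
  have p2 : φ (l * m / q) = qPoch (l * m / q) q k * φ (m * (l * q ^ k) / q) := by
    rw [qPochInf_eq_qPoch_mul hq _ k]
    ring_nf
  have p3 : φ q = qPoch q q k * φ (q * (l * q ^ k) / l) := by
    rw [qPochInf_eq_qPoch_mul hq _ k, show q * (l * q ^ k) / l = q * q ^ k by field_simp]
  have n3 := qPochInf_ne_zero_of_norm_lt_one hq0 hq hq
  have p4 : φ (q * l / m) = qPoch (q * l / m) q k * φ (q * (l * q ^ k) / m) := by
    rw [qPochInf_eq_qPoch_mul hq _ k, show q * (l * q ^ k) / m = q * l / m * q ^ k by ring]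
  have n4 : φ (q * l / m) ≠ 0 := by
    rw [mul_div_assoc, mul_comm q]
    exact (hlm.mul_self hq0).qPochInf_ne_zero hq0 hq
  have hml : QGen q (m / l) := by simpa using hlm.inv
  have p5 : φ (m / l) = (l - m) / l * φ (q * m / l) := by
    rw [qPochInf_step hq, show 1 - m / l = (l - m) / l by field_simp,
      show m / l * q = q * m / l by ring]
  have n5 := hml.qPochInf_ne_zero hq0 hq
  have e1 : ∏ i, φ (l * a i * q ^ k) * qPoch (l / a i) q k * φ (m / a i) =
      (∏ i, φ (l / a i) * φ (m / a i)) * ∏ i, φ (l * q ^ k * a i) / φ (l * q ^ k / a i) := by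
    rw [← Finset.prod_mul_distrib]
    refine Finset.prod_congr rfl fun i _ => ?_
    have := n1 i
    rw [p1 i, mul_right_comm l]
    field_simp
  rw [bailTerm, e1, bailD, bailH, show l * (l * q ^ k) / q = l ^ 2 / q * q ^ k by ring,
    show (l * q ^ k) ^ 2 / q = l ^ 2 / q * q ^ (2 * k) by ring, p5]
  rw [p5] at n5
  have n6 : l - m ≠ 0 := by
    rintro h
    simp [h] at n5
  have n7 : φ (q * m / l) ≠ 0 := right_ne_zero_of_mul n5
  rw [p3] at n3
  rw [p4] at n4
  rw [p2, p3, p4]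
  have n31 := left_ne_zero_of_mul n3
  have n32 := right_ne_zero_of_mul n3
  have n41 := left_ne_zero_of_mul n4
  have n42 := right_ne_zero_of_mul n4
  generalize ∏ i, φ (l / a i) * φ (m / a i) = P1
  generalize ∏ i, φ (l * q ^ k * a i) / φ (l * q ^ k / a i) = P2
  generalize φ (q * (l * q ^ k) / l) = P3 at *
  generalize φ (q * (l * q ^ k) / m) = P4 at *
  generalize φ (m * (l * q ^ k) / q) = P5 at *
  generalize φ (q * m / l) = P6 at *
  generalize φ (l ^ 2 / q * q ^ k) = P7 at *
  generalize 1 - l ^ 2 / q * q ^ (2 * k) = P8 at *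
  field_simp

theorem BailGen.left_ne_zero {n : ℕ} {l m : ℂ} {a : Fin n → ℂ} (h : BailGen q l m a) : l ≠ 0 := by
  rintro rfl
  exact h.ratio.1 (by simp)

theorem BailGen.bailSum_eq_tsum (hq0 : q ≠ 0) (hq : ‖q‖ < 1) {n : ℕ} {l m : ℂ} {a : Fin n → ℂ}
    (h : BailGen q l m a) :
    bailSum q l m a = ∑' k, bailTerm q l m a k + ∑' k, bailTerm q m l a k := by
  have key : ∀ {l m : ℂ}, BailGen q l m a → ∑' k, bailTerm q l m a k =
      bailD q l m a / (l - m) * ∑' k : ℕ, bailH q l m a (l * q ^ k) := by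
    intro l m h
    rw [← tsum_mul_left]
    exact tsum_congr fun k =>
      (bailD_mul_bailH hq0 hq h.left_ne_zero h.ratio h.prod h.div_left k).symm
  have h1 : bailD q m l a = bailD q l m a := by
    simp only [bailD, mul_comm, mul_left_comm]
  have h2 : bailH q m l a = bailH q l m a := by
    ext t
    simp only [bailH, mul_comm (qPochInf (q * t / m) q), mul_comm (qPochInf (m * t / q) q)]
  rw [key h, key h.swap, bailSum, h1, h2, ← neg_sub l m, div_neg]
  ring

theorem norm_bailTerm_le (hq : ‖q‖ < 1) {n : ℕ} {l m : ℂ} {a : Fin n → ℂ} {R : ℝ}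
    (h1 : ∀ i, ‖l * a i‖ ≤ R) (h2 : ∀ i, ‖l / a i‖ ≤ R) (h3 : ∀ i, ‖m / a i‖ ≤ R)
    (h4 : ‖l * m / q‖ ≤ R) (h5 : ‖l ^ 2 / q‖ ≤ R) (k : ℕ) :
    ‖bailTerm q l m a k‖ ≤ ‖q‖ ^ k * ((1 + R) * (Real.exp (R / (1 - ‖q‖)) ^ 3) ^ n *
        Real.exp (R / (1 - ‖q‖))) /
      (‖qPoch q q k‖ * ‖φ (l ^ 2 / q * q ^ k)‖ * ‖φ (m / l)‖ * ‖qPoch (q * l / m) q k‖) := by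
  have hR : 0 ≤ R := (norm_nonneg _).trans h4
  have b1 : ‖1 - l ^ 2 / q * q ^ (2 * k)‖ ≤ 1 + R :=
    (norm_sub_le _ _).trans (by rw [norm_one]; gcongr; exact (norm_mul_pow_le hq _ _).trans h5)
  have b2 : ‖∏ i, φ (l * a i * q ^ k) * qPoch (l / a i) q k * φ (m / a i)‖ ≤
      (Real.exp (R / (1 - ‖q‖)) ^ 3) ^ n := by
    rw [norm_prod]
    calc _ ≤ ∏ _i : Fin n, Real.exp (R / (1 - ‖q‖)) ^ 3 := by
          refine Finset.prod_le_prod (fun _ _ => norm_nonneg _) fun i _ => ?_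
          rw [norm_mul, norm_mul, pow_succ, pow_two]
          gcongr
          · exact norm_qPochInf_le hq ((norm_mul_pow_le hq _ _).trans (h1 i))
          · exact norm_qPoch_le hq (h2 i) k
          · exact norm_qPochInf_le hq (h3 i)
      _ = _ := by simp
  rw [bailTerm, norm_div, norm_mul, norm_mul, norm_mul, norm_pow, norm_mul, norm_mul, norm_mul,
    ← mul_assoc, ← mul_assoc]
  gcongr
  exact norm_qPoch_le hq h4 k

theorem tendsto_norm_one_sub_mul_inv_pow (hq0 : q ≠ 0) (hq : ‖q‖ < 1) {y : ℂ} (hy : y ≠ 0) :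
    Tendsto (fun N : ℕ => ‖1 - y * (q ^ N)⁻¹‖) atTop atTop := by
  have h1 : Tendsto (fun N : ℕ => ‖y‖ * (‖q‖⁻¹) ^ N - 1) atTop atTop :=
    tendsto_atTop_add_const_right _ _ ((tendsto_pow_atTop_atTop_of_one_lt
      ((one_lt_inv₀ (norm_pos_iff.2 hq0)).2 hq)).const_mul_atTop (norm_pos_iff.2 hy))
  refine tendsto_atTop_mono (fun N => ?_) h1
  have := norm_sub_norm_le (y * (q ^ N)⁻¹) 1
  rw [norm_sub_rev]
  simpa using this

/-- Passing from N to N + 1 inserts a new first factor 1 - yq^(-N-1), which has absolute value at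
least 1 for large N. Hence a bound valid for one large N persists. -/
theorem exists_le_norm_qPoch_mul_inv_pow (hq0 : q ≠ 0) (hq : ‖q‖ < 1) {y : ℂ} (hy : QGen q y) :
    ∃ c > 0, ∀ᶠ N : ℕ in atTop, ∀ k : ℕ, c ≤ ‖qPoch (y * (q ^ N)⁻¹) q k‖ := by
  obtain ⟨M, hM⟩ := eventually_atTop.1
    ((tendsto_norm_one_sub_mul_inv_pow hq0 hq hy.1).eventually_ge_atTop 1)
  have hyM : QGen q (y * (q ^ M)⁻¹) := by
    simpa using hy.mul_zpow hq0 (-M)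
  obtain ⟨c, hc, h⟩ := exists_le_norm_qPoch hq0 hq hyM.not_mem_Omega
  refine ⟨min 1 c, lt_min one_pos hc, eventually_atTop.2 ⟨M, fun N hN => ?_⟩⟩
  induction N, hN using Nat.le_induction with
  | base => exact fun k => (min_le_right _ _).trans (h k)
  | succ N hN ih =>
    rintro (_ | k)
    · simp
    · rw [qPoch_succ', norm_mul, pow_succ, mul_inv, mul_assoc y, mul_assoc, inv_mul_cancel₀ hq0,
        mul_one]
      have h1 := hM (N + 1) (by omega)
      rw [pow_succ, mul_inv] at h1
      calc min 1 c ≤ 1 * ‖qPoch (y * (q ^ N)⁻¹) q k‖ := by simpa using ih k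
        _ ≤ _ := by gcongr

/-- The first factor carries the growth in N; the remaining ones are bounded below by the previous
lemma applied to yq. -/
theorem exists_mul_le_norm_qPoch_mul_inv_pow (hq0 : q ≠ 0) (hq : ‖q‖ < 1) {y : ℂ}
    (hy : QGen q y) :
    ∃ c > 0, ∀ᶠ N : ℕ in atTop, ∀ k : ℕ,
      c * ‖1 - y * (q ^ N)⁻¹‖ ≤ ‖qPoch (y * (q ^ N)⁻¹) q (k + 1)‖ := by
  obtain ⟨c, hc, h⟩ := exists_le_norm_qPoch_mul_inv_pow hq0 hq (hy.mul_self hq0)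
  refine ⟨c, hc, h.mono fun N hN k => ?_⟩
  rw [qPoch_succ', norm_mul, mul_comm c, mul_right_comm]
  gcongr
  exact hN k

theorem exists_mul_le_norm_qPochInf_mul_inv_pow (hq0 : q ≠ 0) (hq : ‖q‖ < 1) {y : ℂ}
    (hy : QGen q y) :
    ∃ c > 0, ∀ᶠ N : ℕ in atTop, c * ‖1 - y * (q ^ N)⁻¹‖ ≤ ‖φ (y * (q ^ N)⁻¹)‖ := by
  obtain ⟨c, hc, h⟩ := exists_mul_le_norm_qPoch_mul_inv_pow hq0 hq hy
  exact ⟨c, hc, h.mono fun N hN =>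
    ge_of_tendsto ((tendsto_qPoch hq _).norm.comp (tendsto_add_atTop_nat 1)) (.of_forall hN)⟩

theorem exists_le_norm_qPoch_mul_pow (hq0 : q ≠ 0) (hq : ‖q‖ < 1) {y : ℂ} (hy : QGen q y) :
    ∃ c > 0, ∀ N k : ℕ, c ≤ ‖qPoch (y * q ^ N) q k‖ := by
  obtain ⟨c, hc, h⟩ := exists_le_norm_qPochInf_mul_pow hq0 hq hy.not_mem_Omega
  refine ⟨c / Real.exp (‖y‖ / (1 - ‖q‖)), by positivity, fun N k => ?_⟩
  rw [div_le_iff₀ (Real.exp_pos _)]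
  refine (h N).trans ?_
  rw [qPochInf_eq_qPoch_mul hq _ k, norm_mul]
  gcongr
  rw [mul_assoc, ← pow_add]
  exact norm_qPochInf_le hq (norm_mul_pow_le hq _ _)

end BaileyLimit

/-! ### Bailey's two-term sum: the limit and the evaluation -/

section BaileyEvaluation

variable {q : ℂ}

local notation "φ" x:max => qPochInf x q

theorem exists_norm_bound_bail {n : ℕ} (q l m : ℂ) (a : Fin n → ℂ) : ∃ R : ℝ,
    (∀ i, ‖l * a i‖ ≤ R) ∧ (∀ i, ‖l / a i‖ ≤ R) ∧ (∀ i, ‖m / a i‖ ≤ R) ∧ ‖l * m / q‖ ≤ R ∧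
      ‖l ^ 2 / q‖ ≤ R := by
  have hs : ∀ f : Fin n → ℝ, (∀ i, 0 ≤ f i) → ∀ i, f i ≤ ∑ i, f i := fun f hf i =>
    Finset.single_le_sum (fun j _ => hf j) (Finset.mem_univ i)
  have s1 := hs (fun i => ‖l * a i‖) fun _ => norm_nonneg _
  have s2 := hs (fun i => ‖l / a i‖) fun _ => norm_nonneg _
  have s3 := hs (fun i => ‖m / a i‖) fun _ => norm_nonneg _
  have p1 : 0 ≤ ∑ i, ‖l * a i‖ := Finset.sum_nonneg fun _ _ => norm_nonneg _
  have p2 : 0 ≤ ∑ i, ‖l / a i‖ := Finset.sum_nonneg fun _ _ => norm_nonneg _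
  have p3 : 0 ≤ ∑ i, ‖m / a i‖ := Finset.sum_nonneg fun _ _ => norm_nonneg _
  have p4 := norm_nonneg (l * m / q)
  have p5 := norm_nonneg (l ^ 2 / q)
  refine ⟨∑ i, ‖l * a i‖ + ∑ i, ‖l / a i‖ + ∑ i, ‖m / a i‖ + ‖l * m / q‖ + ‖l ^ 2 / q‖,
    fun i => ?_, fun i => ?_, fun i => ?_, ?_, ?_⟩
  · linarith [s1 i]
  · linarith [s2 i]
  · linarith [s3 i]
  · linarith
  · linarith

theorem tendsto_two_mul_atTop : Tendsto (fun N : ℕ => 2 * N) atTop atTop :=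
  tendsto_atTop_mono (fun N => by simpa using Nat.le_mul_of_pos_left N two_pos) tendsto_id

theorem tendsto_mul_pow_mul_zero (hq : ‖q‖ < 1) (x : ℂ) {j : ℕ} (hj : 0 < j) :
    Tendsto (fun N : ℕ => x * q ^ (j * N)) atTop (𝓝 0) :=
  (tendsto_mul_pow_zero hq x).comp
    (tendsto_atTop_mono (fun N => by simpa using Nat.le_mul_of_pos_left N hj) tendsto_id)

/-- The unequal exponents N and 3N send m/l to 0. The denominator (q^(1-2N) l/m; q)_k then blows up
for every k ≥ 1, so only the term k = 0 survives, and it tends to 1. With equal exponents the ratio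
m/l would stay fixed. -/
theorem BailGen.tendsto_tsum_left (hq0 : q ≠ 0) (hq : ‖q‖ < 1) {n : ℕ} {l m : ℂ} {a : Fin n → ℂ}
    (h : BailGen q l m a) :
    Tendsto (fun N : ℕ => ∑' k, bailTerm q (l * q ^ N) (m * q ^ (3 * N)) (fun i => a i * q ^ N) k)
      atTop (𝓝 1) := by
  obtain ⟨R, h1, h2, h3, h4, h5⟩ := exists_norm_bound_bail q l m a
  have hml : QGen q (m / l) := by simpa using h.ratio.inv
  have hy : QGen q (q * l / m) := by
    rw [mul_div_assoc, mul_comm]; exact h.ratio.mul_self hq0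
  obtain ⟨c1, hc1, g1⟩ := exists_le_norm_qPoch hq0 hq
    (not_mem_Omega_of_norm_lt_one hq0 hq hq)
  obtain ⟨c2, hc2, g2⟩ := exists_le_norm_qPochInf_mul_pow hq0 hq
    (h.sq_left.div_self hq0).not_mem_Omega
  obtain ⟨c3, hc3, g3⟩ := exists_le_norm_qPochInf_mul_pow hq0 hq hml.not_mem_Omega
  obtain ⟨c4, hc4, g4⟩ := exists_le_norm_qPoch_mul_inv_pow hq0 hq hy
  obtain ⟨c5, hc5, g5⟩ := exists_mul_le_norm_qPoch_mul_inv_pow hq0 hq hy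
  have a1 : ∀ (N : ℕ) i, l * q ^ N * (a i * q ^ N) = l * a i * q ^ (2 * N) := fun N i => by ring
  have a2 : ∀ (N : ℕ) i, l * q ^ N / (a i * q ^ N) = l / a i := fun N i =>
    mul_div_mul_right _ _ (pow_ne_zero _ hq0)
  have a3 : ∀ (N : ℕ) i, m * q ^ (3 * N) / (a i * q ^ N) = m / a i * q ^ (2 * N) := fun N i => by
    have := pow_ne_zero N hq0
    field_simp
    ring
  have a4 : ∀ N : ℕ, l * q ^ N * (m * q ^ (3 * N)) / q = l * m / q * q ^ (4 * N) := fun N => by ring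
  have a5 : ∀ N : ℕ, (l * q ^ N) ^ 2 / q = l ^ 2 / q * q ^ (2 * N) := fun N => by ring
  have a6 : ∀ N : ℕ, m * q ^ (3 * N) / (l * q ^ N) = m / l * q ^ (2 * N) := fun N => by
    have := pow_ne_zero N hq0
    field_simp
    ring
  have a7 : ∀ N : ℕ, q * (l * q ^ N) / (m * q ^ (3 * N)) = q * l / m * (q ^ (2 * N))⁻¹ :=
    fun N => by
      have := pow_ne_zero N hq0
      field_simp
      ring
  set K : ℝ := (1 + R) * (Real.exp (R / (1 - ‖q‖)) ^ 3) ^ n * Real.exp (R / (1 - ‖q‖)) with hK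
  have hR : 0 ≤ R := (norm_nonneg _).trans h4
  have hK0 : 0 ≤ K := by positivity
  have bd : ∀ N k : ℕ, ‖bailTerm q (l * q ^ N) (m * q ^ (3 * N)) (fun i => a i * q ^ N) k‖ ≤
      ‖q‖ ^ k * K / (c1 * c2 * c3 * ‖qPoch (q * l / m * (q ^ (2 * N))⁻¹) q k‖) := by
    intro N k
    -- If this factor is zero, both the term and the bound are zero by the convention x/0 = 0.
    by_cases h0 : qPoch (q * l / m * (q ^ (2 * N))⁻¹) q k = 0
    · rw [bailTerm, a7, h0]
      simp
    refine (norm_bailTerm_le hq (R := R) (fun i => ?_) (fun i => ?_) (fun i => ?_) ?_ ?_ k).trans ?_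
    · rw [a1]; exact (norm_mul_pow_le hq _ _).trans (h1 i)
    · rw [a2]; exact h2 i
    · rw [a3]; exact (norm_mul_pow_le hq _ _).trans (h3 i)
    · rw [a4]; exact (norm_mul_pow_le hq _ _).trans h4
    · rw [a5]; exact (norm_mul_pow_le hq _ _).trans h5
    · rw [a5, a6, a7, mul_assoc _ (q ^ (2 * N)) (q ^ k), ← pow_add, ← hK]
      have := norm_pos_iff.2 h0
      gcongr
      · exact g1 k
      · exact g2 _
      · exact g3 _
  have hg : (1 : ℂ) = ∑' k : ℕ, if k = 0 then 1 else 0 := by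
    rw [tsum_ite_eq]
  rw [hg]
  refine tendsto_tsum_of_dominated_convergence
    (bound := fun k => ‖q‖ ^ k * (K / (c1 * c2 * c3 * c4)))
    ((summable_geometric_of_lt_one (norm_nonneg _) hq).mul_right _) (fun k => ?_) ?_
  · rcases k with _ | k
    · have e : ∀ N : ℕ, bailTerm q (l * q ^ N) (m * q ^ (3 * N)) (fun i => a i * q ^ N) 0 =
          (1 - l ^ 2 / q * q ^ (2 * N)) *
          (∏ i, φ (l * a i * q ^ (2 * N)) * φ (m / a i * q ^ (2 * N))) /
          (φ (l ^ 2 / q * q ^ (2 * N)) * φ (m / l * q ^ (2 * N))) := by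
        intro N
        simp only [bailTerm, a1, a3, a5, a6]
        simp
      simp only [e, if_true]
      have t := fun x => tendsto_mul_pow_mul_zero hq x (j := 2) (by norm_num)
      have t' := fun x => tendsto_qPochInf_one hq (t x)
      have := (((t (l ^ 2 / q)).const_sub 1).mul (tendsto_finsetProd Finset.univ fun i _ =>
        (t' (l * a i)).mul (t' (m / a i)))).div ((t' (l ^ 2 / q)).mul (t' (m / l))) (by simp)
      simpa [Pi.div_def] using this
    · simp only [Nat.add_eq_zero_iff, one_ne_zero, and_false, if_false]
      have hinf : Tendsto (fun N : ℕ => c1 * c2 * c3 * (c5 * ‖1 - q * l / m * (q ^ (2 * N))⁻¹‖))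
          atTop atTop :=
        (((tendsto_norm_one_sub_mul_inv_pow hq0 hq hy.1).comp tendsto_two_mul_atTop).const_mul_atTop
          hc5).const_mul_atTop (by positivity)
      refine squeeze_zero_norm' ?_
        (((tendsto_const_nhds (x := ‖q‖ ^ (k + 1) * K))).div_atTop hinf)
      filter_upwards [tendsto_two_mul_atTop.eventually g5, hinf.eventually_gt_atTop 0] with N hN hp
      refine (bd N (k + 1)).trans ?_
      gcongr
      exact hN k
  · filter_upwards [tendsto_two_mul_atTop.eventually g4] with N hN k
    refine (bd N k).trans ?_
    rw [← mul_div_assoc]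
    gcongr
    exact hN k

/-- In the companion series every term has the factor φ(q^(-2N) l/m) in its denominator, and this
factor tends to infinity. -/
theorem BailGen.tendsto_tsum_right (hq0 : q ≠ 0) (hq : ‖q‖ < 1) {n : ℕ} {l m : ℂ} {a : Fin n → ℂ}
    (h : BailGen q l m a) :
    Tendsto (fun N : ℕ => ∑' k, bailTerm q (m * q ^ (3 * N)) (l * q ^ N) (fun i => a i * q ^ N) k)
      atTop (𝓝 0) := by
  obtain ⟨R, h1, h2, h3, h4, h5⟩ := exists_norm_bound_bail q m l a
  have hml : QGen q (q * m / l) := by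
    rw [mul_div_assoc, mul_comm]; exact (by simpa using h.ratio.inv : QGen q (m / l)).mul_self hq0
  have hy : QGen q (l / m) := h.ratio
  obtain ⟨c1, hc1, g1⟩ := exists_le_norm_qPoch hq0 hq
    (not_mem_Omega_of_norm_lt_one hq0 hq hq)
  obtain ⟨c2, hc2, g2⟩ := exists_le_norm_qPochInf_mul_pow hq0 hq
    (h.sq_right.div_self hq0).not_mem_Omega
  obtain ⟨c3, hc3, g3⟩ := exists_le_norm_qPoch_mul_pow hq0 hq hml
  obtain ⟨c5, hc5, g5⟩ := exists_mul_le_norm_qPochInf_mul_inv_pow hq0 hq hy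
  have a1 : ∀ (N : ℕ) i, m * q ^ (3 * N) * (a i * q ^ N) = m * a i * q ^ (4 * N) :=
    fun N i => by ring
  have a2 : ∀ (N : ℕ) i, l * q ^ N / (a i * q ^ N) = l / a i := fun N i =>
    mul_div_mul_right _ _ (pow_ne_zero _ hq0)
  have a3 : ∀ (N : ℕ) i, m * q ^ (3 * N) / (a i * q ^ N) = m / a i * q ^ (2 * N) := fun N i => by
    have := pow_ne_zero N hq0
    field_simp
    ring
  have a4 : ∀ N : ℕ, m * q ^ (3 * N) * (l * q ^ N) / q = m * l / q * q ^ (4 * N) := fun N => by ring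
  have a5 : ∀ N : ℕ, (m * q ^ (3 * N)) ^ 2 / q = m ^ 2 / q * q ^ (6 * N) := fun N => by ring
  have a6 : ∀ N : ℕ, l * q ^ N / (m * q ^ (3 * N)) = l / m * (q ^ (2 * N))⁻¹ := fun N => by
    have := pow_ne_zero N hq0
    field_simp
    ring
  have a7 : ∀ N : ℕ, q * (m * q ^ (3 * N)) / (l * q ^ N) = q * m / l * q ^ (2 * N) :=
    fun N => by
      have := pow_ne_zero N hq0
      field_simp
      ring
  set K : ℝ := (1 + R) * (Real.exp (R / (1 - ‖q‖)) ^ 3) ^ n * Real.exp (R / (1 - ‖q‖)) with hK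
  have hR : 0 ≤ R := (norm_nonneg _).trans h4
  have hK0 : 0 ≤ K := by positivity
  have bd : ∀ N k : ℕ, ‖bailTerm q (m * q ^ (3 * N)) (l * q ^ N) (fun i => a i * q ^ N) k‖ ≤
      ‖q‖ ^ k * K / (c1 * c2 * ‖φ (l / m * (q ^ (2 * N))⁻¹)‖ * c3) := by
    intro N k
    by_cases h0 : φ (l / m * (q ^ (2 * N))⁻¹) = 0
    · rw [bailTerm, a6, h0]
      simp
    refine (norm_bailTerm_le hq (R := R) (fun i => ?_) (fun i => ?_) (fun i => ?_) ?_ ?_ k).trans ?_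
    · rw [a1]; exact (norm_mul_pow_le hq _ _).trans (h1 i)
    · rw [a3]; exact (norm_mul_pow_le hq _ _).trans (h2 i)
    · rw [a2]; exact h3 i
    · rw [a4]; exact (norm_mul_pow_le hq _ _).trans h4
    · rw [a5]; exact (norm_mul_pow_le hq _ _).trans h5
    · rw [a5, a6, a7, mul_assoc _ (q ^ (6 * N)) (q ^ k), ← pow_add, ← hK]
      have := norm_pos_iff.2 h0
      gcongr
      · exact g1 k
      · exact g2 _
      · exact g3 _ _
  have hinf : Tendsto (fun N : ℕ => c1 * c2 * (c5 * ‖1 - l / m * (q ^ (2 * N))⁻¹‖) * c3)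
      atTop atTop :=
    ((((tendsto_norm_one_sub_mul_inv_pow hq0 hq hy.1).comp tendsto_two_mul_atTop).const_mul_atTop
      hc5).const_mul_atTop (by positivity)).atTop_mul_const hc3
  have hg : (0 : ℂ) = ∑' k : ℕ, (0 : ℂ) := by simp
  rw [hg]
  refine tendsto_tsum_of_dominated_convergence
    (bound := fun k => ‖q‖ ^ k * K)
    ((summable_geometric_of_lt_one (norm_nonneg _) hq).mul_right _) (fun k => ?_) ?_
  · refine squeeze_zero_norm' ?_
      (((tendsto_const_nhds (x := ‖q‖ ^ k * K))).div_atTop hinf)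
    filter_upwards [tendsto_two_mul_atTop.eventually g5, hinf.eventually_gt_atTop 0] with N hN hp
    refine (bd N k).trans ?_
    gcongr
  · filter_upwards [tendsto_two_mul_atTop.eventually g5, hinf.eventually_ge_atTop 1] with N hN hp k
    refine (bd N k).trans (div_le_self (by positivity) (hp.trans ?_))
    gcongr

theorem BailGen.tendsto_bailSum (hq0 : q ≠ 0) (hq : ‖q‖ < 1) {n : ℕ} {l m : ℂ} {a : Fin n → ℂ}
    (h : BailGen q l m a) :
    Tendsto (fun N : ℕ => bailSum q (l * q ^ N) (m * q ^ (3 * N)) (fun i => a i * q ^ N))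
      atTop (𝓝 1) := by
  have := (h.tendsto_tsum_left hq0 hq).add (h.tendsto_tsum_right hq0 hq)
  rw [add_zero] at this
  exact this.congr fun N => ((h.shift hq0 N (3 * N) fun _ => N).bailSum_eq_tsum hq0 hq).symm

/-- Four contiguous steps raise each of a, b, c, d once. The first is paired with l; after
exchanging l and m the other three are paired with m. This asymmetric choice yields the exponents 1
and 3 that make the limit trivial. -/
theorem BailGen.bailSum_shift (hq0 : q ≠ 0) (hq : ‖q‖ < 1) {a b c d l m : ℂ}
    (ha : a ≠ 0) (hb : b ≠ 0) (hc : c ≠ 0) (hd : d ≠ 0)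
    (h : l * m = a * b * c * d) (hg : BailGen q l m ![a, b, c, d]) :
    bailSum q l m ![a, b, c, d] = (1 - a * b) * (1 - a * b * q) * ((1 - a * c) * (1 - a * c * q)) *
      ((1 - a * d) * (1 - a * d * q)) * ((1 - b * c) * (1 - b * c * q)) *
      ((1 - b * d) * (1 - b * d * q)) * ((1 - c * d) * (1 - c * d * q)) *
      bailSum q (l * q) (m * q ^ 3) ![a * q, b * q, c * q, d * q] := by
  have hl := hg.left_ne_zero
  have hm := hg.swap.left_ne_zero
  have rot : ∀ a b c d l m : ℂ, bailSum q l m ![a, b, c, d] = bailSum q m l ![b, c, d, a] := by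
    intro a b c d l m
    rw [bailSum_swap, ← bailSum_comp_equiv _ _ _ (finRotate 4)]
    congr 1
    ext i; fin_cases i <;> rfl
  have rot' : ∀ a b c d l m : ℂ, bailSum q l m ![a, b, c, d] = bailSum q l m ![b, c, d, a] := by
    intro a b c d l m
    rw [rot, bailSum_swap]
  have rotG : ∀ a b c d l m : ℂ, BailGen q l m ![a, b, c, d] → BailGen q l m ![b, c, d, a] := by
    intro a b c d l m h
    have e : ![b, c, d, a] = ![a, b, c, d] ∘ finRotate 4 := by
      ext i; fin_cases i <;> rfl
    rw [e]
    exact ⟨fun i => h.div_left _, fun i => h.div_right _, fun i => h.mul_left _,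
      fun i => h.mul_right _, h.ratio, h.sq_left, h.sq_right, h.prod⟩
  have shG : ∀ {a b c d l m : ℂ}, BailGen q l m ![a, b, c, d] →
      BailGen q (l * q) m ![a * q, b, c, d] := by
    intro a b c d l m h
    have := h.shift hq0 1 0 ![1, 0, 0, 0]
    have e : ![a * q, b, c, d] = fun t => ![a, b, c, d] t * q ^ (![1, 0, 0, 0] : Fin 4 → ℕ) t := by
      ext i; fin_cases i <;> simp
    rw [e]
    simpa using this
  have g1 := (rotG _ _ _ _ _ _ (shG hg)).swap
  have g2 := rotG _ _ _ _ _ _ (shG g1)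
  have g3 := rotG _ _ _ _ _ _ (shG g2)
  have hl' := mul_ne_zero hl hq0
  have hm' := mul_ne_zero hm hq0
  have hm'' := mul_ne_zero hm' hq0
  have ha' := mul_ne_zero ha hq0
  have hb' := mul_ne_zero hb hq0
  have hc' := mul_ne_zero hc hq0
  rw [bailSum_contiguous hq0 hq ha hb hc hd hl hm h hg, rot,
    bailSum_contiguous hq0 hq hb hc hd ha' hm hl' (by linear_combination q * h) g1, rot',
    bailSum_contiguous hq0 hq hc hd ha' hb' hm' hl' (by linear_combination q ^ 2 * h) g2, rot',
    bailSum_contiguous hq0 hq hd ha' hb' hc' hm'' hl' (by linear_combination q ^ 3 * h) g3, rot,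
    show m * q * q * q = m * q ^ 3 by ring, show b * (a * q) = a * b * q by ring,
    show c * (a * q) = a * c * q by ring, show c * (b * q) = b * c * q by ring,
    show d * (a * q) = a * d * q by ring, show d * (b * q) = b * d * q by ring,
    show d * (c * q) = c * d * q by ring]
  generalize 1 - a * b * q = v6
  generalize 1 - a * b = v0
  generalize 1 - a * c * q = v7
  generalize 1 - a * c = v1
  generalize 1 - a * d * q = v8
  generalize 1 - a * d = v2
  generalize 1 - b * c * q = v9
  generalize 1 - b * c = v3
  generalize 1 - b * d * q = v10
  generalize 1 - b * d = v4
  generalize 1 - c * d * q = v11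
  generalize 1 - c * d = v5
  ring

/-- Evaluation of the balanced two-term very-well-poised sum with four parameters. -/
theorem BailGen.bailSum_eq (hq0 : q ≠ 0) (hq : ‖q‖ < 1) {a b c d l m : ℂ}
    (ha : a ≠ 0) (hb : b ≠ 0) (hc : c ≠ 0) (hd : d ≠ 0)
    (h : l * m = a * b * c * d) (hg : BailGen q l m ![a, b, c, d]) :
    bailSum q l m ![a, b, c, d] =
      φ (a * b) * φ (a * c) * φ (a * d) * φ (b * c) * φ (b * d) * φ (c * d) := by
  have hN : ∀ N : ℕ, bailSum q l m ![a, b, c, d] = qPoch (a * b) q (2 * N) *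
      qPoch (a * c) q (2 * N) * qPoch (a * d) q (2 * N) * qPoch (b * c) q (2 * N) *
      qPoch (b * d) q (2 * N) * qPoch (c * d) q (2 * N) *
      bailSum q (l * q ^ N) (m * q ^ (3 * N)) (fun i => ![a, b, c, d] i * q ^ N) := by
    intro N
    induction N with
    | zero => simp
    | succ N ih =>
      have e : ∀ N, (fun i => ![a, b, c, d] i * q ^ N) =
          ![a * q ^ N, b * q ^ N, c * q ^ N, d * q ^ N] := by
        intro N; ext i; fin_cases i <;> rfl
      have g := hg.shift hq0 N (3 * N) fun _ => N
      have hqN := pow_ne_zero N hq0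
      rw [e] at g ih ⊢
      rw [ih, g.bailSum_shift hq0 hq (mul_ne_zero ha hqN) (mul_ne_zero hb hqN)
        (mul_ne_zero hc hqN) (mul_ne_zero hd hqN) (by linear_combination q ^ (4 * N) * h)]
      have p : ∀ x : ℂ, qPoch x q (2 * (N + 1)) =
          qPoch x q (2 * N) * ((1 - x * q ^ (2 * N)) * (1 - x * q ^ (2 * N) * q)) := by
        intro x
        rw [mul_add, mul_one, qPoch_succ, qPoch_succ]
        ring
      have e2 : ∀ x y : ℂ, x * q ^ N * (y * q ^ N) = x * y * q ^ (2 * N) := fun x y => by ring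
      have e3 : ∀ x : ℂ, x * q ^ N * q = x * q ^ (N + 1) := fun x => by ring
      rw [show m * q ^ (3 * N) * q ^ 3 = m * q ^ (3 * (N + 1)) by ring]
      simp only [p, e2, e3]
      generalize 1 - a * b * q ^ (2 * N) * q = v6
      generalize 1 - a * b * q ^ (2 * N) = v0
      generalize 1 - a * c * q ^ (2 * N) * q = v7
      generalize 1 - a * c * q ^ (2 * N) = v1
      generalize 1 - a * d * q ^ (2 * N) * q = v8
      generalize 1 - a * d * q ^ (2 * N) = v2
      generalize 1 - b * c * q ^ (2 * N) * q = v9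
      generalize 1 - b * c * q ^ (2 * N) = v3
      generalize 1 - b * d * q ^ (2 * N) * q = v10
      generalize 1 - b * d * q ^ (2 * N) = v4
      generalize 1 - c * d * q ^ (2 * N) * q = v11
      generalize 1 - c * d * q ^ (2 * N) = v5
      ring
  have t : ∀ x, Tendsto (fun N : ℕ => qPoch x q (2 * N)) atTop (𝓝 (φ x)) := fun x =>
    (tendsto_qPoch hq x).comp tendsto_two_mul_atTop
  have := ((((((t (a * b)).mul (t (a * c))).mul (t (a * d))).mul (t (b * c))).mul
    (t (b * d))).mul (t (c * d))).mul (hg.tendsto_bailSum hq0 hq)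
  rw [mul_one] at this
  exact tendsto_nhds_unique (tendsto_const_nhds.congr hN) this

end BaileyEvaluation

/-- The integrand of the six-parameter integral. -/
def sixFun {n : ℕ} (q l m : ℂ) (a : Fin n → ℂ) (z : ℂ) : ℂ :=
  qPochInf (z ^ 2) q * qPochInf (z ^ 2)⁻¹ q * (qPochPM l z q * qPochPM m z q) /
    ∏ i, qPochPM (a i) z q

/-- The integral over the unit circle with arbitrarily many parameters in the denominator. -/
def sixInt {n : ℕ} (q l m : ℂ) (a : Fin n → ℂ) : ℂ := Real.circleAverage (sixFun q l m a) 0 1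

/-- The part of the summand of `crossSum` that does not depend on the last four parameters
individually. -/
def crossH (q l m x y C u : ℂ) : ℂ :=
  u * (1 - C * u ^ 2 / q) *
    (qPochInf (u * l) q * qPochInf (u * m) q / (qPochInf (C * u / l) q * qPochInf (C * u / m) q)) *
    (qPochInf (q * u / x) q * qPochInf (q * u / y) q /
      (qPochInf (C * x * u / q) q * qPochInf (C * y * u / q) q))

/-- The normalizing factor of `crossSum`. -/
def crossD (q l m x y : ℂ) : ℂ :=
  qPochInf (m / y) q * qPochInf (l / y) q * qPochInf (m / x) q * qPochInf (l / x) q *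
    qPochInf (l * m / q) q / (qPochInf q q * qPochInf (q * x / y) q * qPochInf (q * y / x) q)

/-- The summand of `crossSum`. -/
def crossPsi (q l m x y a b c d u : ℂ) : ℂ :=
  crossH q l m x y (a * b * c * d) u *
    (qPochInf (u * b * c * d) q / qPochInf (u * a) q * (qPochInf (u * a * c * d) q / qPochInf (u * b) q) *
      (qPochInf (u * a * b * d) q / qPochInf (u * c) q) *
      (qPochInf (u * a * b * c) q / qPochInf (u * d) q))

/-- A two-term sum attached to a pair `x`, `y` of parameters of `sixInt`. -/
def crossSum (q l m x y a b c d : ℂ) : ℂ :=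
  crossD q l m x y / (x - y) *
    (∑' k : ℕ, crossPsi q l m x y a b c d (x * q ^ k) -
      ∑' k : ℕ, crossPsi q l m x y a b c d (y * q ^ k))

/-! ### Expansion of the six-parameter integral along a pair of parameters -/

section CrossSum

variable {q : ℂ}

local notation "φ" x:max => qPochInf x q

/-- An absolute value ρʲ with 1 ≤ j ≤ 6 lies strictly between |q| and 1, where no power of q lies.
All nondegeneracy conditions on the circle region have this form, apart from ratios of absolute
value 1. -/
theorem QGen.of_norm_eq_pow (hq : ‖q‖ < 1) {ρ : ℝ} (hρ0 : 0 < ρ) (hρ1 : ρ < 1) (hqρ : ‖q‖ < ρ ^ 6)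
    {x : ℂ} {j : ℕ} (h1 : 1 ≤ j) (h6 : j ≤ 6) (hx : ‖x‖ = ρ ^ j) : QGen q x := by
  refine QGen.of_norm hq ?_ ?_
  · rw [hx]
    exact hqρ.trans_le (pow_le_pow_of_le_one hρ0.le hρ1.le h6)
  · rw [hx]
    exact pow_lt_one₀ hρ0.le hρ1 (by omega)

theorem QGen.of_norm_eq_one (hq : ‖q‖ < 1) {x : ℂ} (h : ‖x‖ = 1) (h1 : x ≠ 1) :
    QGen q x := by
  refine ⟨ne_zero_of_norm_eq_one h, fun n hn => ?_⟩
  rw [hn, norm_zpow, zpow_eq_one_iff_right₀ (norm_nonneg _) hq.ne] at h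
  exact h1 (by rw [hn, h, zpow_zero])

/-- The four parameters of Bailey's sum are chosen so that the dependence on z is
φ(Cuz)φ(Cu/z)/(φ(uz)φ(u/z)). This is exactly the part of Rahman's integrand that involves its first
parameter u, when C is the product of the other four. -/
theorem bailH_cross {l m x y s C u z : ℂ} (hC : s ^ 2 = C) (hs : s ≠ 0) (hz : z ≠ 0) :
    bailH q (s * x) (s * y) ![l / s, m / s, s * z, s / z] (s * u) =
      s * (crossH q l m x y C u * (qPochPM (C * u) z q / qPochPM u z q)) := by
  subst hC
  have e : bailH q (s * x) (s * y) ![l / s, m / s, s * z, s / z] (s * u) =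
    s * u * (1 - (s * u) ^ 2 / q) * (φ (s * u * (l / s)) / φ (s * u / (l / s)) *
      (φ (s * u * (m / s)) / φ (s * u / (m / s))) * (φ (s * u * (s * z)) / φ (s * u / (s * z))) *
      (φ (s * u * (s / z)) / φ (s * u / (s / z)))) *
    (φ (q * (s * u) / (s * x)) * φ (q * (s * u) / (s * y)) /
      (φ (s * x * (s * u) / q) * φ (s * y * (s * u) / q))) := by
    rw [bailH, Fin.prod_univ_four]; rfl
  rw [e, crossH, qPochPM, qPochPM, show s * u * (l / s) = u * l by field_simp,
    show s * u * (m / s) = u * m by field_simp,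
    show s * u / (l / s) = s ^ 2 * u / l by field_simp,
    show s * u / (m / s) = s ^ 2 * u / m by field_simp,
    show s * u * (s * z) = s ^ 2 * u * z by ring,
    show s * u / (s * z) = u / z by field_simp, show s * u * (s / z) = s ^ 2 * u / z by ring,
    show s * u / (s / z) = u * z by field_simp,
    show q * (s * u) / (s * x) = q * u / x by field_simp,
    show q * (s * u) / (s * y) = q * u / y by field_simp,
    show s * x * (s * u) / q = s ^ 2 * x * u / q by ring,
    show s * y * (s * u) / q = s ^ 2 * y * u / q by ring, mul_pow]
  ring

/-- The normalization contributes φ(xz)φ(x/z)φ(yz)φ(y/z), the two factors of the denominator of the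
integrand that are being expanded. -/
theorem bailD_cross {l m x y s z : ℂ} (h : l * m = s ^ 2 * (x * y)) (hs : s ≠ 0)
    (hz : z ≠ 0) (hl : l ≠ 0) (hm : m ≠ 0) (hx : x ≠ 0) (hy : y ≠ 0) :
    bailD q (s * x) (s * y) ![l / s, m / s, s * z, s / z] =
      crossD q l m x y * (qPochPM x z q * qPochPM y z q) := by
  have e : bailD q (s * x) (s * y) ![l / s, m / s, s * z, s / z] =
    (φ (s * x / (l / s)) * φ (s * y / (l / s)) * (φ (s * x / (m / s)) * φ (s * y / (m / s))) *
      (φ (s * x / (s * z)) * φ (s * y / (s * z))) * (φ (s * x / (s / z)) * φ (s * y / (s / z)))) *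
      φ (s * x * (s * y) / q) / (φ q * φ (q * (s * x) / (s * y)) * φ (q * (s * y) / (s * x))) := by
    rw [bailD, Fin.prod_univ_four]; rfl
  rw [e, crossD, qPochPM, qPochPM,
    show s * x / (l / s) = m / y by field_simp; linear_combination -h,
    show s * y / (l / s) = m / x by field_simp; linear_combination -h,
    show s * x / (m / s) = l / y by field_simp; linear_combination -h,
    show s * y / (m / s) = l / x by field_simp; linear_combination -h,
    show s * x / (s * z) = x / z by field_simp, show s * y / (s * z) = y / z by field_simp,
    show s * x / (s / z) = x * z by field_simp, show s * y / (s / z) = y * z by field_simp,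
    show s * x * (s * y) / q = l * m / q by rw [h]; ring,
    show q * (s * x) / (s * y) = q * x / y by field_simp,
    show q * (s * y) / (s * x) = q * y / x by field_simp]
  ring

theorem bailGen_cross (hq : ‖q‖ < 1) {ρ : ℝ} (hρ0 : 0 < ρ) (hρ1 : ρ < 1)
    (hqρ : ‖q‖ < ρ ^ 6) {l m x y s z : ℂ} (hl : ‖l‖ = ρ ^ 3) (hm : ‖m‖ = ρ ^ 3) (hx : ‖x‖ = ρ)
    (hy : ‖y‖ = ρ) (hs : ‖s‖ = ρ ^ 2) (hz : ‖z‖ = 1) (hxy : x ≠ y) :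
    BailGen q (s * x) (s * y) ![l / s, m / s, s * z, s / z] := by
  have hy0 : y ≠ 0 := norm_pos_iff.1 (hy ▸ hρ0)
  have hs0 : s ≠ 0 := norm_pos_iff.1 (by rw [hs]; positivity)
  have key : ∀ {w : ℂ} (j : ℕ), 1 ≤ j → j ≤ 6 → ‖w‖ = ρ ^ j → QGen q w := fun j h1 h6 h =>
    QGen.of_norm_eq_pow hq hρ0 hρ1 hqρ h1 h6 h
  have n : ∀ {w : ℂ}, ‖w‖ = ρ → (QGen q (s * w / (l / s)) ∧ QGen q (s * w / (m / s)) ∧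
      QGen q (s * w / (s * z)) ∧ QGen q (s * w / (s / z))) ∧
      (QGen q (s * w * (l / s)) ∧ QGen q (s * w * (m / s)) ∧
      QGen q (s * w * (s * z)) ∧ QGen q (s * w * (s / z))) ∧ QGen q ((s * w) ^ 2) := by
    intro w hw
    refine ⟨⟨key 2 ?_ ?_ ?_, key 2 ?_ ?_ ?_, key 1 ?_ ?_ ?_, key 1 ?_ ?_ ?_⟩,
      ⟨key 4 ?_ ?_ ?_, key 4 ?_ ?_ ?_, key 5 ?_ ?_ ?_, key 5 ?_ ?_ ?_⟩, key 6 ?_ ?_ ?_⟩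
    all_goals
      first
        | norm_num
          done
        | simp only [norm_mul, norm_div, norm_pow, hl, hm, hw, hs, hz]
          field_simp
  refine ⟨?_, ?_, ?_, ?_, ?_, (n hx).2.2, (n hy).2.2, ?_⟩
  · intro i; fin_cases i
    exacts [(n hx).1.1, (n hx).1.2.1, (n hx).1.2.2.1, (n hx).1.2.2.2]
  · intro i; fin_cases i
    exacts [(n hy).1.1, (n hy).1.2.1, (n hy).1.2.2.1, (n hy).1.2.2.2]
  · intro i; fin_cases i
    exacts [(n hx).2.1.1, (n hx).2.1.2.1, (n hx).2.1.2.2.1, (n hx).2.1.2.2.2]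
  · intro i; fin_cases i
    exacts [(n hy).2.1.1, (n hy).2.1.2.1, (n hy).2.1.2.2.1, (n hy).2.1.2.2.2]
  · rw [mul_div_mul_left _ _ hs0]
    refine QGen.of_norm_eq_one hq ?_ ?_
    · rw [norm_div, hx, hy, div_self hρ0.ne']
    · rwa [Ne, div_eq_one_iff_eq hy0]
  · refine key 6 (by norm_num) le_rfl ?_
    simp only [norm_mul, hx, hy, hs]
    ring

theorem summable_norm_crossH (hq : ‖q‖ < 1) (l m x y C w : ℂ) :
    Summable fun k : ℕ => ‖crossH q l m x y C (w * q ^ k)‖ := by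
  have hc : ContinuousAt (fun u : ℂ => w * ((1 - C * u ^ 2 / q) *
      (φ (u * l) * φ (u * m) / (φ (C * u / l) * φ (C * u / m))) *
      (φ (q * u / x) * φ (q * u / y) / (φ (C * x * u / q) * φ (C * y * u / q))))) 0 := by
    have h1 : ContinuousAt (fun u : ℂ => 1 - C * u ^ 2 / q) 0 := by fun_prop
    refine continuousAt_const.mul ((h1.mul (ContinuousAt.div ?_ ?_ (by simp))).mul
      (ContinuousAt.div ?_ ?_ (by simp)))
    all_goals
      exact ContinuousAt.mul (continuousAt_qPochInf_comp hq (by fun_prop))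
        (continuousAt_qPochInf_comp hq (by fun_prop))
  refine ((summable_pow_mul_of_tendsto hq
    (hc.tendsto.comp (tendsto_mul_pow_zero hq w))).norm).congr fun k => ?_
  simp only [Function.comp, crossH]
  congr 1
  ring

theorem summable_crossPsi (hq : ‖q‖ < 1) (l m x y a b c d w : ℂ) :
    Summable fun k : ℕ => crossPsi q l m x y a b c d (w * q ^ k) := by
  have hc : ContinuousAt (fun u : ℂ => φ (u * b * c * d) / φ (u * a) *
      (φ (u * a * c * d) / φ (u * b)) * (φ (u * a * b * d) / φ (u * c)) *
      (φ (u * a * b * c) / φ (u * d))) 0 := by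
    refine (((ContinuousAt.div ?_ ?_ (by simp)).mul (ContinuousAt.div ?_ ?_ (by simp))).mul
      (ContinuousAt.div ?_ ?_ (by simp))).mul (ContinuousAt.div ?_ ?_ (by simp))
    all_goals exact continuousAt_qPochInf_comp hq (by fun_prop)
  have hb : (fun k : ℕ => φ (w * q ^ k * b * c * d) / φ (w * q ^ k * a) *
      (φ (w * q ^ k * a * c * d) / φ (w * q ^ k * b)) *
      (φ (w * q ^ k * a * b * d) / φ (w * q ^ k * c)) *
      (φ (w * q ^ k * a * b * c) / φ (w * q ^ k * d))) =O[atTop] fun _ => (1 : ℝ) :=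
    (hc.tendsto.comp (tendsto_mul_pow_zero hq w)).isBigO_one ℝ
  have ho : (fun k : ℕ => crossPsi q l m x y a b c d (w * q ^ k)) =O[atTop]
      fun k : ℕ => ‖crossH q l m x y (a * b * c * d) (w * q ^ k)‖ * (1 : ℝ) :=
    (Asymptotics.isBigO_norm_right.2 (Asymptotics.isBigO_refl _ _)).mul hb
  refine summable_of_isBigO_nat (summable_norm_crossH hq l m x y (a * b * c * d) w) ?_
  simpa using ho

theorem hasSum_circleAverage {f : ℕ → ℂ → ℂ} {g : ℂ → ℂ} {bound : ℕ → ℝ} (hb : Summable bound)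
    (hf : ∀ k z, ‖z‖ = 1 → DifferentiableAt ℂ (f k) z)
    (hle : ∀ k z, ‖z‖ = 1 → ‖f k z‖ ≤ bound k) (hg : ∀ z, ‖z‖ = 1 → HasSum (f · z) (g z)) :
    HasSum (fun k => Real.circleAverage (f k) 0 1) (Real.circleAverage g 0 1) := by
  have hn : ∀ θ : ℝ, ‖circleMap 0 1 θ‖ = 1 := fun θ => by simp
  simp only [Real.circleAverage_def]
  refine HasSum.const_smul _ (intervalIntegral.hasSum_integral_of_dominated_convergence
    (fun k _ => bound k) (fun k => ?_) (fun k => ?_) ?_ ?_ ?_)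
  · refine Continuous.aestronglyMeasurable ?_
    exact continuous_iff_continuousAt.2 fun θ =>
      ((hf k _ (hn θ)).continuousAt.comp (continuous_circleMap 0 1).continuousAt)
  · exact .of_forall fun θ _ => hle k _ (hn θ)
  · exact .of_forall fun θ _ => hb
  · exact intervalIntegrable_const
  · exact .of_forall fun θ _ => hg _ (hn θ)

/-- A single constant dominates Rahman's integrand for all first parameters xq^k and yq^k at once,
as termwise integration requires. -/
theorem exists_norm_rahmanFun_le (hq0 : q ≠ 0) (hq : ‖q‖ < 1) {ρ : ℝ} (hρ1 : ρ < 1) :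
    ∃ K : ℝ, ∀ a b c d e z : ℂ, ‖a‖ ≤ ρ → ‖b‖ ≤ ρ → ‖c‖ ≤ ρ → ‖d‖ ≤ ρ → ‖e‖ ≤ ρ → ‖z‖ = 1 →
      ‖rahmanFun q a b c d e z‖ ≤ K := by
  obtain ⟨c0, hc0, hc⟩ := exists_le_norm_qPochInf hq0 hq hρ1
  have hPM : ∀ x z : ℂ, ‖x‖ ≤ ρ → ‖z‖ = 1 → c0 * c0 ≤ ‖qPochPM x z q‖ := by
    intro x z hx hz
    rw [qPochPM, norm_mul]
    gcongr
    · exact hc _ (by rwa [norm_mul, hz, mul_one])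
    · exact hc _ (by rwa [norm_div, hz, div_one])
  set E := Real.exp (1 / (1 - ‖q‖))
  refine ⟨E * E * (E * E) / (c0 * c0 * (c0 * c0) * (c0 * c0) * (c0 * c0) * (c0 * c0)), ?_⟩
  intro a b c d e z ha hb hcc hd he hz
  have h1 : ‖a * b * c * d * e‖ ≤ 1 := by
    have h0 : 0 ≤ ρ := (norm_nonneg _).trans ha
    simp only [norm_mul]
    calc _ ≤ ρ * ρ * ρ * ρ * ρ := by gcongr
      _ = ρ ^ 5 := by ring
      _ ≤ 1 := pow_le_one₀ h0 hρ1.le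
  simp only [rahmanFun, norm_div, norm_mul]
  gcongr
  · exact norm_qPochInf_le hq (by simp [hz])
  · exact norm_qPochInf_le hq (by simp [hz])
  · rw [qPochPM, norm_mul]
    gcongr
    · exact norm_qPochInf_le hq (by rwa [norm_mul, hz, mul_one])
    · exact norm_qPochInf_le hq (by rwa [norm_div, hz, div_one])
  all_goals exact hPM _ _ ‹_› hz

/-- Expansion of the six-parameter integral into a two-term sum attached to two parameters. -/
theorem sixInt_mul_eq_crossSum (hq0 : q ≠ 0) (hq : ‖q‖ < 1) {ρ : ℝ} (hρ0 : 0 < ρ) (hρ1 : ρ < 1)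
    (hqρ : ‖q‖ < ρ ^ 6) {l m x y a b c d : ℂ} (hl : ‖l‖ = ρ ^ 3) (hm : ‖m‖ = ρ ^ 3)
    (hx : ‖x‖ = ρ) (hy : ‖y‖ = ρ) (ha : ‖a‖ = ρ) (hb : ‖b‖ = ρ) (hc : ‖c‖ = ρ) (hd : ‖d‖ = ρ)
    (hxy : x ≠ y) (h : l * m = a * b * c * d * (x * y)) :
    sixInt q l m ![x, y, a, b, c, d] * (φ (x * y) *
      (φ (a * b) * φ (a * c) * φ (a * d) * φ (b * c) * φ (b * d) * φ (c * d))) =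
    2 / φ q * crossSum q l m x y a b c d := by
  -- With s² = abcd the data sx, sy; l/s, m/s, sz, s/z are balanced: both products equal lm.
  obtain ⟨s, hs⟩ := IsAlgClosed.exists_pow_nat_eq (a * b * c * d) (n := 2) (by norm_num)
  have hC : ‖a * b * c * d‖ = ρ ^ 4 := by
    simp only [norm_mul, ha, hb, hc, hd]; ring
  have hsn : ‖s‖ = ρ ^ 2 := by
    have : ‖s‖ ^ 2 = (ρ ^ 2) ^ 2 := by rw [← norm_pow, hs, hC]; ring
    exact (pow_left_inj₀ (norm_nonneg _) (by positivity) two_ne_zero).1 this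
  have hs0 : s ≠ 0 := norm_pos_iff.1 (by rw [hsn]; positivity)
  have hl0 : l ≠ 0 := norm_pos_iff.1 (by rw [hl]; positivity)
  have hm0 : m ≠ 0 := norm_pos_iff.1 (by rw [hm]; positivity)
  have hx0 : x ≠ 0 := norm_pos_iff.1 (by rwa [hx])
  have hy0 : y ≠ 0 := norm_pos_iff.1 (by rwa [hy])
  have hne : ∀ {w : ℂ}, ‖w‖ < 1 → φ w ≠ 0 := fun h => qPochInf_ne_zero_of_norm_lt_one hq0 hq h
  have hlt : ∀ {w : ℂ}, ‖w‖ = ρ → ‖w‖ < 1 := fun h => h ▸ hρ1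
  obtain ⟨K, hK⟩ := exists_norm_rahmanFun_le hq0 hq hρ1
  have hu : ∀ {w : ℂ} (k : ℕ), ‖w‖ = ρ → ‖w * q ^ k‖ ≤ ρ := fun k h =>
    (norm_mul_pow_le hq _ k).trans h.le
  have hsum : ∀ {w : ℂ}, ‖w‖ = ρ → ∀ z : ℂ, ‖z‖ = 1 → Summable fun k : ℕ =>
      crossH q l m x y (a * b * c * d) (w * q ^ k) * rahmanFun q (w * q ^ k) a b c d z := by
    intro w hw z hz
    refine Summable.of_norm_bounded
      ((summable_norm_crossH hq l m x y (a * b * c * d) w).mul_right K) fun k => ?_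
    rw [norm_mul]
    gcongr
    exact hK _ _ _ _ _ _ (hu k hw) ha.le hb.le hc.le hd.le hz
  -- the pointwise expansion of the integrand
  have hpt : ∀ z : ℂ, ‖z‖ = 1 → φ (x * y) * φ (a * b * c * d) *
      sixFun q l m ![x, y, a, b, c, d] z = crossD q l m x y / (x - y) *
      (∑' k : ℕ, crossH q l m x y (a * b * c * d) (x * q ^ k) *
          rahmanFun q (x * q ^ k) a b c d z -
        ∑' k : ℕ, crossH q l m x y (a * b * c * d) (y * q ^ k) *
          rahmanFun q (y * q ^ k) a b c d z) := by
    intro z hz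
    have hz0 := ne_zero_of_norm_eq_one hz
    have hg := bailGen_cross hq hρ0 hρ1 hqρ hl hm hx hy hsn hz hxy
    have S := hg.bailSum_eq hq0 hq (div_ne_zero hl0 hs0) (div_ne_zero hm0 hs0)
      (mul_ne_zero hs0 hz0) (div_ne_zero hs0 hz0) (by
        field_simp
        rw [h, ← hs]; ring)
    have nx := qPochPM_ne_zero hq0 hq (hlt hx) hz
    have ny := qPochPM_ne_zero hq0 hq (hlt hy) hz
    have na := qPochPM_ne_zero hq0 hq (hlt ha) hz
    have nb := qPochPM_ne_zero hq0 hq (hlt hb) hz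
    have nc := qPochPM_ne_zero hq0 hq (hlt hc) hz
    have nd := qPochPM_ne_zero hq0 hq (hlt hd) hz
    have e1 : ∀ w : ℂ, ∑' k : ℕ, crossH q l m x y (a * b * c * d) (w * q ^ k) *
          rahmanFun q (w * q ^ k) a b c d z = φ (z ^ 2) * φ (z ^ 2)⁻¹ /
          (qPochPM a z q * qPochPM b z q * qPochPM c z q * qPochPM d z q) / s *
        ∑' k : ℕ, bailH q (s * x) (s * y) ![l / s, m / s, s * z, s / z] (s * w * q ^ k) := by
      intro w
      rw [← tsum_mul_left]
      refine tsum_congr fun k => ?_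
      rw [mul_assoc s w, bailH_cross hs hs0 hz0, rahmanFun,
        show w * q ^ k * a * b * c * d = a * b * c * d * (w * q ^ k) by ring]
      field_simp
    have e2 : sixFun q l m ![x, y, a, b, c, d] z =
        φ (z ^ 2) * φ (z ^ 2)⁻¹ * (qPochPM l z q * qPochPM m z q) /
        (qPochPM x z q * qPochPM y z q * qPochPM a z q * qPochPM b z q * qPochPM c z q *
          qPochPM d z q) := by
      rw [sixFun, Fin.prod_univ_six]; rfl
    rw [bailSum, bailD_cross (by rw [h, hs]) hs0 hz0 hl0 hm0 hx0 hy0,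
      show l / s * (m / s) = x * y by
        field_simp; rw [h, ← hs]; ring,
      show l / s * (s * z) = l * z by field_simp, show l / s * (s / z) = l / z by field_simp,
      show m / s * (s * z) = m * z by field_simp, show m / s * (s / z) = m / z by field_simp,
      show s * z * (s / z) = a * b * c * d by rw [← hs]; field_simp] at S
    have S' : crossD q l m x y * (qPochPM x z q * qPochPM y z q) / (s * x - s * y) *
        (∑' k : ℕ, bailH q (s * x) (s * y) ![l / s, m / s, s * z, s / z] (s * x * q ^ k) -
          ∑' k : ℕ, bailH q (s * x) (s * y) ![l / s, m / s, s * z, s / z] (s * y * q ^ k)) =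
        φ (x * y) * φ (a * b * c * d) * (qPochPM l z q * qPochPM m z q) := by
      rw [S, qPochPM, qPochPM]; ring
    rw [e1, e1, e2, ← mul_sub]
    have hxy' := sub_ne_zero.2 hxy
    rw [← mul_sub] at S'
    generalize ∑' k : ℕ, bailH q (s * x) (s * y) ![l / s, m / s, s * z, s / z] (s * x * q ^ k) -
          ∑' k : ℕ, bailH q (s * x) (s * y) ![l / s, m / s, s * z, s / z] (s * y * q ^ k) = V at *
    generalize φ (x * y) * φ (a * b * c * d) = W at *
    generalize qPochPM l z q * qPochPM m z q = L at *
    generalize x - y = v at *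
    rw [← mul_div_assoc, mul_left_comm, ← S']
    field_simp
  -- termwise integration
  have hint : HasSum (fun k : ℕ => crossD q l m x y / (x - y) *
      (crossH q l m x y (a * b * c * d) (x * q ^ k) * rahmanInt q (x * q ^ k) a b c d -
        crossH q l m x y (a * b * c * d) (y * q ^ k) * rahmanInt q (y * q ^ k) a b c d))
      (φ (x * y) * φ (a * b * c * d) * sixInt q l m ![x, y, a, b, c, d]) := by
    have hd' : ∀ {w : ℂ} (k : ℕ), ‖w‖ = ρ → ∀ z : ℂ, ‖z‖ = 1 →
        DifferentiableAt ℂ (rahmanFun q (w * q ^ k) a b c d) z := fun k hw z hz =>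
      differentiableAt_rahmanFun hq0 hq ((hu k hw).trans_lt hρ1) (hlt ha) (hlt hb) (hlt hc)
        (hlt hd) hz
    have hS := hasSum_circleAverage (f := fun (k : ℕ) => (crossD q l m x y / (x - y)) •
      (crossH q l m x y (a * b * c * d) (x * q ^ k) • rahmanFun q (x * q ^ k) a b c d -
        crossH q l m x y (a * b * c * d) (y * q ^ k) • rahmanFun q (y * q ^ k) a b c d))
      (g := (φ (x * y) * φ (a * b * c * d)) • sixFun q l m ![x, y, a, b, c, d])
      ((((summable_norm_crossH hq l m x y (a * b * c * d) x).mul_right K).add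
        ((summable_norm_crossH hq l m x y (a * b * c * d) y).mul_right K)).mul_left
        ‖crossD q l m x y / (x - y)‖) (fun k z hz => ?_)
      (fun k z hz => ?_) (fun z hz => ?_)
    · rw [← mul_circleAverage] at hS
      refine hS.congr_fun fun k => ?_
      rw [← mul_circleAverage, Real.circleAverage_sub
        (circleIntegrable_of_differentiableAt (hd' k hx)).const_smul
        (circleIntegrable_of_differentiableAt (hd' k hy)).const_smul, ← mul_circleAverage,
        ← mul_circleAverage]
      rfl
    · exact (((hd' k hx z hz).const_smul _).sub ((hd' k hy z hz).const_smul _)).const_smul _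
    · simp only [Pi.smul_apply, Pi.sub_apply, smul_eq_mul, norm_mul]
      gcongr
      refine (norm_sub_le _ _).trans ?_
      simp only [norm_mul]
      gcongr
      · exact hK _ _ _ _ _ _ (hu k hx) ha.le hb.le hc.le hd.le hz
      · exact hK _ _ _ _ _ _ (hu k hy) ha.le hb.le hc.le hd.le hz
    · simp only [Pi.smul_apply, Pi.sub_apply, smul_eq_mul]
      rw [hpt z hz]
      exact ((hsum hx z hz).hasSum.sub (hsum hy z hz).hasSum).mul_left _
  -- φ(abcd) arises once from Bailey's evaluation (as φ(sz · s/z)) and once from Rahman's; it is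
  -- cancelled at the end.
  have nC : φ (a * b * c * d) ≠ 0 := hne (by rw [hC]; exact pow_lt_one₀ hρ0.le hρ1 (by norm_num))
  -- Rahman's evaluation with first parameter u = wq^k: the products φ(ua), …, φ(ud) and the triple
  -- products containing u are the factors that turn `crossH` into `crossPsi`.
  have hterm : ∀ {w : ℂ} (k : ℕ), ‖w‖ = ρ →
      crossH q l m x y (a * b * c * d) (w * q ^ k) * rahmanInt q (w * q ^ k) a b c d *
        (φ (a * b) * φ (a * c) * φ (a * d) * φ (b * c) * φ (b * d) * φ (c * d)) =
      2 / φ q * φ (a * b * c * d) * crossPsi q l m x y a b c d (w * q ^ k) := by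
    intro w k hw
    have hR := rahmanInt_eq hq0 hq ((hu k hw).trans_lt hρ1) (hlt ha) (hlt hb) (hlt hc) (hlt hd)
    have n' : ∀ {v : ℂ}, ‖v‖ = ρ → φ (w * q ^ k * v) ≠ 0 := fun hv => hne (by
      rw [norm_mul]
      exact mul_lt_one_of_nonneg_of_lt_one_left (norm_nonneg _) ((hu k hw).trans_lt hρ1)
        (hlt hv).le)
    have n1 := n' ha
    have n2 := n' hb
    have n3 := n' hc
    have n4 := n' hd
    rw [crossPsi]
    generalize crossH q l m x y (a * b * c * d) (w * q ^ k) = H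
    generalize rahmanInt q (w * q ^ k) a b c d = R at *
    generalize w * q ^ k = u at *
    generalize 2 / φ q = κ at *
    generalize φ (a * b * c * d) = V at *
    rw [div_mul_div_comm, div_mul_div_comm, div_mul_div_comm, ← mul_div_assoc, ← mul_div_assoc,
      eq_div_iff (mul_ne_zero (mul_ne_zero (mul_ne_zero n1 n2) n3) n4)]
    linear_combination H * hR
  have hpsi : ∀ {w : ℂ}, ‖w‖ = ρ → Summable fun k : ℕ =>
      crossPsi q l m x y a b c d (w * q ^ k) := fun {w} _ => summable_crossPsi hq ..
  have h2 : HasSum (fun k : ℕ => φ (a * b * c * d) * (2 / φ q * (crossD q l m x y / (x - y) *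
      (crossPsi q l m x y a b c d (x * q ^ k) - crossPsi q l m x y a b c d (y * q ^ k)))))
      (φ (a * b * c * d) * (sixInt q l m ![x, y, a, b, c, d] * (φ (x * y) *
      (φ (a * b) * φ (a * c) * φ (a * d) * φ (b * c) * φ (b * d) * φ (c * d))))) := by
    have h4 := hint.mul_right
      (φ (a * b) * φ (a * c) * φ (a * d) * φ (b * c) * φ (b * d) * φ (c * d))
    rw [show φ (x * y) * φ (a * b * c * d) * sixInt q l m ![x, y, a, b, c, d] *
      (φ (a * b) * φ (a * c) * φ (a * d) * φ (b * c) * φ (b * d) * φ (c * d)) =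
      φ (a * b * c * d) * (sixInt q l m ![x, y, a, b, c, d] * (φ (x * y) *
      (φ (a * b) * φ (a * c) * φ (a * d) * φ (b * c) * φ (b * d) * φ (c * d)))) by ring] at h4
    refine h4.congr_fun fun k => ?_
    linear_combination (-crossD q l m x y / (x - y)) * (hterm k hx - hterm k hy)
  have h3 := ((((hpsi hx).hasSum.sub (hpsi hy).hasSum).mul_left
    (crossD q l m x y / (x - y))).mul_left (2 / φ q)).mul_left (φ (a * b * c * d))
  exact mul_left_cancel₀ nC (h2.unique h3)

end CrossSum

/-! ### Proportionality of two six-parameter integrals and the two-term evaluation -/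

section Transformation

variable {q : ℂ}

local notation "φ" x:max => qPochInf x q

/-- With e² = a₁a₂a₃a₄, the substitution a_i ↦ e/a_i (i ≤ 4), (a₅, a₆) ↦ (l/e, m/e), (l, m) ↦ (a₆e,
a₅e) merely permutes the factors of the summand, provided u is rescaled by e/(a₁a₂). The rescaling
maps the starting points a₂, a₁ to e/a₁, e/a₂. -/
theorem crossPsi_transform {a₁ a₂ a₃ a₄ a₅ a₆ e l m : ℂ} (h₁ : a₁ ≠ 0) (h₂ : a₂ ≠ 0)
    (h₃ : a₃ ≠ 0) (h₅ : a₅ ≠ 0) (he : e ≠ 0) (hl : l ≠ 0) (hm : m ≠ 0)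
    (h₄ : a₄ = e ^ 2 / (a₁ * a₂ * a₃)) (h₆ : a₆ = l * m / (e ^ 2 * a₅)) (u : ℂ) :
    crossPsi q (a₆ * e) (a₅ * e) (e / a₁) (e / a₂) (e / a₃) (e / a₄) (l / e) (m / e)
      (e / (a₁ * a₂) * u) = e / (a₁ * a₂) * crossPsi q l m a₂ a₁ a₃ a₄ a₅ a₆ u := by
  have e1 : e / a₃ * (e / a₄) * (l / e) * (m / e) * (e / (a₁ * a₂) * u) ^ 2 / q =
      a₃ * a₄ * a₅ * a₆ * u ^ 2 / q := by rw [h₄, h₆]; field_simp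
  have e2 : e / (a₁ * a₂) * u * (a₆ * e) = u * a₃ * a₄ * a₆ := by rw [h₄, h₆]; field_simp
  have e3 : e / (a₁ * a₂) * u * (a₅ * e) = u * a₃ * a₄ * a₅ := by rw [h₄]; field_simp
  have e4 : e / a₃ * (e / a₄) * (l / e) * (m / e) * (e / (a₁ * a₂) * u) / (a₆ * e) = u * a₅ := by
    rw [h₄, h₆]; field_simp
  have e5 : e / a₃ * (e / a₄) * (l / e) * (m / e) * (e / (a₁ * a₂) * u) / (a₅ * e) = u * a₆ := by
    rw [h₄, h₆]; field_simp
  have e6 : q * (e / (a₁ * a₂) * u) / (e / a₁) = q * u / a₂ := by field_simp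
  have e7 : q * (e / (a₁ * a₂) * u) / (e / a₂) = q * u / a₁ := by field_simp
  have e8 : e / a₃ * (e / a₄) * (l / e) * (m / e) * (e / a₁) * (e / (a₁ * a₂) * u) / q =
      a₃ * a₄ * a₅ * a₆ * a₂ * u / q := by rw [h₄, h₆]; field_simp
  have e9 : e / a₃ * (e / a₄) * (l / e) * (m / e) * (e / a₂) * (e / (a₁ * a₂) * u) / q =
      a₃ * a₄ * a₅ * a₆ * a₁ * u / q := by rw [h₄, h₆]; field_simp
  have e10 : e / (a₁ * a₂) * u * (e / a₄) * (l / e) * (m / e) = u * a₃ * a₅ * a₆ := by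
    rw [h₄, h₆]; field_simp
  have e11 : e / (a₁ * a₂) * u * (e / a₃) * (l / e) * (m / e) = u * a₄ * a₅ * a₆ := by
    rw [h₄, h₆]; field_simp
  have e12 : e / (a₁ * a₂) * u * (e / a₃) * (e / a₄) * (m / e) = u * m := by
    rw [h₄]; field_simp
  have e13 : e / (a₁ * a₂) * u * (e / a₃) * (e / a₄) * (l / e) = u * l := by
    rw [h₄]; field_simp
  have e14 : e / (a₁ * a₂) * u * (e / a₃) = u * a₄ := by rw [h₄]; field_simp
  have e15 : e / (a₁ * a₂) * u * (e / a₄) = u * a₃ := by rw [h₄]; field_simp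
  have e16 : e / (a₁ * a₂) * u * (l / e) = a₃ * a₄ * a₅ * a₆ * u / m := by
    rw [h₄, h₆]; field_simp
  have e17 : e / (a₁ * a₂) * u * (m / e) = a₃ * a₄ * a₅ * a₆ * u / l := by
    rw [h₄, h₆]; field_simp
  rw [crossPsi, crossPsi, crossH, crossH, e1, e2, e3, e4, e5, e6, e7, e8, e9, e10, e11, e12, e13,
    e14, e15, e16, e17]
  ring

/-- For the transformed data and the pair l/e, m/e the four parameters left over are e/a₁, …, e/a₄,
with product e². The triple products then turn into ta₁, …, ta₄, and the summand becomes symmetric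
in all six a_i. -/
theorem crossPsi_bail {a₁ a₂ a₃ a₄ a₅ a₆ e l m : ℂ} (h₁ : a₁ ≠ 0) (h₂ : a₂ ≠ 0)
    (h₃ : a₃ ≠ 0) (h₅ : a₅ ≠ 0) (he : e ≠ 0) (hl : l ≠ 0) (hm : m ≠ 0)
    (h₄ : a₄ = e ^ 2 / (a₁ * a₂ * a₃)) (h₆ : a₆ = l * m / (e ^ 2 * a₅)) (t : ℂ) :
    crossPsi q (a₆ * e) (a₅ * e) (l / e) (m / e) (e / a₁) (e / a₂) (e / a₃) (e / a₄)
      (e⁻¹ * t) = e⁻¹ * bailH q l m ![a₁, a₂, a₃, a₄, a₅, a₆] t := by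
  have eC : e / a₁ * (e / a₂) * (e / a₃) * (e / a₄) = e ^ 2 := by rw [h₄]; field_simp
  have e1 : e ^ 2 * (e⁻¹ * t) ^ 2 / q = t ^ 2 / q := by field_simp
  have e2 : e⁻¹ * t * (a₆ * e) = t * a₆ := by field_simp
  have e3 : e⁻¹ * t * (a₅ * e) = t * a₅ := by field_simp
  have e4 : e ^ 2 * (e⁻¹ * t) / (a₆ * e) = t / a₆ := by rw [h₆]; field_simp
  have e5 : e ^ 2 * (e⁻¹ * t) / (a₅ * e) = t / a₅ := by field_simp
  have e6 : q * (e⁻¹ * t) / (l / e) = q * t / l := by field_simp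
  have e7 : q * (e⁻¹ * t) / (m / e) = q * t / m := by field_simp
  have e8 : e ^ 2 * (l / e) * (e⁻¹ * t) / q = l * t / q := by field_simp
  have e9 : e ^ 2 * (m / e) * (e⁻¹ * t) / q = m * t / q := by field_simp
  have e10 : e⁻¹ * t * (e / a₂) * (e / a₃) * (e / a₄) = t * a₁ := by rw [h₄]; field_simp
  have e11 : e⁻¹ * t * (e / a₁) * (e / a₃) * (e / a₄) = t * a₂ := by rw [h₄]; field_simp
  have e12 : e⁻¹ * t * (e / a₁) * (e / a₂) * (e / a₄) = t * a₃ := by rw [h₄]; field_simp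
  have e13 : e⁻¹ * t * (e / a₁) * (e / a₂) * (e / a₃) = t * a₄ := by rw [h₄]; field_simp
  have e14 : ∀ a, e⁻¹ * t * (e / a) = t / a := fun a => by field_simp
  have eb : bailH q l m ![a₁, a₂, a₃, a₄, a₅, a₆] t = t * (1 - t ^ 2 / q) *
    (φ (t * a₁) / φ (t / a₁) * (φ (t * a₂) / φ (t / a₂)) * (φ (t * a₃) / φ (t / a₃)) *
      (φ (t * a₄) / φ (t / a₄)) * (φ (t * a₅) / φ (t / a₅)) * (φ (t * a₆) / φ (t / a₆))) *
    (φ (q * t / l) * φ (q * t / m) / (φ (l * t / q) * φ (m * t / q))) := by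
    rw [bailH, Fin.prod_univ_six]; rfl
  rw [crossPsi, crossH, eC, e1, e2, e3, e4, e5, e6, e7, e8, e9, e10, e11, e12, e13, e14, e14, e14,
    e14, eb]
  ring

theorem crossSum_transform {a₁ a₂ a₃ a₄ a₅ a₆ e l m : ℂ} (h₁ : a₁ ≠ 0) (h₂ : a₂ ≠ 0)
    (h₃ : a₃ ≠ 0) (h₅ : a₅ ≠ 0) (he : e ≠ 0) (hl : l ≠ 0) (hm : m ≠ 0)
    (h₄ : a₄ = e ^ 2 / (a₁ * a₂ * a₃)) (h₆ : a₆ = l * m / (e ^ 2 * a₅)) :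
    crossSum q (a₆ * e) (a₅ * e) (e / a₁) (e / a₂) (e / a₃) (e / a₄) (l / e) (m / e) *
      (φ (m / a₁) * φ (l / a₁) * φ (m / a₂) * φ (l / a₂)) =
    crossSum q l m a₂ a₁ a₃ a₄ a₅ a₆ * (φ (a₁ * a₅) * φ (a₁ * a₆) * φ (a₂ * a₅) * φ (a₂ * a₆)) := by
  have t1 : ∀ k : ℕ, e / a₁ * q ^ k = e / (a₁ * a₂) * (a₂ * q ^ k) := fun k => by field_simp
  have t2 : ∀ k : ℕ, e / a₂ * q ^ k = e / (a₁ * a₂) * (a₁ * q ^ k) := fun k => by field_simp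
  have d1 : a₅ * e / (e / a₂) = a₂ * a₅ := by field_simp
  have d2 : a₆ * e / (e / a₂) = a₂ * a₆ := by field_simp
  have d3 : a₅ * e / (e / a₁) = a₁ * a₅ := by field_simp
  have d4 : a₆ * e / (e / a₁) = a₁ * a₆ := by field_simp
  have d5 : a₆ * e * (a₅ * e) / q = l * m / q := by rw [h₆]; field_simp
  have d6 : q * (e / a₁) / (e / a₂) = q * a₂ / a₁ := by field_simp
  have d7 : q * (e / a₂) / (e / a₁) = q * a₁ / a₂ := by field_simp
  have d8 : e / a₁ - e / a₂ = e / (a₁ * a₂) * (a₂ - a₁) := by field_simp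
  rw [crossSum, crossSum, crossD, crossD, d1, d2, d3, d4, d5, d6, d7, d8]
  simp only [t1, t2, crossPsi_transform h₁ h₂ h₃ h₅ he hl hm h₄ h₆, tsum_mul_left, ← mul_sub]
  have h12 : e / (a₁ * a₂) ≠ 0 := div_ne_zero he (mul_ne_zero h₁ h₂)
  have hττ := mul_inv_cancel₀ h12
  clear t1 t2 d1 d2 d3 d4 d5 d6 d7 d8
  generalize e / (a₁ * a₂) = τ at *
  generalize ∑' k : ℕ, crossPsi q l m a₂ a₁ a₃ a₄ a₅ a₆ (a₂ * q ^ k) -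
    ∑' k : ℕ, crossPsi q l m a₂ a₁ a₃ a₄ a₅ a₆ (a₁ * q ^ k) = V
  generalize φ q * φ (q * a₂ / a₁) * φ (q * a₁ / a₂) = W
  rw [div_eq_mul_inv _ (τ * (a₂ - a₁)), mul_inv]
  generalize τ⁻¹ = τ' at *
  linear_combination (φ (a₂ * a₅) * φ (a₂ * a₆) * φ (a₁ * a₅) * φ (a₁ * a₆) * φ (l * m / q) / W *
    (a₂ - a₁)⁻¹ * V * (φ (m / a₁) * φ (l / a₁) * φ (m / a₂) * φ (l / a₂))) * hττ

theorem crossSum_bail {a₁ a₂ a₃ a₄ a₅ a₆ e l m : ℂ} (h₁ : a₁ ≠ 0) (h₂ : a₂ ≠ 0)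
    (h₃ : a₃ ≠ 0) (h₅ : a₅ ≠ 0) (he : e ≠ 0) (hl : l ≠ 0) (hm : m ≠ 0)
    (h₄ : a₄ = e ^ 2 / (a₁ * a₂ * a₃)) (h₆ : a₆ = l * m / (e ^ 2 * a₅)) :
    crossSum q (a₆ * e) (a₅ * e) (l / e) (m / e) (e / a₁) (e / a₂) (e / a₃) (e / a₄) *
      (φ (l / a₁) * φ (m / a₁) * (φ (l / a₂) * φ (m / a₂)) * (φ (l / a₃) * φ (m / a₃)) *
        (φ (l / a₄) * φ (m / a₄))) = bailSum q l m ![a₁, a₂, a₃, a₄, a₅, a₆] := by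
  have t1 : ∀ (w : ℂ) (k : ℕ), w / e * q ^ k = e⁻¹ * (w * q ^ k) := fun w k => by field_simp
  have d1 : a₅ * e / (m / e) = l / a₆ := by rw [h₆]; field_simp
  have d2 : a₆ * e / (m / e) = l / a₅ := by rw [h₆]; field_simp
  have d3 : a₅ * e / (l / e) = m / a₆ := by rw [h₆]; field_simp
  have d4 : a₆ * e / (l / e) = m / a₅ := by rw [h₆]; field_simp
  have d5 : a₆ * e * (a₅ * e) / q = l * m / q := by rw [h₆]; field_simp
  have d6 : q * (l / e) / (m / e) = q * l / m := by field_simp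
  have d7 : q * (m / e) / (l / e) = q * m / l := by field_simp
  have d8 : l / e - m / e = e⁻¹ * (l - m) := by field_simp
  have eb : bailD q l m ![a₁, a₂, a₃, a₄, a₅, a₆] =
      φ (l / a₁) * φ (m / a₁) * (φ (l / a₂) * φ (m / a₂)) * (φ (l / a₃) * φ (m / a₃)) *
        (φ (l / a₄) * φ (m / a₄)) * (φ (l / a₅) * φ (m / a₅)) * (φ (l / a₆) * φ (m / a₆)) *
        φ (l * m / q) / (φ q * φ (q * l / m) * φ (q * m / l)) := by
    rw [bailD, Fin.prod_univ_six]; rfl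
  rw [crossSum, crossD, bailSum, eb, d1, d2, d3, d4, d5, d6, d7, d8]
  simp only [t1, crossPsi_bail h₁ h₂ h₃ h₅ he hl hm h₄ h₆, tsum_mul_left, ← mul_sub]
  generalize ∑' k : ℕ, bailH q l m ![a₁, a₂, a₃, a₄, a₅, a₆] (l * q ^ k) -
    ∑' k : ℕ, bailH q l m ![a₁, a₂, a₃, a₄, a₅, a₆] (m * q ^ k) = V
  rw [div_eq_mul_inv _ (e⁻¹ * (l - m)), mul_inv, inv_inv]
  have hee := mul_inv_cancel₀ he
  generalize φ q * φ (q * l / m) * φ (q * m / l) = W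
  generalize e⁻¹ = e' at *
  linear_combination (φ (l / a₆) * φ (l / a₅) * φ (m / a₆) * φ (m / a₅) *
    φ (l * m / q) / W * (l - m)⁻¹ * V * (φ (l / a₁) * φ (m / a₁) * (φ (l / a₂) * φ (m / a₂)) *
      (φ (l / a₃) * φ (m / a₃)) * (φ (l / a₄) * φ (m / a₄)))) * hee

/-- The six-parameter integral as a two-term very-well-poised sum. -/
theorem sixInt_mul_eq_bailSum (hq0 : q ≠ 0) (hq : ‖q‖ < 1) {ρ : ℝ} (hρ0 : 0 < ρ) (hρ1 : ρ < 1)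
    (hqρ : ‖q‖ < ρ ^ 6) {a₁ a₂ a₃ a₄ a₅ a₆ l m : ℂ} (hl : ‖l‖ = ρ ^ 3) (hm : ‖m‖ = ρ ^ 3)
    (n₁ : ‖a₁‖ = ρ) (n₂ : ‖a₂‖ = ρ) (n₃ : ‖a₃‖ = ρ) (n₄ : ‖a₄‖ = ρ) (n₅ : ‖a₅‖ = ρ)
    (n₆ : ‖a₆‖ = ρ) (h₁₂ : a₁ ≠ a₂) (hlm : l ≠ m) (h : l * m = a₁ * a₂ * a₃ * a₄ * a₅ * a₆) :
    sixInt q l m ![a₁, a₂, a₃, a₄, a₅, a₆] *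
      (φ (a₁ * a₂) * φ (a₁ * a₃) * φ (a₁ * a₄) * φ (a₁ * a₅) * φ (a₁ * a₆) *
        (φ (a₂ * a₃) * φ (a₂ * a₄) * φ (a₂ * a₅) * φ (a₂ * a₆)) *
        (φ (a₃ * a₄) * φ (a₃ * a₅) * φ (a₃ * a₆)) * (φ (a₄ * a₅) * φ (a₄ * a₆)) * φ (a₅ * a₆)) =
    2 / φ q * bailSum q l m ![a₁, a₂, a₃, a₄, a₅, a₆] := by
  have hne : ∀ {w : ℂ} (j : ℕ), ‖w‖ = ρ ^ j → w ≠ 0 := fun j hw =>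
    norm_pos_iff.1 (by rw [hw]; positivity)
  have h₁ := hne 1 (by simpa using n₁)
  have h₂ := hne 1 (by simpa using n₂)
  have h₃ := hne 1 (by simpa using n₃)
  have h₄ := hne 1 (by simpa using n₄)
  have h₅ := hne 1 (by simpa using n₅)
  have hl0 := hne 3 hl
  have hm0 := hne 3 hm
  -- The square root e fixes the transformed integral, with parameters e/a₁, …, e/a₄, l/e, m/e and
  -- numerator parameters a₆e, a₅e.
  obtain ⟨e, he2⟩ := IsAlgClosed.exists_pow_nat_eq (a₁ * a₂ * a₃ * a₄) (n := 2) (by norm_num)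
  have hen : ‖e‖ = ρ ^ 2 := by
    have : ‖e‖ ^ 2 = (ρ ^ 2) ^ 2 := by
      rw [← norm_pow, he2]
      simp only [norm_mul, n₁, n₂, n₃, n₄]; ring
    exact (pow_left_inj₀ (norm_nonneg _) (by positivity) two_ne_zero).1 this
  have he := hne 2 hen
  have g₄ : a₄ = e ^ 2 / (a₁ * a₂ * a₃) := by rw [he2]; field_simp
  have g₆ : a₆ = l * m / (e ^ 2 * a₅) := by rw [he2, h]; field_simp
  -- As |e| = ρ², the transformed parameters have absolute values ρ and ρ³ again, so the same
  -- expansion applies to them.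
  have N : ∀ {a : ℂ}, ‖a‖ = ρ → ‖e / a‖ = ρ := fun ha => by
    rw [norm_div, hen, ha]; field_simp
  have N' : ∀ {a : ℂ}, ‖a‖ = ρ → ‖a * e‖ = ρ ^ 3 := fun ha => by
    rw [norm_mul, hen, ha]; ring
  have N'' : ∀ {a : ℂ}, ‖a‖ = ρ ^ 3 → ‖a / e‖ = ρ := fun ha => by
    rw [norm_div, hen, ha]; field_simp
  have hprod : a₆ * e * (a₅ * e) = l * m := by rw [g₆]; field_simp
  -- `F1` expands the original integral along a₂, a₁. `F2` and `F3` expand the transformed one along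
  -- e/a₁, e/a₂ and along l/e, m/e. `C1` links the sums in `F1` and `F2`; `C2` identifies the sum in
  -- `F3`.
  have F1 := sixInt_mul_eq_crossSum hq0 hq hρ0 hρ1 hqρ hl hm n₂ n₁ n₃ n₄ n₅ n₆ h₁₂.symm
    (by rw [h]; ring)
  have F2 := sixInt_mul_eq_crossSum hq0 hq hρ0 hρ1 hqρ (N' n₆) (N' n₅) (N n₁) (N n₂) (N n₃) (N n₄)
    (N'' hl) (N'' hm) (fun h' => h₁₂ (by
      rw [div_eq_div_iff h₁ h₂] at h'
      exact (mul_left_cancel₀ he h').symm)) (by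
      rw [hprod, g₄]; field_simp)
  have F3 := sixInt_mul_eq_crossSum hq0 hq hρ0 hρ1 hqρ (N' n₆) (N' n₅) (N'' hl) (N'' hm) (N n₁)
    (N n₂) (N n₃) (N n₄) (fun h' => hlm ((div_left_inj' he).1 h')) (by
      rw [hprod, g₄]; field_simp)
  have C1 := crossSum_transform (q := q) h₁ h₂ h₃ h₅ he hl0 hm0 g₄ g₆
  have C2 := crossSum_bail (q := q) h₁ h₂ h₃ h₅ he hl0 hm0 g₄ g₆
  have p12 : e / a₁ * (e / a₂) = a₃ * a₄ := by rw [g₄]; field_simp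
  have p34 : e / a₃ * (e / a₄) = a₁ * a₂ := by rw [g₄]; field_simp
  have p13 : e / a₁ * (e / a₃) = a₂ * a₄ := by rw [g₄]; field_simp
  have p14 : e / a₁ * (e / a₄) = a₂ * a₃ := by rw [g₄]; field_simp
  have p23 : e / a₂ * (e / a₃) = a₁ * a₄ := by rw [g₄]; field_simp
  have p24 : e / a₂ * (e / a₄) = a₁ * a₃ := by rw [g₄]; field_simp
  have pe : ∀ w a, e / a * (w / e) = w / a := fun w a => by field_simp
  have p56 : l / e * (m / e) = a₅ * a₆ := by rw [g₆]; field_simp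
  have s1 : sixInt q l m ![a₂, a₁, a₃, a₄, a₅, a₆] = sixInt q l m ![a₁, a₂, a₃, a₄, a₅, a₆] := by
    rw [sixInt, sixInt]
    congr 1
    ext z
    simp only [sixFun, Fin.prod_univ_six]
    congr 1
    exact congrArg (· * _ * _ * _ * _) (mul_comm _ _)
  have s2 : ∀ a b c d x y : ℂ, sixInt q (a₆ * e) (a₅ * e) ![x, y, a, b, c, d] =
      sixInt q (a₆ * e) (a₅ * e) ![a, b, c, d, x, y] := by
    intro a b c d x y
    rw [sixInt, sixInt]
    congr 1
    ext z
    rw [sixFun, sixFun, Fin.prod_univ_six, Fin.prod_univ_six]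
    congr 1
    change qPochPM x z q * qPochPM y z q * qPochPM a z q * qPochPM b z q * qPochPM c z q *
      qPochPM d z q = qPochPM a z q * qPochPM b z q * qPochPM c z q * qPochPM d z q *
      qPochPM x z q * qPochPM y z q
    ring
  rw [s1, mul_comm a₂ a₁] at F1
  rw [p12, p34, pe, pe, pe, pe, p56] at F2
  rw [s2, p12, p13, p14, p23, p24, p34, p56] at F3
  have nz : ∀ {x y : ℂ}, ‖x‖ = ρ → ‖y‖ = ρ → φ (x * y) ≠ 0 := fun hx hy =>
    qPochInf_ne_zero_of_norm_lt_one hq0 hq (by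
      rw [norm_mul, hx, hy]; exact mul_lt_one_of_nonneg_of_lt_one_left hρ0.le hρ1 hρ1.le)
  have z1 := nz n₁ n₂
  have z2 := nz n₃ n₄
  have z3 := nz n₅ n₆
  rw [← C2]
  generalize sixInt q l m ![a₁, a₂, a₃, a₄, a₅, a₆] = I at *
  generalize sixInt q (a₆ * e) (a₅ * e) ![e / a₁, e / a₂, e / a₃, e / a₄, l / e, m / e] = I' at *
  generalize crossSum q (a₆ * e) (a₅ * e) (e / a₁) (e / a₂) (e / a₃) (e / a₄) (l / e) (m / e) =
    S1 at *
  generalize crossSum q (a₆ * e) (a₅ * e) (l / e) (m / e) (e / a₁) (e / a₂) (e / a₃) (e / a₄) =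
    S2 at *
  generalize crossSum q l m a₂ a₁ a₃ a₄ a₅ a₆ = S3 at *
  generalize 2 / φ q = κ at *
  clear s1 s2 p12 p34 p13 p14 p23 p24 pe p56 nz C2
  generalize φ (a₁ * a₂) = A12 at *
  generalize φ (a₁ * a₃) = A13 at *
  generalize φ (a₁ * a₄) = A14 at *
  generalize φ (a₁ * a₅) = A15 at *
  generalize φ (a₁ * a₆) = A16 at *
  generalize φ (a₂ * a₃) = A23 at *
  generalize φ (a₂ * a₄) = A24 at *
  generalize φ (a₂ * a₅) = A25 at *
  generalize φ (a₂ * a₆) = A26 at *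
  generalize φ (a₃ * a₄) = A34 at *
  generalize φ (a₃ * a₅) = A35 at *
  generalize φ (a₃ * a₆) = A36 at *
  generalize φ (a₄ * a₅) = A45 at *
  generalize φ (a₄ * a₆) = A46 at *
  generalize φ (a₅ * a₆) = A56 at *
  generalize φ (l / a₁) = L1 at *
  generalize φ (l / a₂) = L2 at *
  generalize φ (l / a₃) = L3 at *
  generalize φ (l / a₄) = L4 at *
  generalize φ (m / a₁) = M1 at *
  generalize φ (m / a₂) = M2 at *
  generalize φ (m / a₃) = M3 at *
  generalize φ (m / a₄) = M4 at *
  -- Eliminating the cross sums between `F1`, `C1` and `F2` gives the proportionality of the two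
  -- integrals, up to a common nonzero factor.
  have key : (A12 * A34 * A56) * (I * (A15 * A16 * A25 * A26 * A35 * A36 * A45 * A46)) =
      (A12 * A34 * A56) * (I' * (L1 * M1 * (L2 * M2) * (L3 * M3) * (L4 * M4))) := by
    linear_combination (A15 * A16 * A25 * A26) * F1 - κ * C1 - (M1 * L1 * M2 * L2) * F2
  have key' := mul_left_cancel₀ (mul_ne_zero (mul_ne_zero z1 z2) z3) key
  linear_combination (A12 * A13 * A14 * A23 * A24 * A34 * A56) * key' +
    (L1 * M1 * (L2 * M2) * (L3 * M3) * (L4 * M4)) * F3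

end Transformation

/-! ### Residues in an annulus -/

section Residues

variable {q : ℂ}

local notation "φ" x:max => qPochInf x q

/-- Partial fractions in 1/w: the Lagrange basis polynomials at the nodes 1/a_i sum to 1; evaluate
at 1/w and divide by the product. -/
theorem one_div_prod_one_sub_div {n : ℕ} [NeZero n] {a : Fin n → ℂ} (hinj : Function.Injective a)
    (ha : ∀ i, a i ≠ 0) {w : ℂ} (hw : w ≠ 0) (hwa : ∀ i, w ≠ a i) :
    1 / ∏ i, (1 - a i / w) =
      ∑ i, 1 / (∏ j ∈ Finset.univ.erase i, (1 - a j / a i)) * (w / (w - a i)) := by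
  have hv : Set.InjOn (fun i => (a i)⁻¹) (Finset.univ : Finset (Fin n)) :=
    fun i _ j _ h => hinj (inv_injective h)
  have hs := congrArg (Polynomial.eval w⁻¹) (Lagrange.sum_basis hv Finset.univ_nonempty)
  rw [Polynomial.eval_finsetSum, Polynomial.eval_one] at hs
  have hne : ∀ i, 1 - a i / w ≠ 0 := fun i h => hwa i (by
    rw [sub_eq_zero, eq_comm, div_eq_one_iff_eq hw] at h
    exact h.symm)
  have hs' := congrArg (· / ∏ i, (1 - a i / w)) hs.symm
  rw [Finset.sum_div] at hs'
  refine hs'.trans ?_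
  refine Finset.sum_congr rfl fun i _ => ?_
  rw [Lagrange.basis, Polynomial.eval_prod, ← Finset.mul_prod_erase _ _ (Finset.mem_univ i)]
  have e : ∏ j ∈ Finset.univ.erase i, Polynomial.eval w⁻¹ (Lagrange.basisDivisor (a i)⁻¹ (a j)⁻¹) =
      (∏ j ∈ Finset.univ.erase i, (1 - a j / w)) / ∏ j ∈ Finset.univ.erase i, (1 - a j / a i) := by
    rw [← Finset.prod_div_distrib]
    refine Finset.prod_congr rfl fun j hj => ?_
    have hij : a i ≠ a j := fun h => (Finset.ne_of_mem_erase hj) (hinj h).symm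
    have := ha i
    have := ha j
    have h1 : (a i)⁻¹ - (a j)⁻¹ ≠ 0 := sub_ne_zero.2 fun h => hij (inv_injective h)
    have h2 : 1 - a j / a i ≠ 0 := by
      rw [sub_ne_zero, Ne, eq_comm, div_eq_one_iff_eq (ha i)]
      exact hij.symm
    have h3 : (a i)⁻¹ - (a j)⁻¹ = -(1 - a j / a i) / a j := by field_simp; ring
    simp only [Lagrange.basisDivisor, Polynomial.eval_mul, Polynomial.eval_C, Polynomial.eval_sub,
      Polynomial.eval_X]
    rw [h3]
    generalize 1 - a j / a i = v at *
    field_simp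
    ring
  have h4 : ∏ j ∈ Finset.univ.erase i, (1 - a j / w) ≠ 0 := Finset.prod_ne_zero_iff.2 fun j _ => hne j
  have h5 := hne i
  have h6 : w - a i ≠ 0 := sub_ne_zero.2 (hwa i)
  have h7 : w / (w - a i) = 1 / (1 - a i / w) := by field_simp
  rw [e, h7]
  generalize ∏ j ∈ Finset.univ.erase i, (1 - a j / w) = P at *
  field_simp

theorem circleAverage_div_sub {a : ℂ} (ha : ‖a‖ < 1) :
    Real.circleAverage (fun w => w / (w - a)) 0 1 = 1 := by
  have := DiffContOnCl.circleAverage_smul_div (f := fun _ : ℂ => (1 : ℂ)) (c := 0) (R := 1) (w := a)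
    diffContOnCl_const (by simpa using ha)
  simpa using this

/-- The pole lies outside |z| = |q|, so the mean value property gives the value at the center, which
is 0. Compared with the average 1 over the unit circle, the simple pole between the circles
contributes 1. -/
theorem circleAverage_mul_div_sub {a : ℂ} (ha : ‖q‖ < ‖a‖) :
    Real.circleAverage (fun w => q * w / (q * w - a)) 0 1 = 0 := by
  have hd : DiffContOnCl ℂ (fun w => q * w / (q * w - a)) (Metric.ball 0 |(1 : ℝ)|) := by
    refine DifferentiableOn.diffContOnCl fun w hw => ?_
    rw [abs_one, closure_ball _ one_ne_zero, mem_closedBall_zero_iff] at hw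
    have : q * w - a ≠ 0 := by
      intro h
      rw [sub_eq_zero] at h
      rw [← h, norm_mul] at ha
      nlinarith [norm_nonneg q]
    fun_prop (disch := assumption)
  simpa using hd.circleAverage

/-- Away from a this is a difference quotient; at a, an interior point of the annulus, the
singularity is removable. -/
theorem differentiableAt_dslope {a : ℂ} (h1 : ‖q‖ < ‖a‖) (h2 : ‖a‖ < 1) {h : ℂ → ℂ}
    (hd : ∀ w, ‖q‖ ≤ ‖w‖ → ‖w‖ ≤ 1 → DifferentiableAt ℂ h w) {w : ℂ} (hw1 : ‖q‖ ≤ ‖w‖)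
    (hw2 : ‖w‖ ≤ 1) : DifferentiableAt ℂ (dslope h a) w := by
  rcases eq_or_ne w a with rfl | hwa
  · have ho : {w : ℂ | ‖q‖ < ‖w‖ ∧ ‖w‖ < 1} ∈ 𝓝 w :=
      ((isOpen_lt continuous_const continuous_norm).inter
        (isOpen_lt continuous_norm continuous_const)).mem_nhds ⟨h1, h2⟩
    exact ((differentiableOn_dslope ho).2 fun v hv =>
      (hd v hv.1.le hv.2.le).differentiableWithinAt).differentiableAt ho
  · exact (differentiableAt_dslope_of_ne hwa).2 (hd w hw1 hw2)

/-- The residue theorem for an annulus and a function with simple poles. -/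
theorem circleAverage_sub_circleAverage_comp_mul (hq0 : q ≠ 0) (hq : ‖q‖ < 1) {n : ℕ} [NeZero n]
    {a : Fin n → ℂ} (hinj : Function.Injective a) (h1 : ∀ i, ‖q‖ < ‖a i‖) (h2 : ∀ i, ‖a i‖ < 1)
    {h F : ℂ → ℂ} (hd : ∀ w, ‖q‖ ≤ ‖w‖ → ‖w‖ ≤ 1 → DifferentiableAt ℂ h w)
    (hF : ∀ w, ‖q‖ ≤ ‖w‖ → ‖w‖ ≤ 1 → F w = h w / ∏ i, (1 - a i / w)) :
    Real.circleAverage F 0 1 - Real.circleAverage (fun w => F (q * w)) 0 1 =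
      ∑ i, h (a i) / ∏ j ∈ Finset.univ.erase i, (1 - a j / a i) := by
  have ha : ∀ i, a i ≠ 0 := fun i => norm_pos_iff.1 ((norm_nonneg q).trans_lt (h1 i))
  set c : Fin n → ℂ := fun i => 1 / ∏ j ∈ Finset.univ.erase i, (1 - a j / a i) with hc
  have hpos := norm_pos_iff.2 hq0
  have dS : ∀ i w, ‖q‖ ≤ ‖w‖ → ‖w‖ ≤ 1 → DifferentiableAt ℂ (fun w => w * dslope h (a i) w) w :=
    fun i w hw1 hw2 => differentiableAt_id.mul
      (differentiableAt_dslope (h1 i) (h2 i) hd hw1 hw2)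
  -- Each polar part is split off by writing h(w) = h(a_i) + (w - a_i) `dslope h (a i) w`. The
  -- regular parts have equal averages over both circles and drop out of the difference.
  have exp : ∀ w, ‖q‖ ≤ ‖w‖ → ‖w‖ ≤ 1 → (∀ i, w ≠ a i) → F w =
      ∑ i, c i * (w * dslope h (a i) w + h (a i) * (w / (w - a i))) := by
    intro w hw1 hw2 hwa
    have hw : w ≠ 0 := norm_pos_iff.1 (hpos.trans_le hw1)
    rw [hF w hw1 hw2, ← mul_one_div, one_div_prod_one_sub_div hinj ha hw hwa, Finset.mul_sum]
    refine Finset.sum_congr rfl fun i _ => ?_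
    have h3 := sub_smul_dslope h (a i) w
    have h4 := sub_ne_zero.2 (hwa i)
    rw [smul_eq_mul] at h3
    have h5 : dslope h (a i) w = (h w - h (a i)) / (w - a i) := by
      rw [eq_div_iff h4, ← h3, mul_comm]
    rw [h5, hc]
    ring
  have n1 : ∀ i w, ‖w‖ = 1 → w ≠ a i := fun i w hw h => (h2 i).ne (h ▸ hw)
  have n2 : ∀ i w, ‖w‖ = 1 → q * w ≠ a i := fun i w hw h => (h1 i).ne (by
    rw [← h, norm_mul, hw, mul_one])
  have nq : ∀ w : ℂ, ‖w‖ = 1 → ‖q * w‖ = ‖q‖ := fun w hw => by rw [norm_mul, hw, mul_one]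
  have e1 : Real.circleAverage F 0 1 = ∑ i, c i *
      (Real.circleAverage (fun w => w * dslope h (a i) w) 0 1 + h (a i)) := by
    rw [Real.circleAverage_congr_sphere (f₂ := fun w =>
      ∑ i, (c i • ((fun w => w * dslope h (a i) w) + h (a i) • (fun w => (w / (w - a i))))) w)]
    · have d1 : ∀ i, CircleIntegrable (fun w => w * dslope h (a i) w) 0 1 := fun i =>
        circleIntegrable_of_differentiableAt fun w hw => dS i w (hw ▸ hq.le) hw.le
      have d2 : ∀ i, CircleIntegrable (fun w => w / (w - a i)) 0 1 := fun i =>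
        circleIntegrable_of_differentiableAt fun w hw => by
          have := sub_ne_zero.2 (n1 i w hw)
          fun_prop (disch := assumption)
      rw [Real.circleAverage_fun_sum fun i _ => ((d1 i).add (d2 i).const_smul).const_smul]
      refine Finset.sum_congr rfl fun i _ => ?_
      rw [Real.circleAverage_smul, Real.circleAverage_add (d1 i) (d2 i).const_smul,
        Real.circleAverage_smul, circleAverage_div_sub (h2 i)]
      simp
    · intro w hw
      have hw : ‖w‖ = 1 := by simpa using hw
      simpa using exp w (hw ▸ hq.le) hw.le fun i => n1 i w hw
  have e2 : Real.circleAverage (fun w => F (q * w)) 0 1 = ∑ i, c i *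
      (Real.circleAverage (fun w => w * dslope h (a i) w) 0 1) := by
    rw [Real.circleAverage_congr_sphere (f₂ := fun w =>
      ∑ i, (c i • ((fun w => (fun w => w * dslope h (a i) w) (q * w)) +
        h (a i) • (fun w => (q * w / (q * w - a i))))) w)]
    · have d1 : ∀ i, CircleIntegrable (fun w => (fun w => w * dslope h (a i) w) (q * w)) 0 1 :=
        fun i => circleIntegrable_of_differentiableAt fun w hw =>
          (dS i (q * w) (nq w hw).ge ((nq w hw).trans_le hq.le)).comp w
            (by fun_prop : DifferentiableAt ℂ (fun w => q * w) w)
      have d2 : ∀ i, CircleIntegrable (fun w => q * w / (q * w - a i)) 0 1 := fun i =>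
        circleIntegrable_of_differentiableAt fun w hw => by
          have := sub_ne_zero.2 (n2 i w hw)
          fun_prop (disch := assumption)
      rw [Real.circleAverage_fun_sum fun i _ => ((d1 i).add (d2 i).const_smul).const_smul]
      refine Finset.sum_congr rfl fun i _ => ?_
      rw [Real.circleAverage_smul, Real.circleAverage_add (d1 i) (d2 i).const_smul,
        Real.circleAverage_smul, circleAverage_mul_div_sub (h1 i),
        circleAverage_comp_mul_left_eq hq0 hq (dS i)]
      simp
    · intro w hw
      have hw : ‖w‖ = 1 := by simpa using hw
      simpa using exp (q * w) (nq w hw).ge ((nq w hw).trans_le hq.le) fun i => n2 i w hw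
  rw [e1, e2, ← Finset.sum_sub_distrib]
  refine Finset.sum_congr rfl fun i _ => ?_
  simp only [hc]
  ring

end Residues

/-- The `k`-th term of the `i`-th of the very-well-poised series that arise as sums of residues. -/
def sixCoef {n : ℕ} (q l m : ℂ) (a : Fin n → ℂ) (i : Fin n) (k : ℕ) : ℂ :=
  q ^ k * ((1 - a i ^ 2 * q ^ (2 * k)) / (1 - a i ^ 2)) * qPoch (a i ^ 2) q k *
      qPochInf (a i ^ 2)⁻¹ q *
    (qPochInf (a i * l * q ^ k) q * qPochInf (a i * m * q ^ k) q * qPochInf (l / a i) q *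
      qPochInf (m / a i) q * qPoch (q * a i / l) q k * qPoch (q * a i / m) q k) /
    (qPoch q q k * ∏ j ∈ Finset.univ.erase i,
      (qPochInf (a i * a j * q ^ k) q * qPochInf (a j / a i) q * qPoch (q * a i / a j) q k))

/-- The factor of `sixFun q l m a (q ^ N * w)` that is analytic for `‖q‖ ≤ ‖w‖ ≤ 1`. -/
def annulusFun {n : ℕ} (q l m : ℂ) (a : Fin n → ℂ) (N : ℕ) (w : ℂ) : ℂ :=
  q ^ N * (1 - w ^ 2 * q ^ (2 * N)) * qPochInf (q * w ^ 2) q * qPochInf (w ^ 2)⁻¹ q *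
    (qPochInf (l * q ^ N * w) q * qPoch (q * w / l) q N * qPochInf (l / w) q *
      (qPochInf (m * q ^ N * w) q * qPoch (q * w / m) q N * qPochInf (m / w) q)) /
    ∏ i, (qPochInf (a i * q ^ N * w) q * qPoch (q * w / a i) q N * qPochInf (q * a i / w) q)

/-! ### The integrand on shrinking circles -/

section ResidueSum

variable {q : ℂ}

local notation "φ" x:max => qPochInf x q

/-- Reversing the first N factors gives E_N = (-1)^N q^(-N(N+1)/2). The duplication rule for E
compares φ(z⁻²), shifted 2N times, with the factors φ(x/z), shifted N times. -/
theorem exists_qPochInf_mul_inv_pow (hq0 : q ≠ 0) (hq : ‖q‖ < 1) :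
    ∃ E : ℕ → ℂ, (∀ N, E N ≠ 0) ∧ (∀ N, E (2 * N) = q ^ N * E N ^ 4) ∧
      ∀ y : ℂ, y ≠ 0 → ∀ N, φ (y * (q ^ N)⁻¹) = φ y * qPoch (q / y) q N * E N * y ^ N := by
  have hs : ∀ N, ∏ j ∈ Finset.range (N + 1), (-(q ^ (j + 1))⁻¹) =
      (∏ j ∈ Finset.range N, (-(q ^ (j + 1))⁻¹)) * (-(q ^ (N + 1))⁻¹) := fun N =>
    Finset.prod_range_succ _ _
  refine ⟨fun N => ∏ j ∈ Finset.range N, (-(q ^ (j + 1))⁻¹), fun N => ?_, fun N => ?_,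
    fun y hy N => ?_⟩
  · exact Finset.prod_ne_zero_iff.2 fun j _ => neg_ne_zero.2 (inv_ne_zero (pow_ne_zero _ hq0))
  · induction N with
    | zero => simp
    | succ N ih =>
      simp only at ih ⊢
      rw [mul_add, mul_one, hs, hs, ih, hs, pow_succ]
      have := pow_ne_zero N hq0
      field_simp
      ring
  · induction N with
    | zero => simp
    | succ N ih =>
      have h1 := qPochInf_step hq (y * (q ^ (N + 1))⁻¹)
      rw [show y * (q ^ (N + 1))⁻¹ * q = y * (q ^ N)⁻¹ by
        field_simp; ring, ih] at h1
      have h2 : 1 - y * (q ^ (N + 1))⁻¹ = -(q ^ (N + 1))⁻¹ * y * (1 - q / y * q ^ N) := by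
        field_simp
        ring
      simp only at h1 ⊢
      rw [h1, hs, qPoch_succ, h2]
      ring

/-- The numerator yields E_(2N) E_N² = q^N E_N⁶ and the denominator E_N⁶, so only q^N is left. The
N-th powers of the parameters cancel by the balancing condition, and those of w by counting factors.
This q^N is the source of both the decay and the argument q of the residue series. -/
theorem sixFun_pow_mul (hq0 : q ≠ 0) (hq : ‖q‖ < 1) {l m w : ℂ} {a : Fin 6 → ℂ} (hl : l ≠ 0)
    (hm : m ≠ 0) (hw : w ≠ 0) (ha : ∀ i, a i ≠ 0) (h : l * m = ∏ i, a i) (N : ℕ) :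
    sixFun q l m a (q ^ N * w) = annulusFun q l m a N w / ∏ i, (1 - a i / w) := by
  obtain ⟨E, hE0, hE2, hE⟩ := exists_qPochInf_mul_inv_pow hq0 hq
  have hPM : ∀ x : ℂ, x ≠ 0 → qPochPM x (q ^ N * w) q =
      φ (x * q ^ N * w) * qPoch (q * w / x) q N * φ (x / w) * (E N * (x / w) ^ N) := by
    intro x hx
    rw [qPochPM, show x / (q ^ N * w) = x / w * (q ^ N)⁻¹ by
      rw [mul_comm, div_mul_eq_div_div, div_eq_mul_inv (x / w)], hE _ (div_ne_zero hx hw),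
      show q / (x / w) = q * w / x by field_simp, mul_assoc x]
    ring
  have h1 : φ ((q ^ N * w) ^ 2) * φ ((q ^ N * w) ^ 2)⁻¹ =
      (1 - w ^ 2 * q ^ (2 * N)) * φ (q * w ^ 2) * φ (w ^ 2)⁻¹ * (q ^ N * E N ^ 4) *
        ((w ^ 2)⁻¹ ^ (2 * N)) := by
    rw [show ((q ^ N * w) ^ 2)⁻¹ = (w ^ 2)⁻¹ * (q ^ (2 * N))⁻¹ by
      rw [← mul_inv]; ring, hE _ (inv_ne_zero (pow_ne_zero 2 hw)), hE2,
      show q / (w ^ 2)⁻¹ = q * w ^ 2 by field_simp,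
      show (q ^ N * w) ^ 2 = w ^ 2 * q ^ (2 * N) by ring, qPochInf_step hq (w ^ 2 * q ^ (2 * N)),
      qPochInf_eq_qPoch_mul hq (q * w ^ 2) (2 * N),
      show w ^ 2 * q ^ (2 * N) * q = q * w ^ 2 * q ^ (2 * N) by ring]
    ring
  have h2 : ∏ i, qPochPM (a i) (q ^ N * w) q =
      (∏ i, (1 - a i / w)) * (∏ i, (φ (a i * q ^ N * w) * qPoch (q * w / a i) q N *
        φ (q * a i / w))) * (E N ^ 6 * ((∏ i, a i) / w ^ 6) ^ N) := by
    have : (∏ i, a i) / w ^ 6 = ∏ i, (a i / w) := by simp [Finset.prod_div_distrib]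
    rw [this, ← Finset.prod_pow, show E N ^ 6 = ∏ _i : Fin 6, E N by simp,
      ← Finset.prod_mul_distrib, ← Finset.prod_mul_distrib, ← Finset.prod_mul_distrib]
    refine Finset.prod_congr rfl fun i _ => ?_
    rw [hPM _ (ha i), qPochInf_step hq (a i / w), show a i / w * q = q * a i / w by ring]
    ring
  have hP : (∏ i, a i) ≠ 0 := Finset.prod_ne_zero_iff.2 fun i _ => ha i
  rw [sixFun, h1, h2, hPM l hl, hPM m hm, annulusFun, ← h]
  have hEN := hE0 N
  have hlN := pow_ne_zero N hl
  have hmN := pow_ne_zero N hm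
  have hwN := pow_ne_zero N hw
  have e1 : ((l * m / w ^ 6) ^ N) = l ^ N * m ^ N / (w ^ N) ^ 6 := by
    rw [div_pow, mul_pow, ← pow_mul, ← pow_mul, mul_comm 6]
  have e2 : (w ^ 2)⁻¹ ^ (2 * N) = ((w ^ N) ^ 4)⁻¹ := by
    rw [inv_pow, ← pow_mul, ← pow_mul]; ring_nf
  rw [e1, e2, div_pow, div_pow]
  generalize (∏ i, (1 - a i / w)) = P1
  generalize ∏ i, (φ (a i * q ^ N * w) * qPoch (q * w / a i) q N * φ (q * a i / w)) = P2
  generalize φ (l * q ^ N * w) * qPoch (q * w / l) q N * φ (l / w) = P3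
  generalize φ (m * q ^ N * w) * qPoch (q * w / m) q N * φ (m / w) = P4
  generalize 1 - w ^ 2 * q ^ (2 * N) = P6 at *
  generalize φ (q * w ^ 2) = P7 at *
  generalize φ (w ^ 2)⁻¹ = P8 at *
  generalize l ^ N = l' at *
  generalize m ^ N = m' at *
  generalize w ^ N = w' at *
  generalize E N = E' at *
  generalize q ^ N = q' at *
  field_simp

theorem mul_mul_div_div_cancel {x y : ℂ} (hx : x ≠ 0) (hy : y ≠ 0) (A P Q R : ℂ) :
    y * (A * x / (x * Q * y * P) / R) = A / (Q * (P * R)) := by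
  field_simp

/-- At w = a_i the i-th denominator factor contains φ(qa_i/a_i) = φ(q), which the prefactor cancels.
The denominator factors φ(qa_j/a_i) combine with 1 - a_j/a_i to φ(a_j/a_i). -/
theorem annulusFun_self (hq : ‖q‖ < 1) {n : ℕ} {l m : ℂ} {a : Fin n → ℂ} (i : Fin n)
    (ha : a i ≠ 0) (hsq : φ (a i ^ 2) ≠ 0) (k : ℕ) :
    φ q * (annulusFun q l m a k (a i) / ∏ j ∈ Finset.univ.erase i, (1 - a j / a i)) =
      sixCoef q l m a i k := by
  have e1 : ∏ j, (φ (a j * q ^ k * a i) * qPoch (q * a i / a j) q k * φ (q * a j / a i)) =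
      (φ (a i ^ 2 * q ^ k) * qPoch q q k * φ q) * ∏ j ∈ Finset.univ.erase i,
        (φ (a j * q ^ k * a i) * qPoch (q * a i / a j) q k * φ (q * a j / a i)) := by
    rw [← Finset.mul_prod_erase _ _ (Finset.mem_univ i), mul_div_cancel_right₀ _ ha,
      show a i * q ^ k * a i = a i ^ 2 * q ^ k by ring]
  have e2 : ∏ j ∈ Finset.univ.erase i,
      (φ (a i * a j * q ^ k) * φ (a j / a i) * qPoch (q * a i / a j) q k) =
      (∏ j ∈ Finset.univ.erase i,
        (φ (a j * q ^ k * a i) * qPoch (q * a i / a j) q k * φ (q * a j / a i))) *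
        ∏ j ∈ Finset.univ.erase i, (1 - a j / a i) := by
    rw [← Finset.prod_mul_distrib]
    refine Finset.prod_congr rfl fun j _ => ?_
    rw [qPochInf_step hq (a j / a i), show a j / a i * q = q * a j / a i by ring,
      show a j * q ^ k * a i = a i * a j * q ^ k by ring]
    ring
  have s1 := qPochInf_step hq (a i ^ 2)
  have s2 := qPochInf_eq_qPoch_mul hq (a i ^ 2) k
  rw [mul_comm (a i ^ 2) q] at s1
  have n1 : 1 - a i ^ 2 ≠ 0 := fun h => hsq (by rw [s1, h, zero_mul])
  have n2 : φ (a i ^ 2 * q ^ k) ≠ 0 := fun h => hsq (by rw [s2, h, mul_zero])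
  have s3 : φ (q * a i ^ 2) = qPoch (a i ^ 2) q k * φ (a i ^ 2 * q ^ k) / (1 - a i ^ 2) := by
    rw [eq_div_iff n1, ← s2, s1, mul_comm]
  have hqq : φ q ≠ 0 := by
    by_cases hq0 : q = 0
    · simp [hq0]
    · exact qPochInf_ne_zero_of_norm_lt_one hq0 hq hq
  rw [annulusFun, sixCoef, e1, e2, s3, show l * q ^ k * a i = a i * l * q ^ k by ring,
    show m * q ^ k * a i = a i * m * q ^ k by ring]
  refine Eq.trans ?_ (mul_mul_div_div_cancel n2 hqq _ _ _ _)
  congr 3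
  ring

end ResidueSum

/-- A sequence of functions is bounded near `s₀`, uniformly in the index. -/
def LocBdd (f : ℂ → ℕ → ℂ) (s₀ : ℂ) : Prop := ∃ K : ℝ, ∀ᶠ s in 𝓝 s₀, ∀ k, ‖f s k‖ ≤ K

/-! ### Locally uniform bounds for the terms of the series -/

section LocallyBounded

variable {q s₀ : ℂ}

local notation "φ" x:max => qPochInf x q

namespace LocBdd

theorem mul {f g : ℂ → ℕ → ℂ} (hf : LocBdd f s₀) (hg : LocBdd g s₀) :
    LocBdd (fun s k => f s k * g s k) s₀ := by
  obtain ⟨K, hK⟩ := hf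
  obtain ⟨L, hL⟩ := hg
  refine ⟨K * L, (hK.and hL).mono fun s hs k => ?_⟩
  rw [norm_mul]
  exact mul_le_mul (hs.1 k) (hs.2 k) (norm_nonneg _) ((norm_nonneg _).trans (hs.1 k))

theorem of_continuousAt {g : ℂ → ℂ} (hg : ContinuousAt g s₀) : LocBdd (fun s _ => g s) s₀ := by
  refine ⟨‖g s₀‖ + 1, ?_⟩
  filter_upwards [hg.norm.eventually_lt continuousAt_const (lt_add_one _)] with s hs _ using hs.le

theorem mono {f g : ℂ → ℕ → ℂ} (hf : LocBdd f s₀) (h : ∀ᶠ s in 𝓝 s₀, ∀ k, ‖g s k‖ ≤ ‖f s k‖) :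
    LocBdd g s₀ := by
  obtain ⟨K, hK⟩ := hf
  exact ⟨K, (hK.and h).mono fun s hs k => (hs.2 k).trans (hs.1 k)⟩

theorem prod {ι : Type*} {t : Finset ι} {f : ι → ℂ → ℕ → ℂ} (hf : ∀ i ∈ t, LocBdd (f i) s₀) :
    LocBdd (fun s k => ∏ i ∈ t, f i s k) s₀ := by
  classical
  induction t using Finset.induction_on with
  | empty => exact ⟨1, by simp⟩
  | insert i t hi ih =>
    simp only [Finset.prod_insert hi]
    exact (hf i (by simp)).mul (ih fun j hj => hf j (by simp [hj]))

theorem one_sub_mul_pow (hq : ‖q‖ < 1) {y : ℂ → ℂ} (hy : ContinuousAt y s₀) (e : ℕ → ℕ) :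
    LocBdd (fun s k => 1 - y s * q ^ e k) s₀ := by
  refine ⟨1 + (‖y s₀‖ + 1), ?_⟩
  filter_upwards [hy.norm.eventually_lt continuousAt_const (lt_add_one _)] with s hs k
  refine (norm_sub_le _ _).trans ?_
  rw [norm_one]
  gcongr
  exact (norm_mul_pow_le hq _ _).trans hs.le

theorem qPochInf (hq : ‖q‖ < 1) {y : ℂ → ℂ} (hy : ContinuousAt y s₀) :
    LocBdd (fun s k => φ (y s * q ^ k)) s₀ := by
  refine ⟨Real.exp ((‖y s₀‖ + 1) / (1 - ‖q‖)), ?_⟩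
  filter_upwards [hy.norm.eventually_lt continuousAt_const (lt_add_one _)] with s hs k
  exact norm_qPochInf_le hq ((norm_mul_pow_le hq _ _).trans hs.le)

theorem qPoch (hq : ‖q‖ < 1) {y : ℂ → ℂ} (hy : ContinuousAt y s₀) :
    LocBdd (fun s k => qPoch (y s) q k) s₀ := by
  refine ⟨Real.exp ((‖y s₀‖ + 1) / (1 - ‖q‖)), ?_⟩
  filter_upwards [hy.norm.eventually_lt continuousAt_const (lt_add_one _)] with s hs k
  exact norm_qPoch_le hq hs.le k

/-- The reciprocal equals (y;q)_k/φ(y): a bounded finite product times a function continuous at s₀.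
-/
theorem inv_qPochInf (hq : ‖q‖ < 1) {y : ℂ → ℂ} (hy : ContinuousAt y s₀) (h : φ (y s₀) ≠ 0) :
    LocBdd (fun s k => (φ (y s * q ^ k))⁻¹) s₀ := by
  have hc := continuousAt_qPochInf_comp hq hy
  refine ((qPoch hq hy).mul (of_continuousAt (hc.inv₀ h))).mono ?_
  filter_upwards [hc.eventually_ne h] with s hs k
  simp only [Pi.inv_apply]
  rw [qPochInf_eq_qPoch_mul hq (y s) k] at hs ⊢
  have h1 := left_ne_zero_of_mul hs
  rw [mul_inv, mul_inv_cancel_left₀ h1]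

theorem inv_qPoch (hq : ‖q‖ < 1) {y : ℂ → ℂ} (hy : ContinuousAt y s₀) (h : φ (y s₀) ≠ 0) :
    LocBdd (fun s k => (BasicHyp.qPoch (y s) q k)⁻¹) s₀ := by
  have hc := continuousAt_qPochInf_comp hq hy
  refine ((qPochInf hq hy).mul (of_continuousAt (hc.inv₀ h))).mono ?_
  filter_upwards [hc.eventually_ne h] with s hs k
  simp only [Pi.inv_apply]
  rw [qPochInf_eq_qPoch_mul hq (y s) k] at hs ⊢
  have h1 := right_ne_zero_of_mul hs
  rw [mul_inv, mul_left_comm, mul_inv_cancel₀ h1, mul_one]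

theorem summable_pow_mul (hq : ‖q‖ < 1) {f : ℂ → ℕ → ℂ} (hf : LocBdd f s₀) :
    Summable fun k => q ^ k * f s₀ k := by
  obtain ⟨K, hK⟩ := hf
  refine Summable.of_norm_bounded
    ((summable_geometric_of_lt_one (norm_nonneg _) hq).mul_right K) fun k => ?_
  rw [norm_mul, norm_pow]
  gcongr
  exact hK.self_of_nhds k

theorem differentiableAt_tsum (hq : ‖q‖ < 1) {f : ℂ → ℕ → ℂ} (hf : LocBdd f s₀)
    (hd : ∀ᶠ s in 𝓝 s₀, ∀ k, DifferentiableAt ℂ (fun s => q ^ k * f s k) s) :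
    DifferentiableAt ℂ (fun s => ∑' k, q ^ k * f s k) s₀ := by
  obtain ⟨K, hK⟩ := hf
  obtain ⟨U, hU, hUo, hsU⟩ := eventually_nhds_iff.1 (hK.and hd)
  refine (differentiableOn_tsum_of_summable_norm (u := fun k => ‖q‖ ^ k * K)
    ((summable_geometric_of_lt_one (norm_nonneg _) hq).mul_right K)
    (fun k s hs => ((hU s hs).2 k).differentiableWithinAt) hUo fun k s hs => ?_).differentiableAt
    (hUo.mem_nhds hsU)
  rw [norm_mul, norm_pow]
  gcongr
  exact (hU s hs).1 k

end LocBdd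

/-- Splitting off q^k leaves a factor bounded locally uniformly in the parameters. This yields
convergence of the series and analyticity of its sum at once. -/
theorem locBdd_sixCoef (hq0 : q ≠ 0) (hq : ‖q‖ < 1) {n : ℕ} {l m : ℂ → ℂ} {a : Fin n → ℂ → ℂ}
    (hl : ContinuousAt l s₀) (hm : ContinuousAt m s₀) (ha : ∀ i, ContinuousAt (a i) s₀)
    (hl0 : l s₀ ≠ 0) (hm0 : m s₀ ≠ 0) (ha0 : ∀ i, a i s₀ ≠ 0) (i : Fin n)
    (h1 : 1 - a i s₀ ^ 2 ≠ 0) (h2 : ∀ j, j ≠ i → φ (a i s₀ * a j s₀) ≠ 0)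
    (h3 : ∀ j, j ≠ i → φ (a j s₀ / a i s₀) ≠ 0) (h4 : ∀ j, j ≠ i → φ (q * a i s₀ / a j s₀) ≠ 0) :
    ∃ f : ℂ → ℕ → ℂ, LocBdd f s₀ ∧
      ∀ s k, sixCoef q (l s) (m s) (fun j => a j s) i k = q ^ k * f s k := by
  have c2 : ContinuousAt (fun s => a i s ^ 2) s₀ := (ha i).pow 2
  have cφ : ∀ {y : ℂ → ℂ}, ContinuousAt y s₀ → ContinuousAt (fun s => φ (y s)) s₀ :=
    fun hy => continuousAt_qPochInf_comp hq hy
  have hqq := qPochInf_ne_zero_of_norm_lt_one hq0 hq hq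
  have B := ((((LocBdd.one_sub_mul_pow hq c2 (fun k => 2 * k)).mul
    (.of_continuousAt ((continuousAt_const.sub c2).inv₀ h1))).mul (.qPoch hq c2)).mul
    (.of_continuousAt (cφ (c2.inv₀ (pow_ne_zero 2 (ha0 i)))))).mul
    (((((((LocBdd.qPochInf hq ((ha i).mul hl)).mul (.qPochInf hq ((ha i).mul hm))).mul
      (.of_continuousAt (cφ (hl.div (ha i) (ha0 i))))).mul
      (.of_continuousAt (cφ (hm.div (ha i) (ha0 i))))).mul
      (.qPoch hq (((continuousAt_const (y := q)).mul (ha i)).div hl hl0))).mul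
      (.qPoch hq (((continuousAt_const (y := q)).mul (ha i)).div hm hm0))).mul
      ((LocBdd.inv_qPoch hq (continuousAt_const (y := q)) hqq).mul
        (LocBdd.prod (t := Finset.univ.erase i) fun j hj =>
          ((LocBdd.inv_qPochInf hq ((ha i).mul (ha j)) (h2 j (Finset.ne_of_mem_erase hj))).mul
          (.of_continuousAt ((cφ ((ha j).div (ha i) (ha0 i))).inv₀
            (h3 j (Finset.ne_of_mem_erase hj))))).mul
          (.inv_qPoch hq (((continuousAt_const (y := q)).mul (ha i)).div (ha j) (ha0 j))
            (h4 j (Finset.ne_of_mem_erase hj))))))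
  refine ⟨_, B, fun s k => ?_⟩
  simp only [sixCoef, div_eq_mul_inv, mul_inv, Finset.prod_inv_distrib, Finset.prod_mul_distrib,
    Pi.mul_apply, Pi.inv_apply, Pi.div_apply, Pi.sub_apply]
  ring

theorem locBdd_bailTerm (hq0 : q ≠ 0) (hq : ‖q‖ < 1) {n : ℕ} {l m : ℂ → ℂ} {a : Fin n → ℂ → ℂ}
    (hl : ContinuousAt l s₀) (hm : ContinuousAt m s₀) (ha : ∀ i, ContinuousAt (a i) s₀)
    (hl0 : l s₀ ≠ 0) (hm0 : m s₀ ≠ 0) (ha0 : ∀ i, a i s₀ ≠ 0)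
    (h1 : φ (l s₀ ^ 2 / q) ≠ 0) (h2 : φ (m s₀ / l s₀) ≠ 0) (h3 : φ (q * l s₀ / m s₀) ≠ 0) :
    ∃ f : ℂ → ℕ → ℂ, LocBdd f s₀ ∧
      ∀ s k, bailTerm q (l s) (m s) (fun j => a j s) k = q ^ k * f s k := by
  have c2 : ContinuousAt (fun s => l s ^ 2 / q) s₀ := (hl.pow 2).div_const q
  have cφ : ∀ {y : ℂ → ℂ}, ContinuousAt y s₀ → ContinuousAt (fun s => φ (y s)) s₀ :=
    fun hy => continuousAt_qPochInf_comp hq hy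
  have hqq := qPochInf_ne_zero_of_norm_lt_one hq0 hq hq
  have B := (((LocBdd.one_sub_mul_pow hq c2 (fun k => 2 * k)).mul
    (LocBdd.prod (t := Finset.univ) fun i _ => ((LocBdd.qPochInf hq (hl.mul (ha i))).mul
      (.qPoch hq (hl.div (ha i) (ha0 i)))).mul
      (.of_continuousAt (cφ (hm.div (ha i) (ha0 i)))))).mul
    (.qPoch hq ((hl.mul hm).div_const q))).mul
    ((((LocBdd.inv_qPoch hq (continuousAt_const (y := q)) hqq).mul (.inv_qPochInf hq c2 h1)).mul
      (.of_continuousAt ((cφ (hm.div hl hl0)).inv₀ h2))).mul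
      (.inv_qPoch hq (((continuousAt_const (y := q)).mul hl).div hm hm0) h3))
  refine ⟨_, B, fun s k => ?_⟩
  simp only [bailTerm, div_eq_mul_inv, mul_inv, Finset.prod_mul_distrib, Pi.mul_apply, Pi.inv_apply,
    Pi.div_apply]
  ring

end LocallyBounded

/-! ### The six-parameter integral as a sum of residues -/

section ResidueExpansion

variable {q : ℂ}

local notation "φ" x:max => qPochInf x q

theorem qPoch_ne_zero_of_norm_lt_one (hq0 : q ≠ 0) (hq : ‖q‖ < 1) {x : ℂ} (hx : ‖x‖ < 1) (n : ℕ) :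
    qPoch x q n ≠ 0 := fun h =>
  qPochInf_ne_zero_of_norm_lt_one hq0 hq hx (by rw [qPochInf_eq_qPoch_mul hq x n, h, zero_mul])

theorem differentiableAt_annulusFun (hq0 : q ≠ 0) (hq : ‖q‖ < 1) {n : ℕ} {l m w : ℂ}
    {a : Fin n → ℂ} (h1 : ∀ i, ‖q‖ < ‖a i‖) (h2 : ∀ i, ‖a i‖ < 1) (N : ℕ) (hw1 : ‖q‖ ≤ ‖w‖)
    (hw2 : ‖w‖ ≤ 1) : DifferentiableAt ℂ (annulusFun q l m a N) w := by
  have hpos := norm_pos_iff.2 hq0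
  have hw : w ≠ 0 := norm_pos_iff.1 (hpos.trans_le hw1)
  have hw' : w ^ 2 ≠ 0 := pow_ne_zero 2 hw
  have dφ : ∀ {y : ℂ → ℂ}, DifferentiableAt ℂ y w → DifferentiableAt ℂ (fun w => φ (y w)) w :=
    fun hy => differentiableAt_qPochInf_comp hq hy
  have dp : ∀ {y : ℂ → ℂ}, DifferentiableAt ℂ y w →
      DifferentiableAt ℂ (fun w => qPoch (y w) q N) w :=
    fun hy => (differentiable_qPoch N).differentiableAt.comp w hy
  have d1 : DifferentiableAt ℂ (fun w : ℂ => q ^ N * (1 - w ^ 2 * q ^ (2 * N))) w := by fun_prop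
  have d2 : DifferentiableAt ℂ (fun w : ℂ => φ (q * w ^ 2)) w := dφ (by fun_prop)
  have d3 : DifferentiableAt ℂ (fun w : ℂ => φ (w ^ 2)⁻¹) w :=
    dφ (by fun_prop (disch := assumption))
  have d4 : ∀ x, DifferentiableAt ℂ (fun w : ℂ => φ (x * q ^ N * w)) w := fun x => dφ (by fun_prop)
  have d5 : ∀ x, DifferentiableAt ℂ (fun w : ℂ => qPoch (q * w / x) q N) w :=
    fun x => dp (by fun_prop)
  have d6 : ∀ x, DifferentiableAt ℂ (fun w : ℂ => φ (x / w)) w :=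
    fun x => dφ (by fun_prop (disch := assumption))
  have d7 : DifferentiableAt ℂ (fun w : ℂ => ∏ i, (φ (a i * q ^ N * w) * qPoch (q * w / a i) q N *
      φ (q * a i / w))) w :=
    DifferentiableAt.fun_finsetProd fun i _ => ((d4 _).mul (d5 _)).mul (d6 _)
  refine ((((d1.mul d2).mul d3).mul ((((d4 l).mul (d5 l)).mul (d6 l)).mul
    (((d4 m).mul (d5 m)).mul (d6 m))))).div d7 (Finset.prod_ne_zero_iff.2 fun i _ => ?_)
  have ha := hpos.trans (h1 i)
  refine mul_ne_zero (mul_ne_zero ?_ ?_) ?_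
  · refine qPochInf_ne_zero_of_norm_lt_one hq0 hq ?_
    rw [norm_mul]
    exact mul_lt_one_of_nonneg_of_lt_one_left (norm_nonneg _)
      ((norm_mul_pow_le hq _ _).trans_lt (h2 i)) hw2
  · refine qPoch_ne_zero_of_norm_lt_one hq0 hq ?_ N
    rw [norm_div, norm_mul, div_lt_one ha]
    exact (mul_le_of_le_one_right (norm_nonneg _) hw2).trans_lt (h1 i)
  · refine qPochInf_ne_zero_of_norm_lt_one hq0 hq ?_
    rw [norm_div, norm_mul, div_lt_one (hpos.trans_le hw1)]
    exact (mul_lt_of_lt_one_right hpos (h2 i)).trans_le hw1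

theorem norm_circleAverage_le {f : ℂ → ℂ} {K : ℝ} (h : ∀ z, ‖z‖ = 1 → ‖f z‖ ≤ K) :
    ‖Real.circleAverage f 0 1‖ ≤ K := by
  have h1 : ‖∫ θ in (0 : ℝ)..2 * Real.pi, f (circleMap 0 1 θ)‖ ≤ K * |2 * Real.pi - 0| :=
    intervalIntegral.norm_integral_le_of_norm_le_const fun θ _ => h _ (by simp)
  have hπ := Real.pi_pos
  rw [Real.circleAverage_def, norm_smul, norm_inv, Real.norm_of_nonneg (by positivity)]
  rw [sub_zero, abs_of_pos (by positivity)] at h1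
  rw [inv_mul_le_iff₀ (by positivity), mul_comm _ K]
  exact h1

/-- In the factored form of `sixFun_pow_mul` everything except q^N is bounded uniformly in N, and |1
- a_i/w| ≥ 1 - ρ on the unit circle. -/
theorem exists_norm_sixFun_pow_mul_le (hq0 : q ≠ 0) (hq : ‖q‖ < 1) {l m : ℂ} {a : Fin 6 → ℂ}
    (hl : l ≠ 0) (hm : m ≠ 0) (h : l * m = ∏ i, a i) {ρ : ℝ} (h1 : ‖q‖ < ρ) (h2 : ρ < 1)
    (ha : ∀ i, ‖a i‖ = ρ) :
    ∃ K : ℝ, ∀ (N : ℕ) (w : ℂ), ‖w‖ = 1 → ‖sixFun q l m a (q ^ N * w)‖ ≤ ‖q‖ ^ N * K := by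
  have hρ := (norm_nonneg q).trans_lt h1
  obtain ⟨c, hc, hcle⟩ := exists_le_norm_qPochInf hq0 hq h2
  have h3 : ‖q‖ / ρ < 1 := (div_lt_one hρ).2 h1
  obtain ⟨c', hc', hcle'⟩ := exists_le_norm_qPochInf hq0 hq h3
  set B : ℝ → ℝ := fun R => Real.exp (R / (1 - ‖q‖)) with hB
  -- A lower bound for one denominator triple: `c` serves the two infinite products. `c' / B 1`
  -- serves the finite one, written as φ(x)/φ(xq^N) with |x| = |q|/ρ.
  set d : ℝ := c * (c' / B 1) * c with hd
  have hd0 : 0 < d := by positivity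
  refine ⟨2 * B 1 * B 1 * (B ‖l‖ * B (‖q‖ / ‖l‖) * B ‖l‖ * (B ‖m‖ * B (‖q‖ / ‖m‖) * B ‖m‖)) /
    (d ^ 6 * (1 - ρ) ^ 6), fun N w hw => ?_⟩
  have hw0 := ne_zero_of_norm_eq_one hw
  have ha0 : ∀ i, a i ≠ 0 := fun i => norm_pos_iff.1 (by rw [ha]; exact hρ)
  have hS : ∀ x : ℂ, ‖φ (x * q ^ N * w) * qPoch (q * w / x) q N * φ (x / w)‖ ≤
      B ‖x‖ * B (‖q‖ / ‖x‖) * B ‖x‖ := by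
    intro x
    rw [norm_mul, norm_mul]
    gcongr
    · refine norm_qPochInf_le hq ?_
      rw [norm_mul, hw, mul_one]
      exact norm_mul_pow_le hq _ _
    · refine norm_qPoch_le hq ?_ N
      rw [norm_div, norm_mul, hw, mul_one]
    · refine norm_qPochInf_le hq ?_
      rw [norm_div, hw, div_one]
  have hD : d ^ 6 ≤ ‖∏ i, (φ (a i * q ^ N * w) * qPoch (q * w / a i) q N * φ (q * a i / w))‖ := by
    rw [norm_prod]
    calc d ^ 6 = ∏ _i : Fin 6, d := by simp
      _ ≤ _ := by
        refine Finset.prod_le_prod (fun _ _ => hd0.le) fun i _ => ?_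
        rw [norm_mul, norm_mul, hd]
        have n1 : ‖q * w / a i‖ = ‖q‖ / ρ := by rw [norm_div, norm_mul, hw, mul_one, ha]
        gcongr
        · refine hcle _ ?_
          rw [norm_mul, hw, mul_one]
          exact (norm_mul_pow_le hq _ _).trans (ha i).le
        · rw [div_le_iff₀ (Real.exp_pos _)]
          refine (hcle' _ n1.le).trans ?_
          rw [qPochInf_eq_qPoch_mul hq _ N, norm_mul]
          gcongr
          exact norm_qPochInf_le hq ((norm_mul_pow_le hq _ _).trans (n1.trans_lt h3).le)
        · refine hcle _ ?_
          rw [norm_div, hw, div_one, norm_mul, ha]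
          exact mul_le_of_le_one_left hρ.le hq.le
  have hE : (1 - ρ) ^ 6 ≤ ‖∏ i, (1 - a i / w)‖ := by
    rw [norm_prod]
    calc (1 - ρ) ^ 6 = ∏ _i : Fin 6, (1 - ρ) := by simp
      _ ≤ _ := by
        refine Finset.prod_le_prod (fun _ _ => by linarith) fun i _ => ?_
        have := norm_sub_norm_le 1 (a i / w)
        rwa [norm_one, norm_div, hw, div_one, ha] at this
  have hρ' : 0 < 1 - ρ := by linarith
  rw [sixFun_pow_mul hq0 hq hl hm hw0 ha0 h, annulusFun, div_div, norm_div, norm_mul, norm_mul,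
    norm_mul, norm_mul, norm_mul (∏ i, _), norm_pow]
  have b1 : ‖1 - w ^ 2 * q ^ (2 * N)‖ ≤ 2 := by
    refine (norm_sub_le _ _).trans ?_
    have := norm_mul_pow_le hq (w ^ 2) (2 * N)
    rw [norm_pow, hw, one_pow] at this
    rw [norm_one]
    linarith
  have b2 : ‖φ (q * w ^ 2)‖ ≤ B 1 :=
    norm_qPochInf_le hq (by rw [norm_mul, norm_pow, hw, one_pow, mul_one]; exact hq.le)
  have b3 : ‖φ (w ^ 2)⁻¹‖ ≤ B 1 :=
    norm_qPochInf_le hq (by rw [norm_inv, norm_pow, hw, one_pow, inv_one])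
  have b4 : ‖φ (l * q ^ N * w) * qPoch (q * w / l) q N * φ (l / w) *
      (φ (m * q ^ N * w) * qPoch (q * w / m) q N * φ (m / w))‖ ≤
      B ‖l‖ * B (‖q‖ / ‖l‖) * B ‖l‖ * (B ‖m‖ * B (‖q‖ / ‖m‖) * B ‖m‖) := by
    rw [norm_mul]
    exact mul_le_mul (hS l) (hS m) (norm_nonneg _) (by positivity)
  calc _ ≤ ‖q‖ ^ N * 2 * B 1 * B 1 * (B ‖l‖ * B (‖q‖ / ‖l‖) * B ‖l‖ *
        (B ‖m‖ * B (‖q‖ / ‖m‖) * B ‖m‖)) / (d ^ 6 * (1 - ρ) ^ 6) := by gcongr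
    _ = _ := by ring

/-- The six-parameter integral as a sum of residues. -/
theorem qPochInf_mul_sixInt (hq0 : q ≠ 0) (hq : ‖q‖ < 1) {l m : ℂ} {a : Fin 6 → ℂ}
    (hl : l ≠ 0) (hm : m ≠ 0) (h : l * m = ∏ i, a i) {ρ : ℝ} (h1 : ‖q‖ < ρ) (h2 : ρ < 1)
    (ha : ∀ i, ‖a i‖ = ρ) (hinj : Function.Injective a) :
    φ q * sixInt q l m a = ∑ i, ∑' k, sixCoef q l m a i k := by
  have hρ := (norm_nonneg q).trans_lt h1
  have ha0 : ∀ i, a i ≠ 0 := fun i => norm_pos_iff.1 (by rw [ha]; exact hρ)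
  have nφ : ∀ {x : ℂ}, ‖x‖ < 1 → φ x ≠ 0 := fun hx => qPochInf_ne_zero_of_norm_lt_one hq0 hq hx
  have n2 : ∀ i j, ‖a i * a j‖ < 1 := fun i j => by
    rw [norm_mul, ha, ha]
    exact mul_lt_one_of_nonneg_of_lt_one_left hρ.le h2 h2.le
  have hsum : ∀ i, Summable (sixCoef q l m a i) := by
    intro i
    have h3 : ∀ j, j ≠ i → φ (a j / a i) ≠ 0 := fun j hj => by
      refine (QGen.of_norm_eq_one hq ?_ ?_).qPochInf_ne_zero hq0 hq
      · rw [norm_div, ha, ha, div_self hρ.ne']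
      · rw [Ne, div_eq_one_iff_eq (ha0 i)]
        exact fun h => hj (hinj h)
    have h4 : ∀ j, j ≠ i → φ (q * a i / a j) ≠ 0 := fun j _ => nφ (by
      rw [norm_div, norm_mul, ha, ha, mul_div_cancel_right₀ _ hρ.ne']
      exact hq)
    have h5 : 1 - a i ^ 2 ≠ 0 := fun h0 => by
      have := n2 i i
      rw [← sq, ← sub_eq_zero.1 h0, norm_one] at this
      exact lt_irrefl _ this
    -- The parameters are taken as constant functions, so the base point 0 is arbitrary; only
    -- summability is extracted.
    obtain ⟨f, hf, he⟩ := locBdd_sixCoef (s₀ := 0) (l := fun _ => l) (m := fun _ => m)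
      (a := fun i _ => a i) hq0 hq continuousAt_const continuousAt_const
      (fun i => continuousAt_const) hl hm ha0 i h5 (fun j _ => nφ (n2 i j)) h3 h4
    exact (hf.summable_pow_mul hq).congr fun k => (he 0 k).symm
  -- `A N` is the average over the circle of radius |q|^N. Passing to the next circle picks up the
  -- residues at a_i q^N, the N-th terms of the six series, and `A N` tends to 0.
  set A : ℕ → ℂ := fun N => Real.circleAverage (fun w => sixFun q l m a (q ^ N * w)) 0 1 with hA
  have hstep : ∀ N, φ q * (A N - A (N + 1)) = ∑ i, sixCoef q l m a i N := by
    intro N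
    have h3 := circleAverage_sub_circleAverage_comp_mul hq0 hq hinj (fun i => by rwa [ha])
      (fun i => by rwa [ha]) (h := annulusFun q l m a N)
      (F := fun w => sixFun q l m a (q ^ N * w))
      (fun w hw1 hw2 => differentiableAt_annulusFun hq0 hq (fun i => by rwa [ha])
        (fun i => by rwa [ha]) N hw1 hw2)
      (fun w hw1 hw2 => sixFun_pow_mul hq0 hq hl hm
        (norm_pos_iff.1 ((norm_pos_iff.2 hq0).trans_le hw1)) ha0 h N)
    simp only [hA, pow_succ, mul_assoc] at h3 ⊢
    rw [h3, Finset.mul_sum]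
    refine Finset.sum_congr rfl fun i _ => annulusFun_self hq i (ha0 i) (nφ ?_) N
    rw [sq]; exact n2 i i
  have hA0 : A 0 = sixInt q l m a := by simp [hA, sixInt]
  have hlim : Tendsto A atTop (𝓝 0) := by
    obtain ⟨K, hK⟩ := exists_norm_sixFun_pow_mul_le hq0 hq hl hm h h1 h2 ha
    have h4 : Tendsto (fun N : ℕ => ‖q‖ ^ N * K) atTop (𝓝 0) := by
      simpa using (tendsto_pow_atTop_nhds_zero_of_lt_one (norm_nonneg q) hq).mul_const K
    exact squeeze_zero_norm (fun N => norm_circleAverage_le (hK N)) h4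
  have hs : HasSum (fun N => ∑ i, sixCoef q l m a i N) (∑ i, ∑' k, sixCoef q l m a i k) :=
    hasSum_sum fun i _ => (hsum i).hasSum
  refine (tendsto_nhds_unique hs.tendsto_sum_nat ?_).symm
  have h5 : ∀ M, ∑ N ∈ Finset.range M, ∑ i, sixCoef q l m a i N = φ q * (A 0 - A M) := by
    intro M
    rw [← Finset.sum_range_sub', Finset.mul_sum]
    exact Finset.sum_congr rfl fun N _ => (hstep N).symm
  simp only [h5, hA0]
  simpa using (hlim.const_sub (sixInt q l m a)).const_mul (φ q)

end ResidueExpansion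

/-! ### The identity for parameters on circles -/

section CircleRegion

variable {q : ℂ}

local notation "φ" x:max => qPochInf x q

theorem bailGen_of_norm (hq : ‖q‖ < 1) {ρ : ℝ} (hρ0 : 0 < ρ) (hρ1 : ρ < 1) (hqρ : ‖q‖ < ρ ^ 6)
    {n : ℕ} {l m : ℂ} {a : Fin n → ℂ} (hl : ‖l‖ = ρ ^ 3) (hm : ‖m‖ = ρ ^ 3) (ha : ∀ i, ‖a i‖ = ρ)
    (hlm : l ≠ m) : BailGen q l m a := by
  have hm0 : m ≠ 0 := norm_pos_iff.1 (by rw [hm]; positivity)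
  have key : ∀ (x : ℂ) (k : ℕ), 1 ≤ k → k ≤ 6 → ‖x‖ = ρ ^ k → QGen q x :=
    fun x k h1 h6 hx => QGen.of_norm_eq_pow hq hρ0 hρ1 hqρ h1 h6 hx
  refine ⟨fun i => key _ 2 (by norm_num) (by norm_num) ?_,
    fun i => key _ 2 (by norm_num) (by norm_num) ?_,
    fun i => key _ 4 (by norm_num) (by norm_num) ?_,
    fun i => key _ 4 (by norm_num) (by norm_num) ?_, QGen.of_norm_eq_one hq ?_ ?_,
    key _ 6 (by norm_num) (by norm_num) ?_, key _ 6 (by norm_num) (by norm_num) ?_,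
    key _ 6 (by norm_num) (by norm_num) ?_⟩
  · rw [norm_div, hl, ha]; field_simp
  · rw [norm_div, hm, ha]; field_simp
  · rw [norm_mul, hl, ha]; ring
  · rw [norm_mul, hm, ha]; ring
  · rw [norm_div, hl, hm, div_self (by positivity)]
  · rwa [Ne, div_eq_one_iff_eq hm0]
  · rw [norm_pow, hl]; ring
  · rw [norm_pow, hm]; ring
  · rw [norm_mul, hl, hm]; ring

theorem prod_Ioi_fin_six (f : Fin 6 → Fin 6 → ℂ) :
    ∏ i, ∏ j ∈ Finset.Ioi i, f i j =
      f 0 1 * f 0 2 * f 0 3 * f 0 4 * f 0 5 * (f 1 2 * f 1 3 * f 1 4 * f 1 5) *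
        (f 2 3 * f 2 4 * f 2 5) * (f 3 4 * f 3 5) * f 4 5 := by
  have e0 : Finset.Ioi (0 : Fin 6) = {1, 2, 3, 4, 5} := by decide
  have e1 : Finset.Ioi (1 : Fin 6) = {2, 3, 4, 5} := by decide
  have e2 : Finset.Ioi (2 : Fin 6) = {3, 4, 5} := by decide
  have e3 : Finset.Ioi (3 : Fin 6) = {4, 5} := by decide
  have e4 : Finset.Ioi (4 : Fin 6) = {5} := by decide
  have e5 : Finset.Ioi (5 : Fin 6) = ∅ := by decide
  rw [Fin.prod_univ_six, e0, e1, e2, e3, e4, e5]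
  simp [mul_assoc]

/-- The evaluation of the integral by residues is compared with its evaluation as a two-term sum;
the factors φ(q) cancel. -/
theorem sum_tsum_sixCoef_of_norm (hq0 : q ≠ 0) (hq : ‖q‖ < 1) {ρ : ℝ} (hρ0 : 0 < ρ) (hρ1 : ρ < 1)
    (hqρ : ‖q‖ < ρ ^ 6) {l m : ℂ} {a : Fin 6 → ℂ} (hl : ‖l‖ = ρ ^ 3) (hm : ‖m‖ = ρ ^ 3)
    (ha : ∀ i, ‖a i‖ = ρ) (hinj : Function.Injective a) (hlm : l ≠ m) (h : l * m = ∏ i, a i) :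
    (∑ i, ∑' k, sixCoef q l m a i k) * ∏ i, ∏ j ∈ Finset.Ioi i, φ (a i * a j) =
      2 * (∑' k, bailTerm q l m a k + ∑' k, bailTerm q m l a k) := by
  have hl0 : l ≠ 0 := norm_pos_iff.1 (by rw [hl]; positivity)
  have hm0 : m ≠ 0 := norm_pos_iff.1 (by rw [hm]; positivity)
  have hφ : φ q ≠ 0 := qPochInf_ne_zero_of_norm_lt_one hq0 hq hq
  have hρ : ‖q‖ < ρ := hqρ.trans_le (pow_le_of_le_one hρ0.le hρ1.le (by norm_num))
  have hv : ![a 0, a 1, a 2, a 3, a 4, a 5] = a := by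
    ext i; fin_cases i <;> rfl
  have h1 := sixInt_mul_eq_bailSum hq0 hq hρ0 hρ1 hqρ hl hm (ha 0) (ha 1) (ha 2) (ha 3) (ha 4)
    (ha 5) (fun e => absurd (hinj e) (by decide)) hlm (by rw [h, Fin.prod_univ_six])
  rw [hv] at h1
  rw [← qPochInf_mul_sixInt hq0 hq hl0 hm0 h hρ hρ1 ha hinj,
    ← (bailGen_of_norm hq hρ0 hρ1 hqρ hl hm ha hlm).bailSum_eq_tsum hq0 hq,
    prod_Ioi_fin_six fun i j => φ (a i * a j), mul_assoc, h1, ← mul_assoc,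
    mul_div_cancel₀ _ hφ]

end CircleRegion

/-! ### Analytic continuation off a countable set -/

section Continuation

variable {q : ℂ}

local notation "φ" x:max => qPochInf x q

/-- Zeros of an entire function that is not identically zero are isolated, and a discrete subset of
the plane is countable. -/
theorem countable_zeros_of_differentiable {Φ : ℂ → ℂ} (hΦ : Differentiable ℂ Φ) {w : ℂ}
    (hw : Φ w ≠ 0) : {s | Φ s = 0}.Countable := by
  have h1 : AnalyticOnNhd ℂ Φ Set.univ := fun z _ => hΦ.analyticAt z
  have h2 := h1.preimage_zero_mem_codiscrete hw
  have h3 := (mem_codiscrete'.1 h2).2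
  refine (HereditarilyLindelofSpace.isLindelof {s | Φ s = 0}).countable_of_isDiscrete ?_
  convert h3 using 1
  ext s; simp

/-- If `F` and `G` are analytic off the zeros of an entire function and agree on a line, they agree
everywhere off these zeros. -/
theorem eq_of_eq_on_line {Φ F G : ℂ → ℂ} {w : ℂ} (hΦ : Differentiable ℂ Φ) (hw : Φ w ≠ 0)
    (hF : ∀ s, Φ s ≠ 0 → DifferentiableAt ℂ F s) (hG : ∀ s, Φ s ≠ 0 → DifferentiableAt ℂ G s)
    (h : ∀ s, s.re = 1 → Φ s ≠ 0 → F s = G s) : F w = G w := by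
  have hc := countable_zeros_of_differentiable hΦ hw
  have hU : IsOpen {s | Φ s ≠ 0} := isOpen_ne_fun hΦ.continuous continuous_const
  -- The complement of a countable set in the real plane is path connected.
  have hconn : IsPreconnected {s | Φ s ≠ 0} :=
    (hc.isPathConnected_compl_of_one_lt_rank (by
      rw [rank_real_complex]; exact Cardinal.one_lt_two)).isConnected.isPreconnected
  -- The line is uncountable, so it is not covered by the zeros. Nearby points of the line then
  -- supply the accumulation needed for the identity theorem.
  obtain ⟨t, ht⟩ : ∃ t : ℝ, Φ (1 + t * I) ≠ 0 := by
    by_contra! hcon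
    have hinj : Function.Injective fun t : ℝ => (1 : ℂ) + t * I := fun s t hst => by simpa using hst
    refine Set.not_countable_univ (α := ℝ) ((hc.preimage hinj).mono fun t _ => hcon t)
  have hseq : Tendsto (fun n : ℕ => (1 : ℂ) + t * I + (1 / ((n : ℝ) + 1) : ℝ) * I) atTop
      (𝓝 (1 + t * I)) := by
    have := ((continuous_ofReal.tendsto 0).comp
      (tendsto_one_div_add_atTop_nhds_zero_nat (𝕜 := ℝ))).mul_const I
    simpa using this.const_add ((1 : ℂ) + t * I)
  have hne : ∀ n : ℕ, (1 : ℂ) + t * I + (1 / ((n : ℝ) + 1) : ℝ) * I ≠ 1 + t * I := fun n => by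
    rw [Ne, add_eq_left, mul_eq_zero, ofReal_eq_zero]
    rintro (h0 | h0)
    · exact (by positivity : (1 / ((n : ℝ) + 1)) ≠ 0) h0
    · exact I_ne_zero h0
  have hseq' : Tendsto (fun n : ℕ => (1 : ℂ) + t * I + (1 / ((n : ℝ) + 1) : ℝ) * I) atTop
      (𝓝[≠] (1 + t * I)) :=
    tendsto_nhdsWithin_iff.2 ⟨hseq, Eventually.of_forall hne⟩
  refine AnalyticOnNhd.eqOn_of_preconnected_of_frequently_eq
    (DifferentiableOn.analyticOnNhd (fun s hs => (hF s hs).differentiableWithinAt) hU)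
    (DifferentiableOn.analyticOnNhd (fun s hs => (hG s hs).differentiableWithinAt) hU)
    hconn ht (hseq'.frequently (Eventually.frequently ?_)) hw
  filter_upwards [hseq.eventually (hU.mem_nhds ht)] with n hn
  exact h _ (by simp) hn

theorem qPoch_ne_zero_of_qPochInf (hq : ‖q‖ < 1) {x : ℂ} (h : φ x ≠ 0) (k : ℕ) :
    qPoch x q k ≠ 0 :=
  left_ne_zero_of_mul (qPochInf_eq_qPoch_mul hq x k ▸ h)

theorem qPochInf_mul_pow_ne_zero (hq : ‖q‖ < 1) {x : ℂ} (h : φ x ≠ 0) (k : ℕ) :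
    φ (x * q ^ k) ≠ 0 :=
  right_ne_zero_of_mul (qPochInf_eq_qPoch_mul hq x k ▸ h)

theorem qPochInf_self_mul_div_ne_zero (hq : ‖q‖ < 1) {x y : ℂ} (h : φ (x / y) ≠ 0) :
    φ (q * x / y) ≠ 0 := by
  have := qPochInf_mul_pow_ne_zero hq h 1
  rwa [pow_one, mul_comm, ← mul_div_assoc] at this

theorem ne_of_qPochInf_div_ne_zero (hq : ‖q‖ < 1) {x y : ℂ} (hx : x ≠ 0) (h : φ (x / y) ≠ 0) :
    x ≠ y := by
  rintro rfl
  rw [div_self hx, qPochInf_step hq] at h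
  simp at h

theorem differentiableAt_qPoch_comp {g : ℂ → ℂ} {z : ℂ} (hg : DifferentiableAt ℂ g z) (k : ℕ) :
    DifferentiableAt ℂ (fun z => qPoch (g z) q k) z :=
  (differentiable_qPoch k).differentiableAt.comp z hg

theorem differentiableAt_sixCoef (hq0 : q ≠ 0) (hq : ‖q‖ < 1) {n : ℕ} {l m : ℂ → ℂ}
    {a : Fin n → ℂ → ℂ} {s : ℂ}
    (hl : DifferentiableAt ℂ l s) (hm : DifferentiableAt ℂ m s)
    (ha : ∀ i, DifferentiableAt ℂ (a i) s)
    (hl0 : l s ≠ 0) (hm0 : m s ≠ 0) (ha0 : ∀ i, a i s ≠ 0) (i : Fin n)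
    (h1 : 1 - a i s ^ 2 ≠ 0) (h2 : ∀ j, j ≠ i → φ (a i s * a j s) ≠ 0)
    (h3 : ∀ j, j ≠ i → φ (a j s / a i s) ≠ 0) (h4 : ∀ j, j ≠ i → φ (q * a i s / a j s) ≠ 0)
    (k : ℕ) :
    DifferentiableAt ℂ (fun s => sixCoef q (l s) (m s) (fun j => a j s) i k) s := by
  have c2 : DifferentiableAt ℂ (fun s => a i s ^ 2) s := (ha i).pow 2
  have dφ : ∀ {y : ℂ → ℂ}, DifferentiableAt ℂ y s → DifferentiableAt ℂ (fun s => φ (y s)) s :=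
    fun hy => differentiableAt_qPochInf_comp hq hy
  have dp : ∀ {y : ℂ → ℂ}, DifferentiableAt ℂ y s →
      DifferentiableAt ℂ (fun s => qPoch (y s) q k) s :=
    fun hy => differentiableAt_qPoch_comp hy k
  have hqq := qPochInf_ne_zero_of_norm_lt_one hq0 hq hq
  unfold sixCoef
  refine ((((((c2.mul_const _).const_sub 1).div (c2.const_sub 1) h1).const_mul _).mul (dp c2)).mul
    (dφ (c2.inv (pow_ne_zero 2 (ha0 i))))).mul ((((((dφ (((ha i).mul hl).mul_const _)).mul
    (dφ (((ha i).mul hm).mul_const _))).mul (dφ (hl.div (ha i) (ha0 i)))).mul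
    (dφ (hm.div (ha i) (ha0 i)))).mul (dp (((ha i).const_mul q).div hl hl0))).mul
    (dp (((ha i).const_mul q).div hm hm0))) |>.div
    ((DifferentiableAt.fun_finsetProd fun j hj =>
      ((dφ (((ha i).mul (ha j)).mul_const _)).mul (dφ ((ha j).div (ha i) (ha0 i)))).mul
      (dp (((ha i).const_mul q).div (ha j) (ha0 j)))).const_mul _) ?_
  refine mul_ne_zero (qPoch_ne_zero_of_qPochInf hq hqq k) (Finset.prod_ne_zero_iff.2 fun j hj => ?_)
  have hji := Finset.ne_of_mem_erase hj
  exact mul_ne_zero (mul_ne_zero (qPochInf_mul_pow_ne_zero hq (h2 j hji) k) (h3 j hji))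
    (qPoch_ne_zero_of_qPochInf hq (h4 j hji) k)

theorem differentiableAt_bailTerm (hq0 : q ≠ 0) (hq : ‖q‖ < 1) {n : ℕ} {l m : ℂ → ℂ}
    {a : Fin n → ℂ → ℂ} {s : ℂ}
    (hl : DifferentiableAt ℂ l s) (hm : DifferentiableAt ℂ m s)
    (ha : ∀ i, DifferentiableAt ℂ (a i) s)
    (hl0 : l s ≠ 0) (hm0 : m s ≠ 0) (ha0 : ∀ i, a i s ≠ 0)
    (h1 : φ (l s ^ 2 / q) ≠ 0) (h2 : φ (m s / l s) ≠ 0) (h3 : φ (q * l s / m s) ≠ 0) (k : ℕ) :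
    DifferentiableAt ℂ (fun s => bailTerm q (l s) (m s) (fun j => a j s) k) s := by
  have c2 : DifferentiableAt ℂ (fun s => l s ^ 2 / q) s := (hl.pow 2).div_const q
  have dφ : ∀ {y : ℂ → ℂ}, DifferentiableAt ℂ y s → DifferentiableAt ℂ (fun s => φ (y s)) s :=
    fun hy => differentiableAt_qPochInf_comp hq hy
  have dp : ∀ {y : ℂ → ℂ}, DifferentiableAt ℂ y s →
      DifferentiableAt ℂ (fun s => qPoch (y s) q k) s :=
    fun hy => differentiableAt_qPoch_comp hy k
  have hqq := qPochInf_ne_zero_of_norm_lt_one hq0 hq hq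
  unfold bailTerm
  refine (((((c2.mul_const _).const_sub 1).const_mul _).mul
    (DifferentiableAt.fun_finsetProd fun i _ => ((dφ ((hl.mul (ha i)).mul_const _)).mul
      (dp (hl.div (ha i) (ha0 i)))).mul (dφ (hm.div (ha i) (ha0 i))))).mul
    (dp ((hl.mul hm).div_const q))).div ((((dφ (c2.mul_const _)).const_mul _).mul
    (dφ (hm.div hl hl0))).mul (dp ((hl.const_mul q).div hm hm0))) ?_
  exact mul_ne_zero (mul_ne_zero (mul_ne_zero (qPoch_ne_zero_of_qPochInf hq hqq k)
    (qPochInf_mul_pow_ne_zero hq h1 k)) h2) (qPoch_ne_zero_of_qPochInf hq h3 k)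

end Continuation

/-- The product of the factors that have to be nonzero for the two sides of the six-parameter
identity to be defined. -/
def genProd {n : ℕ} (q l m : ℂ) (a : Fin n → ℂ) : ℂ :=
  (∏ i, (1 - a i ^ 2)) *
    (∏ i, ∏ j ∈ Finset.univ.erase i, qPochInf (a i * a j) q * qPochInf (a j / a i) q) *
    (qPochInf (l ^ 2 / q) q * qPochInf (m ^ 2 / q) q * qPochInf (m / l) q * qPochInf (l / m) q)

/-! ### Continuation to all admissible parameters -/

section GeneralParameters

variable {q : ℂ}

local notation "φ" x:max => qPochInf x q

theorem genProd_ne_zero_iff {n : ℕ} {l m : ℂ} {a : Fin n → ℂ} : genProd q l m a ≠ 0 ↔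
    (∀ i, 1 - a i ^ 2 ≠ 0) ∧ (∀ i j, j ≠ i → φ (a i * a j) ≠ 0 ∧ φ (a j / a i) ≠ 0) ∧
      φ (l ^ 2 / q) ≠ 0 ∧ φ (m ^ 2 / q) ≠ 0 ∧ φ (m / l) ≠ 0 ∧ φ (l / m) ≠ 0 := by
  simp only [genProd, mul_ne_zero_iff, Finset.prod_ne_zero_iff, Finset.mem_univ, Finset.mem_erase,
    true_imp_iff, and_true, and_assoc]

theorem differentiable_genProd (hq : ‖q‖ < 1) {n : ℕ} {l m : ℂ → ℂ} {a : Fin n → ℂ → ℂ}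
    (hl : Differentiable ℂ l) (hm : Differentiable ℂ m) (ha : ∀ i, Differentiable ℂ (a i))
    (hl0 : ∀ s, l s ≠ 0) (hm0 : ∀ s, m s ≠ 0) (ha0 : ∀ i s, a i s ≠ 0) :
    Differentiable ℂ fun s => genProd q (l s) (m s) fun i => a i s := by
  intro s
  have dφ : ∀ {y : ℂ → ℂ}, DifferentiableAt ℂ y s → DifferentiableAt ℂ (fun s => φ (y s)) s :=
    fun hy => differentiableAt_qPochInf_comp hq hy
  unfold genProd
  exact ((DifferentiableAt.fun_finsetProd fun i _ => ((ha i s).pow 2).const_sub 1).mul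
    (DifferentiableAt.fun_finsetProd fun i _ => DifferentiableAt.fun_finsetProd fun j _ =>
      (dφ ((ha i s).mul (ha j s))).mul (dφ ((ha j s).div (ha i s) (ha0 i s))))).mul
    ((((dφ (((hl s).pow 2).div_const q)).mul (dφ (((hm s).pow 2).div_const q))).mul
      (dφ ((hm s).div (hl s) (hl0 s)))).mul (dφ ((hl s).div (hm s) (hm0 s))))

theorem differentiableAt_tsum_sixCoef (hq0 : q ≠ 0) (hq : ‖q‖ < 1) {n : ℕ} {l m : ℂ → ℂ}
    {a : Fin n → ℂ → ℂ}
    (hl : Differentiable ℂ l) (hm : Differentiable ℂ m) (ha : ∀ i, Differentiable ℂ (a i))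
    (hl0 : ∀ s, l s ≠ 0) (hm0 : ∀ s, m s ≠ 0) (ha0 : ∀ i s, a i s ≠ 0) (i : Fin n) {s : ℂ}
    (hs : genProd q (l s) (m s) (fun i => a i s) ≠ 0) :
    DifferentiableAt ℂ (fun s => ∑' k, sixCoef q (l s) (m s) (fun j => a j s) i k) s := by
  obtain ⟨h1, h2, -⟩ := genProd_ne_zero_iff.1 hs
  obtain ⟨f, hf, he⟩ := locBdd_sixCoef hq0 hq (hl s).continuousAt (hm s).continuousAt
    (fun i => (ha i s).continuousAt) (hl0 s) (hm0 s) (fun i => ha0 i s) i (h1 i)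
    (fun j hj => (h2 i j hj).1) (fun j hj => (h2 i j hj).2)
    (fun j hj => qPochInf_self_mul_div_ne_zero hq (h2 j i hj.symm).2)
  simp only [he]
  refine hf.differentiableAt_tsum hq ?_
  filter_upwards [(differentiable_genProd hq hl hm ha hl0 hm0 ha0 s).continuousAt.eventually_ne hs]
    with t ht k
  obtain ⟨h1, h2, -⟩ := genProd_ne_zero_iff.1 ht
  simp only [← he]
  exact differentiableAt_sixCoef hq0 hq (hl t) (hm t) (fun i => ha i t) (hl0 t) (hm0 t)
    (fun i => ha0 i t) i (h1 i) (fun j hj => (h2 i j hj).1) (fun j hj => (h2 i j hj).2)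
    (fun j hj => qPochInf_self_mul_div_ne_zero hq (h2 j i hj.symm).2) k

theorem genProd_swap {n : ℕ} (l m : ℂ) (a : Fin n → ℂ) : genProd q m l a = genProd q l m a := by
  unfold genProd; ring

theorem differentiableAt_tsum_bailTerm (hq0 : q ≠ 0) (hq : ‖q‖ < 1) {n : ℕ} {l m : ℂ → ℂ}
    {a : Fin n → ℂ → ℂ}
    (hl : Differentiable ℂ l) (hm : Differentiable ℂ m) (ha : ∀ i, Differentiable ℂ (a i))
    (hl0 : ∀ s, l s ≠ 0) (hm0 : ∀ s, m s ≠ 0) (ha0 : ∀ i s, a i s ≠ 0) {s : ℂ}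
    (hs : genProd q (l s) (m s) (fun i => a i s) ≠ 0) :
    DifferentiableAt ℂ (fun s => ∑' k, bailTerm q (l s) (m s) (fun j => a j s) k) s := by
  obtain ⟨-, -, h1, -, h2, h3⟩ := genProd_ne_zero_iff.1 hs
  obtain ⟨f, hf, he⟩ := locBdd_bailTerm hq0 hq (hl s).continuousAt (hm s).continuousAt
    (fun i => (ha i s).continuousAt) (hl0 s) (hm0 s) (fun i => ha0 i s) h1 h2
    (qPochInf_self_mul_div_ne_zero hq h3)
  simp only [he]
  refine hf.differentiableAt_tsum hq ?_
  filter_upwards [(differentiable_genProd hq hl hm ha hl0 hm0 ha0 s).continuousAt.eventually_ne hs]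
    with t ht k
  obtain ⟨-, -, h1, -, h2, h3⟩ := genProd_ne_zero_iff.1 ht
  simp only [← he]
  exact differentiableAt_bailTerm hq0 hq (hl t) (hm t) (fun i => ha i t) (hl0 t) (hm0 t)
    (fun i => ha0 i t) h1 h2 (qPochInf_self_mul_div_ne_zero hq h3) k

theorem exists_radius (hq : ‖q‖ < 1) : ∃ ρ : ℝ, 0 < ρ ∧ ρ < 1 ∧ ‖q‖ < ρ ^ 6 := by
  -- Bernoulli's inequality gives ρ⁶ ≥ 1 - 6(1 - |q|)/12 = (1 + |q|)/2 > |q|.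
  refine ⟨1 - (1 - ‖q‖) / 12, by linarith [norm_nonneg q], by linarith, ?_⟩
  have := one_add_mul_le_pow (a := -((1 - ‖q‖) / 12)) (by linarith [norm_nonneg q]) 6
  rw [sub_eq_add_neg]
  push_cast at this
  linarith

/-- The norm of `x` times the exponential of `s log(r/‖x‖)` is `r` on the line `Re s = 1`. -/
theorem norm_mul_exp_of_re_eq_one {x s : ℂ} {r : ℝ} (hx : x ≠ 0) (hr : 0 < r) (hs : s.re = 1) :
    ‖x * exp (s * Real.log (r / ‖x‖))‖ = r := by
  have h0 := norm_pos_iff.2 hx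
  rw [norm_mul, norm_exp, re_mul_ofReal, hs, one_mul, Real.exp_log (by positivity)]
  field_simp

/-- Each parameter x moves along x exp(s log(r/|x|)), which is x at s = 0 and has absolute value r
on Re s = 1, with r = ρ for the a_i and r = ρ³ for l and m. Both sides are analytic in s off the
zeros of the entire function `genProd`, and on that line the circle case applies. -/
theorem sum_tsum_sixCoef (hq0 : q ≠ 0) (hq : ‖q‖ < 1) {l m : ℂ} {a : Fin 6 → ℂ} (hl : l ≠ 0)
    (hm : m ≠ 0) (ha : ∀ i, a i ≠ 0) (h : l * m = ∏ i, a i) (hg : genProd q l m a ≠ 0) :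
    (∑ i, ∑' k, sixCoef q l m a i k) * ∏ i, ∏ j ∈ Finset.Ioi i, φ (a i * a j) =
      2 * (∑' k, bailTerm q l m a k + ∑' k, bailTerm q m l a k) := by
  obtain ⟨ρ, hρ0, hρ1, hqρ⟩ := exists_radius hq
  set P : ℂ → ℝ → ℂ → ℂ := fun x r s => x * exp (s * Real.log (r / ‖x‖)) with hP
  have hP0 : ∀ x r, P x r 0 = x := fun x r => by simp [hP]
  have hPd : ∀ x r, Differentiable ℂ (P x r) := fun x r => by
    simp only [hP]; fun_prop
  have hPn : ∀ {x : ℂ}, x ≠ 0 → ∀ r s, P x r s ≠ 0 := fun hx r s => mul_ne_zero hx (exp_ne_zero _)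
  have hprod : ∀ s, P l (ρ ^ 3) s * P m (ρ ^ 3) s = ∏ i, P (a i) ρ s := by
    intro s
    -- The exponents on the two sides agree because ρ³ρ³ = ρ⁶ and |lm| = ∏|a_i|; hence the balancing
    -- condition holds for every s.
    have e : Real.log (ρ ^ 3 / ‖l‖) + Real.log (ρ ^ 3 / ‖m‖) = ∑ i, Real.log (ρ / ‖a i‖) := by
      have nl := norm_pos_iff.2 hl
      have nm := norm_pos_iff.2 hm
      have na : ∀ i, 0 < ‖a i‖ := fun i => norm_pos_iff.2 (ha i)
      rw [← Real.log_mul (by positivity) (by positivity), ← Real.log_prod (fun i _ => by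
        have := na i; positivity), Finset.prod_div_distrib, ← norm_prod, ← h, norm_mul]
      congr 1
      simp only [Finset.prod_const, Finset.card_univ, Fintype.card_fin]
      field_simp
    simp only [hP]
    rw [Finset.prod_mul_distrib, ← exp_sum, ← Finset.mul_sum, ← ofReal_sum, ← e, ← h, ofReal_add,
      mul_add, exp_add]
    ring
  have key := eq_of_eq_on_line (w := 0)
    (Φ := fun s => genProd q (P l (ρ ^ 3) s) (P m (ρ ^ 3) s) fun i => P (a i) ρ s)
    (F := fun s => (∑ i, ∑' k, sixCoef q (P l (ρ ^ 3) s) (P m (ρ ^ 3) s) (fun i => P (a i) ρ s) i k) *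
      ∏ i, ∏ j ∈ Finset.Ioi i, φ (P (a i) ρ s * P (a j) ρ s))
    (G := fun s => 2 * (∑' k, bailTerm q (P l (ρ ^ 3) s) (P m (ρ ^ 3) s) (fun i => P (a i) ρ s) k +
      ∑' k, bailTerm q (P m (ρ ^ 3) s) (P l (ρ ^ 3) s) (fun i => P (a i) ρ s) k))
    (differentiable_genProd hq (hPd _ _) (hPd _ _) (fun i => hPd _ _) (hPn hl _) (hPn hm _)
      fun i => hPn (ha i) _)
    (by simpa only [hP0] using hg) ?_ ?_ ?_
  · simpa only [hP0] using key
  · intro s hs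
    refine (DifferentiableAt.fun_sum fun i _ => differentiableAt_tsum_sixCoef hq0 hq (hPd _ _)
      (hPd _ _) (fun i => hPd _ _) (hPn hl _) (hPn hm _) (fun i => hPn (ha i) _) i hs).mul
      (DifferentiableAt.fun_finsetProd fun i _ => DifferentiableAt.fun_finsetProd fun j _ =>
        differentiableAt_qPochInf_comp hq ((hPd _ _ s).mul (hPd _ _ s)))
  · intro s hs
    exact ((differentiableAt_tsum_bailTerm hq0 hq (hPd _ _) (hPd _ _) (fun i => hPd _ _)
      (hPn hl _) (hPn hm _) (fun i => hPn (ha i) _) hs).add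
      (differentiableAt_tsum_bailTerm hq0 hq (hPd _ _) (hPd _ _) (fun i => hPd _ _)
      (hPn hm _) (hPn hl _) (fun i => hPn (ha i) _) (by rwa [genProd_swap]))).const_mul 2
  · intro s hs1 hs
    obtain ⟨-, h2, -, -, -, h3⟩ := genProd_ne_zero_iff.1 hs
    refine sum_tsum_sixCoef_of_norm hq0 hq hρ0 hρ1 hqρ
      (norm_mul_exp_of_re_eq_one hl (by positivity) hs1)
      (norm_mul_exp_of_re_eq_one hm (by positivity) hs1)
      (fun i => norm_mul_exp_of_re_eq_one (ha i) hρ0 hs1) (fun i j hij => ?_)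
      (ne_of_qPochInf_div_ne_zero hq (hPn hl _ _) h3) (hprod s)
    by_contra hne
    exact ne_of_qPochInf_div_ne_zero hq (hPn (ha i) _ _) (h2 j i hne).2 hij

end GeneralParameters

/-! ### Translation into very-well-poised series -/

section WellPoised

variable {q : ℂ}

local notation "φ" x:max => qPochInf x q

theorem qPoch_self_mul (x : ℂ) (k : ℕ) :
    (1 - x) * qPoch (q * x) q k = qPoch x q k * (1 - x * q ^ k) := by
  rw [← qPoch_succ, qPoch_succ', mul_comm q x]

/-- Each of the two ratios telescopes to (1 ∓ xq^k)/(1 ∓ x); only x² survives in their product. -/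
theorem qPoch_sqrt_ratio {x b : ℂ} (hb : x ^ 2 = b) {k : ℕ} (h1 : 1 - x ≠ 0) (h2 : 1 + x ≠ 0)
    (h3 : qPoch x q k ≠ 0) (h4 : qPoch (-x) q k ≠ 0) :
    qPoch (q * x) q k * qPoch (-(q * x)) q k / (qPoch x q k * qPoch (-x) q k) =
      (1 - b * q ^ (2 * k)) / (1 - b) := by
  have e1 := qPoch_self_mul (q := q) x k
  have e2 := qPoch_self_mul (q := q) (-x) k
  rw [mul_neg, sub_neg_eq_add] at e2
  have h5 : 1 - b ≠ 0 := by
    rw [← hb]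
    have := mul_ne_zero h1 h2
    intro h
    exact this (by linear_combination h)
  rw [div_eq_div_iff (mul_ne_zero h3 h4) h5, ← hb]
  linear_combination (1 + x) * qPoch (-(q * x)) q k * e1 + qPoch x q k * (1 - x * q ^ k) * e2

theorem sq_sqrt (b : ℂ) : sqrt b ^ 2 = b := by
  rw [sqrt, ← cpow_nat_mul]
  simp

theorem list_prod_map_div {ι : Type*} (as : List ι) (f g : ι → ℂ) :
    (as.map fun c => f c / g c).prod = (as.map f).prod / (as.map g).prod := by
  induction as with
  | nil => simp
  | cons c as ih => simp only [List.map_cons, List.prod_cons, ih, div_mul_div_comm]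

theorem vwpTerm_eq (hq : ‖q‖ < 1) {b : ℂ} (h1 : φ (sqrt b) ≠ 0) (h2 : φ (-sqrt b) ≠ 0)
    (as : List ℂ) (z : ℂ) (k : ℕ) :
    vwpTerm b as q z k = z ^ k * ((1 - b * q ^ (2 * k)) / (1 - b)) * (qPoch b q k / qPoch q q k) *
      (as.map fun c => qPoch c q k / qPoch (q * b / c) q k).prod := by
  have hs := sq_sqrt b
  have n1 : 1 - sqrt b ≠ 0 := left_ne_zero_of_mul (qPochInf_step hq (sqrt b) ▸ h1)
  have n2 : 1 + sqrt b ≠ 0 := by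
    have := left_ne_zero_of_mul (qPochInf_step hq (-sqrt b) ▸ h2)
    rwa [sub_neg_eq_add] at this
  rw [← qPoch_sqrt_ratio hs n1 n2 (qPoch_ne_zero_of_qPochInf hq h1 k)
    (qPoch_ne_zero_of_qPochInf hq h2 k), list_prod_map_div]
  -- The series has one more numerator than denominator parameter, so the quadratic power of q has
  -- exponent zero.
  have e : (((([sqrt b, -sqrt b] ++ as.map fun x => q * b / x).length : ℕ) : ℤ) + 1 -
      (([q * sqrt b, -(q * sqrt b), b] ++ as).length : ℕ)) = 0 := by
    simp only [List.length_append, List.length_cons, List.length_nil, List.length_map]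
    push_cast; ring
  rw [vwpTerm, phiTerm, e, zpow_zero, mul_one]
  simp only [qPochs, List.cons_append, List.nil_append, List.map_cons, List.prod_cons, List.map_map,
    Function.comp_def]
  simp only [div_eq_mul_inv, mul_inv]
  ring

theorem summable_vwpTerm (hq0 : q ≠ 0) (hq : ‖q‖ < 1) {b : ℂ} (h1 : φ (sqrt b) ≠ 0)
    (h2 : φ (-sqrt b) ≠ 0) {as : List ℂ} (h : ∀ c ∈ as, φ (q * b / c) ≠ 0) :
    Summable (vwpTerm b as q q) := by
  have hqq := qPochInf_ne_zero_of_norm_lt_one hq0 hq hq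
  have hc : ∀ y : ℂ, ContinuousAt (fun _ : ℂ => y) 0 := fun y => continuousAt_const
  have B : LocBdd (fun _ k => (as.map fun c => qPoch c q k / qPoch (q * b / c) q k).prod) 0 := by
    induction as with
    | nil => simpa using LocBdd.of_continuousAt (hc 1)
    | cons c as ih =>
      simp only [List.map_cons, List.prod_cons, div_eq_mul_inv (qPoch _ q _)]
      have := ((LocBdd.qPoch hq (hc c)).mul (.inv_qPoch hq (hc (q * b / c)) (h c (by simp)))).mul
        (ih fun c' hc' => h c' (by simp [hc']))
      simpa only [div_eq_mul_inv (qPoch _ q _)] using this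
  have B' := ((LocBdd.one_sub_mul_pow hq (hc b) fun k => 2 * k).mul
    (.of_continuousAt (hc (1 - b)⁻¹))).mul
    (((LocBdd.qPoch hq (hc b)).mul (.inv_qPoch hq (hc q) hqq)).mul B)
  refine (B'.summable_pow_mul hq).congr fun k => ?_
  rw [vwpTerm_eq hq h1 h2]
  simp only [div_eq_mul_inv]
  ring

/-- Only the unordered pair ±√b enters the series, so the branch of the square root is immaterial.
-/
theorem sqrt_sq_eq_or (x : ℂ) : sqrt (x ^ 2) = x ∨ sqrt (x ^ 2) = -x :=
  sq_eq_sq_iff_eq_or_eq_neg.1 (sq_sqrt _)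

theorem qPochInf_sqrt_sq_ne_zero {x : ℂ} (h1 : φ x ≠ 0) (h2 : φ (-x) ≠ 0) :
    φ (sqrt (x ^ 2)) ≠ 0 ∧ φ (-sqrt (x ^ 2)) ≠ 0 := by
  rcases sqrt_sq_eq_or x with h | h <;> rw [h]
  · exact ⟨h1, h2⟩
  · rw [neg_neg]; exact ⟨h2, h1⟩

theorem not_mem_Omega_of_sq {x : ℂ} (h : x ^ 2 ∉ Omega q) : x ∉ Omega q := by
  rintro ⟨k, rfl⟩
  exact h ⟨k * 2, by rw [inv_pow, pow_mul]⟩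

theorem qPochInf_sqrt_ne_zero (hq0 : q ≠ 0) (hq : ‖q‖ < 1) {b : ℂ} (h : φ b ≠ 0) :
    φ (sqrt b) ≠ 0 ∧ φ (-sqrt b) ≠ 0 := by
  have h' := (qPochInf_ne_zero_iff hq0 hq).1 h
  constructor 
  · exact qPochInf_ne_zero hq0 hq (not_mem_Omega_of_sq (by rwa [sq_sqrt]))
  · exact qPochInf_ne_zero hq0 hq (not_mem_Omega_of_sq (by rwa [neg_sq, sq_sqrt]))

/-- φ(l²/q) = (1 - l²/q) φ(l²); the first factor is the reason for the separate condition l² ≠ q. -/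
theorem qPochInf_sq_div_ne_zero (hq0 : q ≠ 0) (hq : ‖q‖ < 1) {l : ℂ} (h : l ^ 2 ∉ Omega q)
    (h' : l ^ 2 ≠ q) : φ (l ^ 2 / q) ≠ 0 := by
  rw [qPochInf_step hq, div_mul_cancel₀ _ hq0]
  refine mul_ne_zero (sub_ne_zero.2 fun e => h' ?_) (qPochInf_ne_zero hq0 hq h)
  rw [eq_comm, div_eq_one_iff_eq hq0] at e
  exact e

theorem prod_erase_zero_fin_six (g : Fin 6 → ℂ) :
    ∏ j ∈ Finset.univ.erase 0, g j = ∏ j : Fin 5, g j.succ := by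
  have : Finset.univ.erase (0 : Fin 6) = Finset.univ.image Fin.succ := by decide
  rw [this, Finset.prod_image (Fin.succ_injective 5).injOn]

theorem sixCoef_comp_swap (l m : ℂ) (a : Fin 6 → ℂ) (i : Fin 6) (k : ℕ) :
    sixCoef q l m (a ∘ Equiv.swap 0 i) 0 k = sixCoef q l m a i k := by
  simp only [sixCoef, Function.comp_apply, Equiv.swap_apply_left]
  congr 2
  refine Finset.prod_equiv (Equiv.swap 0 i) (fun j => ?_) fun j _ => rfl
  simp only [Finset.mem_erase, Finset.mem_univ, and_true]
  rw [← (Equiv.swap 0 i).injective.ne_iff, Equiv.swap_apply_left]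

/-- The well-poised partners of qa₀/l and qa₀/m are a₀l and a₀m. The prefactor merges with the
finite products through φ(c) = (c;q)_k φ(cq^k). -/
theorem mul_vwpTerm_sixParams (hq : ‖q‖ < 1) (hq0 : q ≠ 0) {l m : ℂ} {a : Fin 6 → ℂ} (hl : l ≠ 0)
    (hm : m ≠ 0) (ha : ∀ i, a i ≠ 0) (h1 : φ (a 0) ≠ 0) (h2 : φ (-a 0) ≠ 0)
    (h3 : φ (a 0 * l) ≠ 0) (h4 : φ (a 0 * m) ≠ 0) (h5 : ∀ j, j ≠ 0 → φ (a 0 * a j) ≠ 0) (k : ℕ) :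
    qPochInfs [(a 0 ^ 2)⁻¹, a 0 * l, a 0 * m, l / a 0, m / a 0] q /
      qPochInfs ((List.ofFn fun j : Fin 5 => a 0 * a j.succ) ++
        List.ofFn fun j : Fin 5 => a j.succ / a 0) q *
      vwpTerm (a 0 ^ 2) (sixParams q l m a) q q k = sixCoef q l m a 0 k := by
  obtain ⟨s1, s2⟩ := qPochInf_sqrt_sq_ne_zero h1 h2
  have a0 := ha 0
  have e1 : ∀ j : Fin 5, q * a 0 ^ 2 / (a 0 * a j.succ) = q * a 0 / a j.succ := fun j => by
    have := ha j.succ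
    field_simp
  have e2 : q * a 0 ^ 2 / (q * a 0 / l) = a 0 * l := by field_simp
  have e3 : q * a 0 ^ 2 / (q * a 0 / m) = a 0 * m := by field_simp
  rw [vwpTerm_eq hq s1 s2]
  simp only [sixParams, sixCoef, prod_erase_zero_fin_six, qPochInfs, List.map_append, List.prod_append,
    List.map_ofFn, List.prod_ofFn, List.map_cons, List.map_nil, List.prod_cons, List.prod_nil,
    Function.comp_apply, mul_one, e1, e2, e3, Finset.prod_mul_distrib, Finset.prod_div_distrib]
  have f : ∏ j : Fin 5, φ (a 0 * a j.succ) = (∏ j : Fin 5, qPoch (a 0 * a j.succ) q k) *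
      ∏ j : Fin 5, φ (a 0 * a j.succ * q ^ k) := by
    rw [← Finset.prod_mul_distrib]
    exact Finset.prod_congr rfl fun j _ => qPochInf_eq_qPoch_mul hq _ k
  have f0 : ∏ j : Fin 5, qPoch (a 0 * a j.succ) q k ≠ 0 := Finset.prod_ne_zero_iff.2 fun j _ =>
    qPoch_ne_zero_of_qPochInf hq (h5 _ (Fin.succ_ne_zero j)) k
  have g := qPoch_ne_zero_of_qPochInf hq h3 k
  have g' := qPoch_ne_zero_of_qPochInf hq h4 k
  rw [f, qPochInf_eq_qPoch_mul hq (a 0 * l) k, qPochInf_eq_qPoch_mul hq (a 0 * m) k]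
  simp only [div_eq_mul_inv, mul_inv]
  generalize ∏ j : Fin 5, qPoch (a 0 * a j.succ) q k = A at *
  generalize qPoch (a 0 * l) q k = B at *
  generalize qPoch (a 0 * m) q k = C at *
  -- Only these three finite products have to be cancelled. Everything else is an identity in formal
  -- inverses, with no further nonvanishing needed.
  have h1 : A * A⁻¹ * (B * B⁻¹) * (C * C⁻¹) = 1 := by
    rw [mul_inv_cancel₀ f0, mul_inv_cancel₀ g, mul_inv_cancel₀ g', one_mul, one_mul]
  refine Eq.trans ?_ ((congrArg (· * _) h1).trans (one_mul _))
  ring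

/-- The balancing condition turns the last parameter into lm/q, whose well-poised partner is ql/m.
-/
theorem mul_vwpTerm_twoParams (hq : ‖q‖ < 1) (hq0 : q ≠ 0) {l m : ℂ} {a : Fin 6 → ℂ} (hl : l ≠ 0)
    (hm : m ≠ 0) (ha : ∀ i, a i ≠ 0) (h : l * m = ∏ i, a i) (h1 : φ (l ^ 2 / q) ≠ 0)
    (h2 : ∀ i, φ (l * a i) ≠ 0) (k : ℕ) :
    qPochInfs ((List.ofFn fun i : Fin 6 => l * a i) ++ List.ofFn fun i : Fin 6 => m / a i) q /
        qPochInfs [l ^ 2, m / l] q *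
      vwpTerm (l ^ 2 / q) (twoParams q a l) q q k = bailTerm q l m a k := by
  obtain ⟨s1, s2⟩ := qPochInf_sqrt_ne_zero hq0 hq h1
  have e1 : ∀ i, q * (l ^ 2 / q) / (l / a i) = l * a i := fun i => by
    have := ha i
    field_simp
  have e2 : q * (l ^ 2 / q) / (l * m / q) = q * l / m := by field_simp
  rw [vwpTerm_eq hq s1 s2]
  simp only [twoParams, bailTerm, ← h, qPochInfs, List.map_append, List.prod_append,
    List.map_ofFn, List.prod_ofFn, List.map_cons, List.map_nil, List.prod_cons, List.prod_nil,
    Function.comp_apply, mul_one, e1, e2, Finset.prod_mul_distrib, Finset.prod_div_distrib]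
  have f : ∏ i, φ (l * a i) = (∏ i, qPoch (l * a i) q k) * ∏ i, φ (l * a i * q ^ k) := by
    rw [← Finset.prod_mul_distrib]
    exact Finset.prod_congr rfl fun j _ => qPochInf_eq_qPoch_mul hq _ k
  have f0 : ∏ i, qPoch (l * a i) q k ≠ 0 := Finset.prod_ne_zero_iff.2 fun i _ =>
    qPoch_ne_zero_of_qPochInf hq (h2 i) k
  have g : φ (l ^ 2 / q * q ^ k) = (1 - l ^ 2 / q) * φ (l ^ 2) / qPoch (l ^ 2 / q) q k := by
    rw [eq_div_iff (qPoch_ne_zero_of_qPochInf hq h1 k), mul_comm, ← qPochInf_eq_qPoch_mul hq,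
      qPochInf_step hq (l ^ 2 / q), div_mul_cancel₀ _ hq0]
  rw [f, g]
  simp only [div_eq_mul_inv, mul_inv, inv_inv]
  generalize ∏ i, qPoch (l * a i) q k = A at *
  have h1 : A * A⁻¹ = 1 := mul_inv_cancel₀ f0
  refine Eq.trans ?_ ((congrArg (· * _) h1).trans (one_mul _))
  ring

theorem sixTerm_comp_swap (hq : ‖q‖ < 1) (hq0 : q ≠ 0) {l m : ℂ} {a : Fin 6 → ℂ} (hl : l ≠ 0)
    (hm : m ≠ 0) (ha : ∀ i, a i ≠ 0) (i : Fin 6) (h1 : φ (a i) ≠ 0) (h2 : φ (-a i) ≠ 0)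
    (h3 : φ (a i * l) ≠ 0) (h4 : φ (a i * m) ≠ 0) (h5 : ∀ j, j ≠ i → φ (a i * a j) ≠ 0) :
    sixTerm q l m (a ∘ Equiv.swap 0 i) = ∑' k, sixCoef q l m a i k := by
  have e := Equiv.swap_apply_left 0 i
  rw [sixTerm, vwpW, ← tsum_mul_left]
  refine tsum_congr fun k => ?_
  rw [← sixCoef_comp_swap]
  refine mul_vwpTerm_sixParams hq hq0 hl hm (fun j => ha _) (by rwa [e]) (by rwa [e]) (by rwa [e])
    (by rwa [e]) (fun j hj => ?_) k
  rw [e]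
  refine h5 _ fun hji => hj ?_
  exact (Equiv.swap 0 i).injective (hji.trans e.symm)

theorem twoTerm_eq (hq : ‖q‖ < 1) (hq0 : q ≠ 0) {l m : ℂ} {a : Fin 6 → ℂ} (hl : l ≠ 0)
    (hm : m ≠ 0) (ha : ∀ i, a i ≠ 0) (h : l * m = ∏ i, a i) (h1 : φ (l ^ 2 / q) ≠ 0)
    (h2 : ∀ i, φ (l * a i) ≠ 0) :
    twoTerm q a ![l, m] =
      (∑' k, bailTerm q l m a k) / ∏ i, ∏ j ∈ Finset.Ioi i, φ (a i * a j) := by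
  rw [← tsum_congr (mul_vwpTerm_twoParams hq hq0 hl hm ha h h1 h2), tsum_mul_left]
  simp only [twoTerm, vwpW, Matrix.cons_val_zero, Matrix.cons_val_one]
  rw [mul_comm (∏ i, ∏ j ∈ Finset.Ioi i, φ (a i * a j)), ← div_div]
  ring

theorem summable_vwpTerm_sixParams (hq : ‖q‖ < 1) (hq0 : q ≠ 0) {l m : ℂ} {a : Fin 6 → ℂ}
    (hl : l ≠ 0) (hm : m ≠ 0) (ha : ∀ i, a i ≠ 0) (h1 : φ (a 0) ≠ 0) (h2 : φ (-a 0) ≠ 0)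
    (h3 : φ (a 0 * l) ≠ 0) (h4 : φ (a 0 * m) ≠ 0) (h5 : ∀ j, j ≠ 0 → φ (a 0 / a j) ≠ 0) :
    Summable (vwpTerm (a 0 ^ 2) (sixParams q l m a) q q) := by
  obtain ⟨s1, s2⟩ := qPochInf_sqrt_sq_ne_zero h1 h2
  have a0 := ha 0
  refine summable_vwpTerm hq0 hq s1 s2 fun c hc => ?_
  simp only [sixParams, List.mem_append, List.mem_ofFn, List.mem_cons, List.not_mem_nil,
    or_false] at hc
  rcases hc with ⟨j, rfl⟩ | rfl | rfl
  · have := ha j.succ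
    rw [show q * a 0 ^ 2 / (a 0 * a j.succ) = q * a 0 / a j.succ by field_simp]
    exact qPochInf_self_mul_div_ne_zero hq (h5 _ (Fin.succ_ne_zero j))
  · rwa [show q * a 0 ^ 2 / (q * a 0 / l) = a 0 * l by field_simp]
  · rwa [show q * a 0 ^ 2 / (q * a 0 / m) = a 0 * m by field_simp]

theorem summable_vwpTerm_twoParams (hq : ‖q‖ < 1) (hq0 : q ≠ 0) {l m : ℂ} {a : Fin 6 → ℂ}
    (hl : l ≠ 0) (hm : m ≠ 0) (ha : ∀ i, a i ≠ 0) (h : l * m = ∏ i, a i) (h1 : φ (l ^ 2 / q) ≠ 0)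
    (h2 : ∀ i, φ (l * a i) ≠ 0) (h3 : φ (l / m) ≠ 0) :
    Summable (vwpTerm (l ^ 2 / q) (twoParams q a l) q q) := by
  obtain ⟨s1, s2⟩ := qPochInf_sqrt_ne_zero hq0 hq h1
  refine summable_vwpTerm hq0 hq s1 s2 fun c hc => ?_
  simp only [twoParams, ← h, List.mem_append, List.mem_ofFn, List.mem_cons, List.not_mem_nil,
    or_false] at hc
  rcases hc with ⟨i, rfl⟩ | rfl
  · have := ha i
    rw [show q * (l ^ 2 / q) / (l / a i) = l * a i by field_simp]
    exact h2 i
  · rw [show q * (l ^ 2 / q) / (l * m / q) = q * l / m by field_simp]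
    exact qPochInf_self_mul_div_ne_zero hq h3

end WellPoised

end BasicHyp

end

/-! ### Proof of the identity -/

open BasicHyp

theorem mainTheorem6 (q lam mu : ℂ) (a : Fin 6 → ℂ)
    (hq0 : q ≠ 0) (hq1 : ‖q‖ < 1)
    (ha : ∀ i, a i ≠ 0) (hlam : lam ≠ 0) (hmu : mu ≠ 0)
    (hprod : lam * mu = ∏ i, a i)
    -- no denominator factor on either side vanishes, so that all expressions are defined
    (hpair : ∀ i j, i ≠ j → a i * a j ∉ BasicHyp.Omega q)
    (hquot : ∀ i j, i ≠ j → a j / a i ∉ BasicHyp.Omega q)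
    (hsqrt : ∀ i, a i ∉ BasicHyp.Omega q ∧ -a i ∉ BasicHyp.Omega q)
    (hal : ∀ i, a i * lam ∉ BasicHyp.Omega q) (ham : ∀ i, a i * mu ∉ BasicHyp.Omega q)
    (hl2 : lam ^ 2 ∉ BasicHyp.Omega q) (hm2 : mu ^ 2 ∉ BasicHyp.Omega q)
    (hlq : lam ^ 2 ≠ q) (hmq : mu ^ 2 ≠ q)
    (hml : mu / lam ∉ BasicHyp.Omega q) (hlm : lam / mu ∉ BasicHyp.Omega q) :
    (∀ k : Fin 6, Summable (BasicHyp.vwpTerm (a k ^ 2)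
        (BasicHyp.sixParams q lam mu (a ∘ Equiv.swap 0 k)) q q)) ∧
    (∀ l : ℂ, l = lam ∨ l = mu → Summable (BasicHyp.vwpTerm (l ^ 2 / q)
        (BasicHyp.twoParams q a l) q q)) ∧
    BasicHyp.idemSum (BasicHyp.sixTerm q lam mu) a =
      2 * BasicHyp.idemSum (BasicHyp.twoTerm q a) ![lam, mu] := by
  have nz : ∀ {x : ℂ}, x ∉ Omega q → qPochInf x q ≠ 0 := fun hx => qPochInf_ne_zero hq0 hq1 hx
  have nl := qPochInf_sq_div_ne_zero hq0 hq1 hl2 hlq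
  have nm := qPochInf_sq_div_ne_zero hq0 hq1 hm2 hmq
  have nla : ∀ i, qPochInf (lam * a i) q ≠ 0 := fun i => mul_comm (a i) lam ▸ nz (hal i)
  have nma : ∀ i, qPochInf (mu * a i) q ≠ 0 := fun i => mul_comm (a i) mu ▸ nz (ham i)
  have hprod' : mu * lam = ∏ i, a i := by rw [mul_comm, hprod]
  refine ⟨fun k => ?_, ?_, ?_⟩
  · have e := Equiv.swap_apply_left 0 k
    have := summable_vwpTerm_sixParams (a := a ∘ Equiv.swap 0 k) hq1 hq0 hlam hmu (fun j => ha _)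
      (nz (by simpa using (hsqrt k).1)) (nz (by simpa using (hsqrt k).2))
      (nz (by simpa using hal k)) (nz (by simpa using ham k))
      (fun j hj => nz (hquot _ _ ((Equiv.swap 0 k).injective.ne hj)))
    rwa [Function.comp_apply, e] at this
  · rintro l (rfl | rfl)
    · exact summable_vwpTerm_twoParams hq1 hq0 hlam hmu ha hprod nl nla (nz hlm)
    · exact summable_vwpTerm_twoParams hq1 hq0 hmu hlam ha hprod' nm nma (nz hml)
  · have hP : ∏ i, ∏ j ∈ Finset.Ioi i, qPochInf (a i * a j) q ≠ 0 :=
      Finset.prod_ne_zero_iff.2 fun i _ => Finset.prod_ne_zero_iff.2 fun j hj =>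
        nz (hpair i j (Finset.mem_Ioi.1 hj).ne)
    -- Since 1 = q⁰ lies in Ω_q, the conditions on a_i and -a_i exclude a_i = ±1.
    have h1 : ∀ i, 1 - a i ^ 2 ≠ 0 := fun i h => by
      have h' : (1 - a i) * (1 + a i) = 0 := by linear_combination h
      rcases mul_eq_zero.1 h' with h' | h'
      · exact (hsqrt i).1 ⟨0, by simpa using (sub_eq_zero.1 h').symm⟩
      · exact (hsqrt i).2 ⟨0, by simpa using (eq_neg_of_add_eq_zero_left h').symm⟩
    have key := sum_tsum_sixCoef hq0 hq1 hlam hmu ha hprod (genProd_ne_zero_iff.2 ⟨h1, fun i j hj =>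
      ⟨nz (hpair i j hj.symm), nz (hquot i j hj.symm)⟩, nl, nm, nz hml, nz hlm⟩)
    have hswap : ![lam, mu] ∘ Equiv.swap (0 : Fin 2) 1 = ![mu, lam] := by
      ext i; fin_cases i <;> simp
    have hleft : idemSum (sixTerm q lam mu) a = ∑ i, ∑' k, sixCoef q lam mu a i k :=
      Finset.sum_congr rfl fun i _ => sixTerm_comp_swap hq1 hq0 hlam hmu ha i (nz (hsqrt i).1)
        (nz (hsqrt i).2) (nz (hal i)) (nz (ham i)) fun j hj => nz (hpair i j hj.symm)
    have hright : idemSum (twoTerm q a) ![lam, mu] =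
        (∑' k, bailTerm q lam mu a k + ∑' k, bailTerm q mu lam a k) /
          ∏ i, ∏ j ∈ Finset.Ioi i, qPochInf (a i * a j) q := by
      rw [idemSum, Fin.sum_univ_two, Equiv.swap_self, Equiv.coe_refl, Function.comp_id, hswap,
        twoTerm_eq hq1 hq0 hlam hmu ha hprod nl nla, twoTerm_eq hq1 hq0 hmu hlam ha hprod' nm nma,
        add_div]
    rw [hleft, hright, ← mul_div_assoc, ← key, mul_div_cancel_right₀ _ hP]
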